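/- **Notation.** Let $H_+=\{z\in\mathbb C : \mathrm{Im}\,z>0\}$. For $\tau,\sigma\in H_+$, $\kappa\in\mathbb Z$, $\kappa\ge 4$, and $l\in\mathbb Z$ put $$\theta(\lambda,\tau)=-\sum_{n\in\mathbb Z+1/2}e^{\pi i(n^2\tau+n(2\lambda+1))},\qquad \theta_{l,\kappa}(\lambda,\tau)=\sum_{n\in\mathbb Z+\frac{l}{2\kappa}}e^{2\pi i\kappa(n^2\tau+n\lambda)},$$ $$\Omega_{a}(t,\tau,\sigma)=\prod_{j,k=0}^\infty\frac{(1-e^{2\pi i(t-a+j\tau+k\sigma)})(1-e^{2\pi i(-t-a+(j+1)\tau+(k+1)\sigma)})}{(1-e^{2\pi i(t+a+j\tau+k\sigma)})(1-e^{2\pi i(-t+a+(j+1)\tau+(k+1)\sigma)})}.$$ For an entire $1$-periodic function $f$, the integral $$\int_\gamma \Omega_{2\eta}(t,\tau,\sigma)\,\frac{f(t)}{\theta(t-2\eta,\tau)\,\theta(t-2\eta,\sigma)}\,dt$$ is taken over $\gamma=[0,1]$ if $\mathrm{Im}\,\eta>0$. For all other $\eta$ with $4\eta+l+m\tau+n\sigma\ne0$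 for all integers $l,m,n$ with $m,n\ge0$, it is defined by analytic continuation in $\eta$ with $\tau,\sigma,f$ fixed, i.e. $\gamma$ is deformed so that it still separates the poles $2\eta+l+m\tau+n\sigma$ from the poles $-(2\eta+l+m\tau+n\sigma)$, where $l,m,n\in\mathbb Z$ and $m,n\ge0$. Set $$u(\lambda,\mu,\tau,\sigma,\eta)=e^{-\frac{\pi i\lambda\mu}{2\eta}}\int_\gamma\Omega_{2\eta}(t,\tau,\sigma)\frac{\theta(\lambda+t,\tau)\theta(\mu+t,\sigma)}{\theta(t-2\eta,\tau)\theta(t-2\eta,\sigma)}\,dt,\qquad Q(\mu,\sigma,\eta)=\frac{\theta(4\eta,\sigma)\,\theta'(0,\sigma)}{\theta(\mu-2\eta,\sigma)\,\theta(\mu+2\eta,\sigma)},$$ where the prime is the derivative in the first argument. An integer $l$ is *admissible* if $l\not\equiv\pm1\pmod\kappa$. For admissible $l$ set $$\widetilde\Delta_{l,\kappa}(\lambda,\tau,\eta)=\sum_{j\in2\kappa\mathbb Z+l}u(\lambda,2\eta j,\tau,-2\eta\kappa,\eta)\,Q(2\eta j,-2\eta\kappa,\eta)\,e^{\pi i\frac{\tau+4\eta}{2\kappa}j^2},$$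 $$\Delta_{l,\kappa}(\lambda,\tau,\eta)=\widetilde\Delta_{l,\kappa}(\lambda,\tau,\eta)-\widetilde\Delta_{l,\kappa}(-\lambda,\tau,\eta).$$ Let $E_\kappa(\tau,\eta)$ be the space of odd entire functions $f$ of $\lambda$ with $f(\lambda+2r+2s\tau)=e^{-2\pi i(\kappa+2)(s^2\tau+s\lambda)}f(\lambda)$ for all $r,s\in\mathbb Z$ which vanish at all points of $2\eta j+\mathbb Z+\mathbb Z\tau$, $j=-1,0,1$. **Theorem.** Let $\kappa\ge4$ be an integer, $\mathrm{Im}\,\eta<0$ and $\tau\in H_+$, and suppose that $j\tau+4\eta\notin\mathbb Z$ for every $j=1,2,\dots$. (i) For every admissible $l$ all terms of the series $\widetilde\Delta_{l,\kappa}$ are defined, the series converges (absolutely) for every $\lambda\in\mathbb C$, and its sum $\lambda\mapsto\widetilde\Delta_{l,\kappa}(\lambda,\tau,\eta)$ is an entire function. (ii) For every admissible $l$ and every $\lambda\in\mathbb C$, $$\widetilde\Delta_{l,\kappa}(\lambda,\tau,\eta)=e^{\frac{2\pi i\eta}{\kappa}l^2}\,I_{l,\kappa}(\lambda,\tau,\eta)\,Q(2\eta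 l,-2\eta\kappa,\eta),$$ where the integral $$I_{l,\kappa}(\lambda,\tau,\eta)=\int_\gamma\Omega_{2\eta}(t,\tau,-2\eta\kappa)\,\frac{\theta(\lambda+t,\tau)\,\theta(2\eta l+t,-2\eta\kappa)}{\theta(t-2\eta,\tau)\,\theta(t-2\eta,-2\eta\kappa)}\,e^{-2\pi ilt/\kappa}\,\theta_{l,\kappa}\!\left(\tfrac2\kappa t-\lambda,\tau\right)dt$$ is defined. (iii) The functions $\lambda\mapsto\Delta_{l,\kappa}(\lambda,\tau,\eta)$, $l=2,\dots,\kappa-2$, form a basis of $E_\kappa(\tau,\eta)$, which therefore has dimension $\kappa-3$. -/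

import Mathlib

noncomputable section

namespace HypergeometricTheta

open Complex

/-! ### Theta functions -/

/-- Jacobi's first theta function
`θ(z, τ) = -∑_{n ∈ ℤ + 1/2} exp(π i (n² τ + n (2 z + 1)))`. -/
def theta (z τ : ℂ) : ℂ :=
  -∑' m : ℤ, exp (Real.pi * I * (((m : ℂ) + 1 / 2) ^ 2 * τ + ((m : ℂ) + 1 / 2) * (2 * z + 1)))

/-- The theta function of level `κ`
`θ_{l,κ}(z, τ) = ∑_{n ∈ ℤ + l/(2κ)} exp(2 π i κ (n² τ + n z))`. -/
def thetaLevel (l : ℤ) (κ : ℕ) (z τ : ℂ) : ℂ :=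
  ∑' m : ℤ, exp (2 * Real.pi * I * κ *
    (((m : ℂ) + l / (2 * κ)) ^ 2 * τ + ((m : ℂ) + l / (2 * κ)) * z))

/-- The space `Θ_k(τ)` of theta functions of level `k`: entire functions with
`f(z + 2 r + 2 s τ) = exp(-2 π i k (s² τ + s z)) f(z)` for all integers `r`, `s`. -/
def thetaSpace (k : ℕ) (τ : ℂ) : Submodule ℂ (ℂ → ℂ) where
  carrier := {f | Differentiable ℂ f ∧ ∀ (z : ℂ) (r s : ℤ),
    f (z + 2 * r + 2 * s * τ) = exp (-2 * Real.pi * I * k * ((s : ℂ) ^ 2 * τ + s * z)) * f z}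
  add_mem' := by
    rintro f g ⟨hf, hf'⟩ ⟨hg, hg'⟩
    exact ⟨hf.add hg, fun z r s => by simp only [Pi.add_apply, hf', hg']; ring⟩
  zero_mem' := ⟨differentiable_const 0, fun z r s => by simp⟩
  smul_mem' := by
    rintro c f ⟨hf, hf'⟩
    exact ⟨hf.const_smul c, fun z r s => by simp only [Pi.smul_apply, smul_eq_mul, hf']; ring⟩

/-- The space `E_κ(τ, η)` of odd theta functions of level `κ + 2` vanishing at all the points
of `2 η j + ℤ + ℤ τ`, for `j = -1, 0, 1`. -/
def oddVanishingSpace (κ : ℕ) (τ η : ℂ) : Submodule ℂ (ℂ → ℂ) where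
  carrier := {f | f ∈ thetaSpace (κ + 2) τ ∧ (∀ z, f (-z) = -f z) ∧
    ∀ j : ℤ, -1 ≤ j → j ≤ 1 → ∀ r s : ℤ, f (2 * η * j + r + s * τ) = 0}
  add_mem' := by
    rintro f g ⟨hf, hf', hf''⟩ ⟨hg, hg', hg''⟩
    exact ⟨add_mem hf hg, fun z => by simp only [Pi.add_apply, hf', hg']; ring,
      fun j h1 h2 r s => by simp [hf'' j h1 h2 r s, hg'' j h1 h2 r s]⟩
  zero_mem' := ⟨zero_mem _, fun z => by simp, fun j _ _ r s => by simp⟩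
  smul_mem' := by
    rintro c f ⟨hf, hf', hf''⟩
    exact ⟨Submodule.smul_mem _ c hf, fun z => by simp [hf'],
      fun j h1 h2 r s => by simp [hf'' j h1 h2 r s]⟩

/-! ### The integral over `γ` -/

/-- The double infinite product `Ω_a(t, τ, σ)`. -/
def Omega (a t τ σ : ℂ) : ℂ :=
  ∏' p : ℕ × ℕ,
    ((1 - exp (2 * Real.pi * I * (t - a + p.1 * τ + p.2 * σ))) *
      (1 - exp (2 * Real.pi * I * (-t - a + (p.1 + 1) * τ + (p.2 + 1) * σ)))) /
    ((1 - exp (2 * Real.pi * I * (t + a + p.1 * τ + p.2 * σ))) *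
      (1 - exp (2 * Real.pi * I * (-t + a + (p.1 + 1) * τ + (p.2 + 1) * σ))))

/-- The integral of `Ω_{2η}(t,τ,σ) f(t) / (θ(t-2η,τ) θ(t-2η,σ))` over the interval `[0,1]`. -/
def intervalInt (τ σ η : ℂ) (f : ℂ → ℂ) : ℂ :=
  ∫ t in (0 : ℝ)..1,
    Omega (2 * η) t τ σ * (f t / (theta (t - 2 * η) τ * theta (t - 2 * η) σ))

/-- For fixed `τ`, `σ`, the values of `η` with `4 η + l + m τ + n σ = 0` for some integers
`l`, `m`, `n` with `m, n ≥ 0`. At these values a pole `t = 2 η + l + m τ + n σ` of the first family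
of poles of the integrand meets a pole `t = -(2 η + l + m τ + n σ)` of the second family. -/
def pinchSet (τ σ : ℂ) : Set ℂ :=
  {η | ∃ (l : ℤ) (m n : ℕ), 4 * η + l + m * τ + n * σ = 0}

/-- `F` is the analytic continuation in `η`, for fixed `τ`, `σ` and fixed `f`, of the integral over
`[0,1]` from the half-plane `Im η > 0` to the complement of `pinchSet τ σ`. -/
def IsContinuation (τ σ : ℂ) (f : ℂ → ℂ) (F : ℂ → ℂ) : Prop :=
  AnalyticOnNhd ℂ F (pinchSet τ σ)ᶜ ∧ ∀ η : ℂ, 0 < η.im → F η = intervalInt τ σ η f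

/-- The integral `∫_γ Ω_{2η}(t,τ,σ) f(t) / (θ(t-2η,τ) θ(t-2η,σ)) dt` is defined: no pinching
occurs at `η` and the analytic continuation exists. -/
def GammaIntegrable (τ σ η : ℂ) (f : ℂ → ℂ) : Prop :=
  η ∉ pinchSet τ σ ∧ ∃ F, IsContinuation τ σ f F

open Classical in
/-- The integral `∫_γ Ω_{2η}(t,τ,σ) f(t) / (θ(t-2η,τ) θ(t-2η,σ)) dt`, for an entire function `f`
with period `1`. The path `γ` is `[0,1]` if `Im η > 0`. For general `η` it is the deformation of
`[0,1]` in `ℂ/ℤ` which keeps the poles `2 η + l + m τ + n σ` above it and the poles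
`-(2 η + l + m τ + n σ)` below it (`m, n ≥ 0`); equivalently, the integral is defined by analytic
continuation in `η`, with `f` fixed. The value is `0` by convention where the continuation does
not exist. -/
def gammaInt (τ σ η : ℂ) (f : ℂ → ℂ) : ℂ :=
  if h : GammaIntegrable τ σ η f then h.2.choose η else 0

/-- The analytic continuation is unique. -/
theorem IsContinuation.eq {τ σ : ℂ} (hτ : 0 < τ.im) (hσ : 0 < σ.im) {f F G : ℂ → ℂ}
    (hF : IsContinuation τ σ f F) (hG : IsContinuation τ σ f G) {η : ℂ}
    (hη : η ∉ pinchSet τ σ) : F η = G η := by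
  have hc : (pinchSet τ σ).Countable := by
    have : pinchSet τ σ ⊆ Set.range
        (fun p : ℤ × ℕ × ℕ => -((p.1 : ℂ) + p.2.1 * τ + p.2.2 * σ) / 4) := by
      rintro x ⟨l, m, n, h⟩
      refine ⟨(l, m, n), ?_⟩
      have : x = -((l : ℂ) + m * τ + n * σ) / 4 := by linear_combination h / 4
      simp [this]
    exact (Set.countable_range _).mono this
  have hconn : IsPreconnected (pinchSet τ σ)ᶜ :=
    (hc.isPathConnected_compl_of_one_lt_rank
      (by rw [Complex.rank_real_complex]; norm_num)).isConnected.isPreconnected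
  have hI : I ∈ (pinchSet τ σ)ᶜ := by
    rintro ⟨l, m, n, h⟩
    have h' := congrArg Complex.im h
    simp at h'
    have : 0 ≤ (m : ℝ) * τ.im := by positivity
    have : 0 ≤ (n : ℝ) * σ.im := by positivity
    linarith
  refine hF.1.eqOn_of_preconnected_of_eventuallyEq hG.1 hconn hI ?_ hη
  have ho : {z : ℂ | 0 < z.im} ∈ nhds I :=
    (isOpen_lt continuous_const Complex.continuous_im).mem_nhds (by simp)
  filter_upwards [ho] with z hz
  rw [hF.2 z hz, hG.2 z hz]

theorem gammaInt_eq {τ σ : ℂ} (hτ : 0 < τ.im) (hσ : 0 < σ.im) {f F : ℂ → ℂ}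
    (hF : IsContinuation τ σ f F) {η : ℂ} (hη : η ∉ pinchSet τ σ) :
    gammaInt τ σ η f = F η := by
  have h : GammaIntegrable τ σ η f := ⟨hη, F, hF⟩
  rw [gammaInt, dif_pos h]
  exact h.2.choose_spec.eq hτ hσ hF hη

/-! ### Hypergeometric theta functions -/

/-- The factor `θ(z+t,τ) θ(μ+t,σ)` of the integrand of the hypergeometric integral. -/
def uFactor (z μ τ σ : ℂ) (t : ℂ) : ℂ := theta (z + t) τ * theta (μ + t) σ

/-- The elliptic hypergeometric integral `u(z, μ, τ, σ, η)`. -/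
def u (z μ τ σ η : ℂ) : ℂ :=
  exp (-(Real.pi * I * z * μ) / (2 * η)) * gammaInt τ σ η (uFactor z μ τ σ)

/-- `Q(μ,σ,η) = θ(4η,σ) θ'(0,σ) / (θ(μ-2η,σ) θ(μ+2η,σ))`. -/
def Q (μ σ η : ℂ) : ℂ :=
  theta (4 * η) σ * deriv (fun z => theta z σ) 0 / (theta (μ - 2 * η) σ * theta (μ + 2 * η) σ)

/-- `l` is admissible with respect to `κ` if `l ≢ ±1` modulo `κ`. -/
def Admissible (κ : ℕ) (l : ℤ) : Prop :=
  ¬ l ≡ 1 [ZMOD κ] ∧ ¬ l ≡ -1 [ZMOD κ]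

/-- The term of the series for the non-symmetric hypergeometric theta function with index `j`. -/
def deltaTerm (κ : ℕ) (j : ℤ) (z τ η : ℂ) : ℂ :=
  u z (2 * η * j) τ (-2 * η * κ) η * Q (2 * η * j) (-2 * η * κ) η *
    exp (Real.pi * I * ((τ + 4 * η) / (2 * κ)) * (j : ℂ) ^ 2)

/-- The `l`-th non-symmetric hypergeometric theta function of level `κ + 2`: the sum of the terms
with index `j = l + 2 κ r`, `r ∈ ℤ`. -/
def deltaTilde (κ : ℕ) (l : ℤ) (z τ η : ℂ) : ℂ :=
  ∑' r : ℤ, deltaTerm κ (l + 2 * κ * r) z τ η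

/-- The `l`-th hypergeometric theta function of level `κ + 2`. -/
def delta (κ : ℕ) (l : ℤ) (z τ η : ℂ) : ℂ :=
  deltaTilde κ l z τ η - deltaTilde κ l (-z) τ η

/-- The factor
`θ(z+t,τ) θ(2ηl+t,-2ηκ) exp(-2πilt/κ) θ_{l,κ}(2t/κ-z,τ)` of the integrand of `I_{l,κ}`. -/
def repFactor (κ : ℕ) (l : ℤ) (z τ η : ℂ) (t : ℂ) : ℂ :=
  theta (z + t) τ * theta (2 * η * l + t) (-2 * η * κ) *
    exp (-2 * Real.pi * I * l * t / κ) * thetaLevel l κ (2 / κ * t - z) τ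

/-- The integral `I_{l,κ}(z, τ, η)`. -/
def repInt (κ : ℕ) (l : ℤ) (z τ η : ℂ) : ℂ :=
  gammaInt τ (-2 * η * κ) η (repFactor κ l z τ η)

end HypergeometricTheta

end

/-!
The integral over `γ` is treated by Fourier analysis, without deforming a contour. Write `e(z) =
exp(2πiz)`. By Jacobi's triple product the integrand is, up to a constant factor, `N(t) f(t) /
(Φ(e(t + 2η)) Φ(e(2η - t)))` with `Φ(y) = ∏ (1 - y e(jτ + kσ))` and `N` entire
(`exists_Omega_div_theta`). For `Im η > 0` one expands the reciprocal of the denominator in powers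
of `e(t)`. Its `n`-th coefficient is `e(2η) ^ |n| * h_{|n|}(e(4η))` with `h_n(z) = ∑ c_{m+n} c_m z
^ m`, where the `c_m` are the Taylor coefficients of `1 / Φ`. This is a Hadamard product of
meromorphic functions, hence continues meromorphically to the plane, with poles only at the values
of `e(4η)` where the contour is pinched; the continuations are bounded in `n`, and tend to a
non-zero multiple of `1 / Φ(z)` (`exists_denominator`, `exists_bound_hcont`, `tendsto_hcont`).
Since the Fourier coefficients of entire functions decay faster than any exponential, the pairing
`Lam` of the continued coefficients with the Fourier coefficients of `N f` converges, is
holomorphic in `η`, and is the integral (`exists_gammaInt_eq`).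

The integral representation is the expansion of the level theta function under the integral:
quasi-periodicity of `θ` and `Q` in `μ` with respect to `σ = -2ηκ` turns the `r`-th term of the
series into the integral of the `r`-th term of that theta function (`deltaTerm_eq`,
`hasSum_Lam_repTerm`). The transformation law in `λ` can be read off from the integrand. For the
vanishing at `2η + ℤ + ℤτ` one moves the contour by `σ` when `Im η > 0` and continues in `η`; this
gives a functional equation (`Lam_theta_sub`) which says that the non-symmetric function takes
equal values at `λ` and `-λ` for such `λ` (`Lam_repFactor_eq_neg`).

The dimension of the space is at most `κ - 3`: its elements are divisible by `θ(λ) θ(λ - 2η) θ(λ +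
2η)`, the quotients are even theta functions of level `κ - 4`, and these are determined by `κ - 3`
of their Fourier coefficients (`finrank_oddVanishingSpace_le`).

It remains to see that the `κ - 3` functions are independent. For this there are functionals dual
to the terms of the series. Let `L` be the functional `pair (ell τ η)`, which satisfies `L(g) -
L(e(2λ + τ) g(λ + τ)) = g(2η) - g(-2η)` (`pair_ell_sub`). Applied to `e(dλ)` times the product of
an integral for `η` and one for `-η`, it gives a double integral of a function `Z(t, s)`. The
equation for `L` and the functional equations at `±η` show that the double integral of `X ^ n Z`,
`X = e(dτ - t - s)`, does not depend on `n` (`pair2_dblKer_succ`). The coefficients for `η` and for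
`-η` have inverse asymptotics, so the limit `n → ∞` can be computed: it is `0` for `d ≠ 0`, and a
non-zero multiple of `Z(-2η, 2η)` for `d = 0` (`pair2_eq_of_invariant`). Thus the functional of
index `n` annihilates all terms but the one of index `n` (`dualFun_hyp`), and since `-l + 2κr`
never lies in `[2, κ - 2]` for `2 ≤ l ≤ κ - 2`, the functionals of these indices separate the
antisymmetrized series (`dualFun_delta`).
-/

noncomputable section

namespace HypergeometricTheta

open Complex

/-! ### Fourier coefficients of periodic entire functions -/

/-- The exponential `exp(2 π i z)`. -/
def ee (z : ℂ) : ℂ := exp (2 * Real.pi * I * z)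

theorem ee_add (z w : ℂ) : ee (z + w) = ee z * ee w := by
  simp only [ee, ← exp_add]; ring_nf

theorem ee_zero : ee 0 = 1 := by simp [ee]

theorem ee_ne_zero (z : ℂ) : ee z ≠ 0 := exp_ne_zero _

theorem ee_neg (z : ℂ) : ee (-z) = (ee z)⁻¹ := by
  simp only [ee, ← exp_neg]; ring_nf

theorem ee_sub (z w : ℂ) : ee (z - w) = ee z / ee w := by
  rw [sub_eq_add_neg, ee_add, ee_neg, div_eq_mul_inv]

theorem ee_int (n : ℤ) : ee n = 1 := by
  rw [ee, exp_eq_one_iff]; exact ⟨n, by ring⟩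

theorem ee_one : ee 1 = 1 := by simpa using ee_int 1

theorem ee_nat_mul (n : ℕ) (z : ℂ) : ee (n * z) = ee z ^ n := by
  simp only [ee, ← exp_nat_mul]; ring_nf

theorem norm_ee (z : ℂ) : ‖ee z‖ = Real.exp (-(2 * Real.pi * z.im)) := by
  rw [ee, norm_exp]; congr 1; simp

theorem differentiable_ee : Differentiable ℂ ee := by
  unfold ee; fun_prop

theorem continuous_ee : Continuous ee := differentiable_ee.continuous

theorem ee_eq_one_iff (z : ℂ) : ee z = 1 ↔ ∃ n : ℤ, z = n := by
  rw [ee, exp_eq_one_iff]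
  have h : (2 * Real.pi * I : ℂ) ≠ 0 := by simp [Real.pi_ne_zero]
  constructor
  · rintro ⟨n, hn⟩
    exact ⟨n, mul_left_cancel₀ h (by rw [hn]; ring)⟩
  · rintro ⟨n, rfl⟩
    exact ⟨n, by ring⟩

theorem norm_ee_lt_one {z : ℂ} (hz : 0 < z.im) : ‖ee z‖ < 1 := by
  rw [norm_ee, Real.exp_lt_one_iff]
  have := Real.pi_pos
  have : 0 < 2 * Real.pi * z.im := by positivity
  linarith

/-- Entire functions with period `1`. -/
structure PerEnt (G : ℂ → ℂ) : Prop where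
  diff : Differentiable ℂ G
  per : ∀ t, G (t + 1) = G t

theorem PerEnt.add_int {G : ℂ → ℂ} (hG : ∀ t, G (t + 1) = G t) (t : ℂ) (n : ℤ) :
    G (t + n) = G t := by
  have : Function.Periodic G 1 := hG
  simpa using this.int_mul n t

theorem PerEnt.mul {F G : ℂ → ℂ} (hF : PerEnt F) (hG : PerEnt G) :
    PerEnt fun t => F t * G t :=
  ⟨hF.diff.mul hG.diff, fun t => by rw [hF.per, hG.per]⟩

theorem perEnt_ee (n : ℤ) : PerEnt fun t => ee (n * t) :=
  ⟨differentiable_ee.comp (by fun_prop), fun t => by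
    rw [mul_add, ee_add, mul_one, ee_int, mul_one]⟩

/-- The `n`-th Fourier coefficient of a function with period `1`. -/
def fc (G : ℂ → ℂ) (n : ℤ) : ℂ := ∫ t in (0 : ℝ)..1, G t * ee (-(n * t))

/-- The integral of a periodic function over a period may be translated by `w`, across a strip
in which the function is holomorphic. -/
theorem integral_translate {K : ℂ → ℂ} (hper : ∀ t, K (t + 1) = K t) (w : ℂ)
    (hK : ∀ t : ℂ, t.im ∈ Set.uIcc 0 w.im → DifferentiableAt ℂ K t) :
    ∫ t in (0 : ℝ)..1, K t = ∫ t in (0 : ℝ)..1, K (t + w) := by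
  have h := Complex.integral_boundary_rect_eq_zero_of_differentiableOn K 0 (1 + w.im * I)
    (fun t ht => (hK t (by simpa using ht.2)).differentiableWithinAt)
  have e1 : ∀ y : ℝ, K (1 + y * I) = K (y * I) := fun y => by rw [add_comm, hper]
  simp only [zero_re, add_re, one_re, mul_re, ofReal_re, I_re, mul_zero, ofReal_im, I_im, mul_one,
    sub_self, add_zero, zero_im, add_im, one_im, mul_im, zero_add, ofReal_zero, ofReal_one,
    zero_mul, e1] at h
  have h2 : ∫ t in (0 : ℝ)..1, K t = ∫ t in (0 : ℝ)..1, K (t + w.im * I) := by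
    linear_combination h
  rw [h2]
  have hp : Function.Periodic (fun t : ℝ => K (t + w.im * I)) 1 := by
    intro t
    have : ((t + 1 : ℝ) : ℂ) + w.im * I = (t + w.im * I) + 1 := by push_cast; ring
    simp only [this, hper]
  have h3 := hp.intervalIntegral_add_eq 0 w.re
  rw [zero_add] at h3
  rw [h3, add_comm w.re 1]
  have h4 := intervalIntegral.integral_comp_add_right (a := 0) (b := 1)
    (fun t : ℝ => K (t + w.im * I)) w.re
  rw [zero_add] at h4
  rw [← h4]
  congr 1
  ext t
  congr 1
  push_cast
  conv_rhs => rw [← re_add_im w]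
  ring

theorem fc_translate {G : ℂ → ℂ} (hG : PerEnt G) (n : ℤ) (w : ℂ) :
    fc G n = ∫ t in (0 : ℝ)..1, G (t + w) * ee (-(n * (t + w))) := by
  refine integral_translate (K := fun t => G t * ee (-(n * t))) (fun t => ?_) w (fun t _ => ?_)
  · have := (perEnt_ee (-n)).per t
    push_cast at this
    rw [hG.per, ← neg_mul, ← neg_mul, this]
  · exact ((hG.diff t).mul (differentiable_ee.comp (by fun_prop) t))

theorem fc_comp_add {G : ℂ → ℂ} (hG : PerEnt G) (n : ℤ) (w : ℂ) :
    fc (fun t => G (t + w)) n = ee (n * w) * fc G n := by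
  rw [fc_translate hG n w, fc, ← intervalIntegral.integral_const_mul]
  congr 1
  ext t
  rw [mul_add, neg_add, ee_add, ee_neg (n * w)]
  field_simp [ee_ne_zero]

theorem norm_fc_le {G : ℂ → ℂ} (hG : PerEnt G) {Y M : ℝ} (hY : 0 ≤ Y)
    (hM : ∀ t : ℂ, |t.im| ≤ Y → ‖G t‖ ≤ M) (n : ℤ) :
    ‖fc G n‖ ≤ M * Real.exp (-(2 * Real.pi * Y)) ^ n.natAbs := by
  have key : ∀ y : ℝ, |y| ≤ Y → n * y = -(n.natAbs * Y) →
      ‖fc G n‖ ≤ M * Real.exp (-(2 * Real.pi * Y)) ^ n.natAbs := by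
    intro y hy hn
    rw [fc_translate hG n (y * I)]
    refine (intervalIntegral.norm_integral_le_of_norm_le_const
      (C := M * Real.exp (-(2 * Real.pi * Y)) ^ n.natAbs) fun t _ => ?_).trans (by simp)
    rw [norm_mul, norm_ee]
    refine mul_le_mul (hM _ (by simpa using hy)) (le_of_eq ?_) (Real.exp_pos _).le
      ((norm_nonneg _).trans (hM 0 (by simpa using hY)))
    rw [← Real.exp_nat_mul]
    congr 1
    have : (-(n * ((t : ℂ) + y * I)) : ℂ).im = -(n * y) := by simp
    rw [this, hn]
    ring
  rcases le_total 0 n with h | h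
  · refine key (-Y) (by rw [abs_neg, abs_of_nonneg hY]) ?_
    have : (n.natAbs : ℝ) = n := by
      rw [Nat.cast_natAbs, abs_of_nonneg h]
    rw [this]; ring
  · refine key Y (by rw [abs_of_nonneg hY]) ?_
    have : (n.natAbs : ℝ) = -n := by
      rw [Nat.cast_natAbs, abs_of_nonpos h]; push_cast; ring
    rw [this]; ring

/-- Boundedness on horizontal strips, uniformly in a parameter from a compact set. -/
theorem exists_strip_bound {X : Type*} [TopologicalSpace X] {f : X → ℂ → ℂ}
    (hf : Continuous (Function.uncurry f)) (hper : ∀ x t, f x (t + 1) = f x t) {K : Set X}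
    (hK : IsCompact K) (Y : ℝ) :
    ∃ M : ℝ, 0 ≤ M ∧ ∀ x ∈ K, ∀ t : ℂ, |t.im| ≤ Y → ‖f x t‖ ≤ M := by
  have hc : IsCompact (K ×ˢ (Set.Icc (0 : ℝ) 1 ×ℂ Set.Icc (-Y) Y)) :=
    hK.prod (isCompact_Icc.reProdIm isCompact_Icc)
  obtain ⟨M, hM⟩ := hc.exists_bound_of_continuousOn hf.continuousOn
  refine ⟨max M 0, le_max_right _ _, fun x hx t ht => ?_⟩
  have h1 := PerEnt.add_int (hper x) t (-⌊t.re⌋)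
  rw [← h1]
  refine (hM (x, t + (-⌊t.re⌋ : ℤ)) ⟨hx, ?_⟩).trans (le_max_left _ _)
  constructor
  · simp only [Int.cast_neg, Set.mem_preimage, add_re, neg_re, intCast_re, Set.mem_Icc]
    exact ⟨by linarith [Int.floor_le t.re], by linarith [Int.lt_floor_add_one t.re]⟩
  · simpa [abs_le] using ht

theorem PerEnt.exists_bound {G : ℂ → ℂ} (hG : PerEnt G) (Y : ℝ) :
    ∃ M : ℝ, 0 ≤ M ∧ ∀ t : ℂ, |t.im| ≤ Y → ‖G t‖ ≤ M := by
  obtain ⟨M, h0, hM⟩ := exists_strip_bound (X := Unit) (f := fun _ => G)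
    (hG.diff.continuous.comp continuous_snd) (fun _ => hG.per) (K := Set.univ) isCompact_univ Y
  exact ⟨M, h0, hM () trivial⟩

/-- On a strip of width `Y` the decay of Fourier coefficients compensates growth at the rate `R`. -/
theorem exists_width (R : ℝ) : ∃ Y : ℝ, 0 ≤ Y ∧ R * Real.exp (-(2 * Real.pi * Y)) ≤ 1 / 2 := by
  refine ⟨|R|, abs_nonneg R, ?_⟩
  have h1 : R * Real.exp (-(2 * Real.pi * |R|)) ≤ |R| * Real.exp (-(2 * |R|)) := by
    refine mul_le_mul (le_abs_self R) ?_ (Real.exp_pos _).le (abs_nonneg R)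
    rw [Real.exp_le_exp]
    nlinarith [Real.pi_gt_three, abs_nonneg R]
  refine h1.trans ?_
  rw [Real.exp_neg, ← div_eq_mul_inv, div_le_div_iff₀ (Real.exp_pos _) (by norm_num)]
  linarith [Real.add_one_le_exp (2 * |R|)]

theorem summable_half_pow_natAbs : Summable fun n : ℤ => (1 / 2 : ℝ) ^ n.natAbs := by
  refine Summable.of_nat_of_neg ?_ ?_ <;> simpa using summable_geometric_two

theorem norm_mul_fc_le {G : ℂ → ℂ} (hG : PerEnt G) {Y M C R : ℝ} (hY : 0 ≤ Y)
    (hR : 0 ≤ R) (hC : 0 ≤ C) (hRY : R * Real.exp (-(2 * Real.pi * Y)) ≤ 1 / 2)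
    (hM : ∀ t : ℂ, |t.im| ≤ Y → ‖G t‖ ≤ M) {c : ℂ} {n : ℤ} (hc : ‖c‖ ≤ C * R ^ n.natAbs) :
    ‖c * fc G n‖ ≤ C * M * (1 / 2) ^ n.natAbs := by
  have hM0 : 0 ≤ M := (norm_nonneg _).trans (hM 0 (by simpa using hY))
  rw [norm_mul]
  refine (mul_le_mul hc (norm_fc_le hG hY hM n) (norm_nonneg _) (by positivity)).trans ?_
  have h4 := pow_le_pow_left₀ (by positivity) hRY n.natAbs
  calc _ = C * M * (R * Real.exp (-(2 * Real.pi * Y))) ^ n.natAbs := by rw [mul_pow]; ring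
    _ ≤ _ := mul_le_mul_of_nonneg_left h4 (mul_nonneg hC hM0)

/-- At most exponential growth of a sequence indexed by the integers. -/
def ExpBdd (φ : ℤ → ℂ) (C R : ℝ) : Prop := 0 ≤ C ∧ 0 ≤ R ∧ ∀ n, ‖φ n‖ ≤ C * R ^ n.natAbs

/-- The linear functional `G ↦ ∑ φ n * Ĝ(n)` on periodic entire functions. The Fourier
coefficients of `G` decay faster than any exponential, so that `φ` may grow exponentially. -/
def pair (φ : ℤ → ℂ) (G : ℂ → ℂ) : ℂ := ∑' n, φ n * fc G n

theorem summable_pair {φ : ℤ → ℂ} {C R : ℝ} (hφ : ExpBdd φ C R) {G : ℂ → ℂ} (hG : PerEnt G) :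
    Summable fun n => φ n * fc G n := by
  obtain ⟨Y, hY, hRY⟩ := exists_width R
  obtain ⟨M, hM0, hM⟩ := hG.exists_bound Y
  exact .of_norm_bounded (summable_half_pow_natAbs.mul_left (C * M))
    fun n => norm_mul_fc_le hG hY hφ.2.1 hφ.1 hRY hM (hφ.2.2 n)

theorem norm_pair_le {φ : ℤ → ℂ} {C R : ℝ} (hφ : ExpBdd φ C R) {G : ℂ → ℂ} (hG : PerEnt G)
    {Y M : ℝ} (hY : 0 ≤ Y) (hRY : R * Real.exp (-(2 * Real.pi * Y)) ≤ 1 / 2)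
    (hM : ∀ t : ℂ, |t.im| ≤ Y → ‖G t‖ ≤ M) :
    ‖pair φ G‖ ≤ C * M * ∑' n : ℤ, (1 / 2 : ℝ) ^ n.natAbs := by
  rw [← tsum_mul_left]
  exact tsum_of_norm_bounded (summable_half_pow_natAbs.mul_left (C * M)).hasSum
    fun n => norm_mul_fc_le hG hY hφ.2.1 hφ.1 hRY hM (hφ.2.2 n)

theorem fc_intervalIntegrable {G : ℂ → ℂ} (hG : Continuous G) (n : ℤ) :
    IntervalIntegrable (fun t : ℝ => G t * ee (-(n * t))) MeasureTheory.volume 0 1 := by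
  have := continuous_ee
  exact Continuous.intervalIntegrable (by fun_prop) _ _

theorem fc_add {F G : ℂ → ℂ} (hF : Continuous F) (hG : Continuous G) (n : ℤ) :
    fc (fun t => F t + G t) n = fc F n + fc G n := by
  simp only [fc, add_mul]
  exact intervalIntegral.integral_add (fc_intervalIntegrable hF n) (fc_intervalIntegrable hG n)

theorem fc_const_mul (c : ℂ) (G : ℂ → ℂ) (n : ℤ) : fc (fun t => c * G t) n = c * fc G n := by
  simp only [fc, mul_assoc]
  exact intervalIntegral.integral_const_mul _ _

theorem fc_neg {G : ℂ → ℂ} (hG : PerEnt G) (n : ℤ) : fc (fun t => G (-t)) n = fc G (-n) := by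
  have h := intervalIntegral.integral_comp_neg (a := 0) (b := 1)
    (fun t : ℝ => G t * ee (n * t))
  have h2 := intervalIntegral.integral_comp_add_right (a := 0) (b := 1)
    (fun t : ℝ => G t * ee (n * t)) (-1)
  simp only [neg_zero, zero_add] at h h2
  norm_num at h2
  have e : ∀ t : ℝ, G (t + -1) * ee (n * (t + -1)) = G t * ee (n * t) := fun t => by
    have h1 := hG.per (t + -1)
    have h3 := (perEnt_ee n).per (t + -1)
    rw [neg_add_cancel_right] at h1 h3
    rw [h1, h3]
  simp only [e] at h2
  rw [fc, fc]
  push_cast at h ⊢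
  simp only [neg_mul, neg_neg, mul_neg] at h ⊢
  rw [h, h2]

theorem fc_ee_mul (G : ℂ → ℂ) (k n : ℤ) : fc (fun t => ee (k * t) * G t) n = fc G (n - k) := by
  rw [fc, fc]
  congr 1
  ext t
  rw [mul_right_comm, mul_comm, ← ee_add]
  congr 2
  push_cast
  ring

theorem pair_add {φ : ℤ → ℂ} {C R : ℝ} (hφ : ExpBdd φ C R) {F G : ℂ → ℂ} (hF : PerEnt F)
    (hG : PerEnt G) : pair φ (fun t => F t + G t) = pair φ F + pair φ G := by
  simp only [pair, fc_add hF.diff.continuous hG.diff.continuous, mul_add]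
  exact (summable_pair hφ hF).tsum_add (summable_pair hφ hG)

theorem pair_const_mul (φ : ℤ → ℂ) (c : ℂ) (G : ℂ → ℂ) :
    pair φ (fun t => c * G t) = c * pair φ G := by
  simp only [pair, fc_const_mul, ← tsum_mul_left]
  congr 1; ext n; ring

theorem pair_neg {φ : ℤ → ℂ} (hφ : ∀ n, φ (-n) = φ n) {G : ℂ → ℂ} (hG : PerEnt G) :
    pair φ (fun t => G (-t)) = pair φ G := by
  simp only [pair, fc_neg hG]
  rw [← (Equiv.neg ℤ).tsum_eq]
  simp [hφ]

/-! ### Fourier inversion -/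

theorem hasSum_fc {G : ℂ → ℂ} (hG : PerEnt G) (t : ℂ) :
    HasSum (fun n : ℤ => fc G n * ee (n * t)) (G t) := by
  -- the value at the point `t` is the value at `0` of a translate
  suffices h : ∀ F : ℂ → ℂ, PerEnt F → HasSum (fun n : ℤ => fc F n) (F 0) by
    have hF : PerEnt fun s => G (s + t) :=
      ⟨hG.diff.comp (by fun_prop), fun s => by rw [add_right_comm, hG.per]⟩
    have := h _ hF
    simp only [fc_comp_add hG, zero_add] at this
    simpa only [mul_comm] using this
  intro F hF
  have hp : Function.Periodic (fun s : ℝ => F s) 1 := fun s => by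
    simpa using hF.per s
  let f : C(AddCircle (1 : ℝ), ℂ) :=
    ⟨hp.lift, by
      refine continuous_coinduced_dom.mpr ?_
      exact hF.diff.continuous.comp continuous_ofReal⟩
  have hco : ∀ n, fourierCoeff f n = fc F n := by
    intro n
    rw [fourierCoeff_eq_intervalIntegral f n 0, fc]
    simp only [one_div, inv_one, one_smul, zero_add, smul_eq_mul]
    congr 1
    ext s
    rw [mul_comm]
    have e1 : f (s : AddCircle (1 : ℝ)) = F s := rfl
    rw [e1, fourier_coe_apply, ee]
    congr 2
    push_cast
    ring
  have hs : Summable (fourierCoeff f) := by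
    have := summable_pair (φ := fun _ => 1) (C := 1) (R := 1)
      ⟨zero_le_one, zero_le_one, fun n => by simp⟩ hF
    refine this.congr fun n => by rw [hco, one_mul]
  have := has_pointwise_sum_fourier_series_of_summable hs ((0 : ℝ) : AddCircle (1 : ℝ))
  have e0 : f ((0 : ℝ) : AddCircle (1 : ℝ)) = F ((0 : ℝ) : ℂ) := rfl
  rw [e0, ofReal_zero] at this
  refine this.congr_fun fun n => ?_
  rw [hco, fourier_coe_apply]
  simp

theorem pair_ee {G : ℂ → ℂ} (hG : PerEnt G) (t : ℂ) : pair (fun n => ee (n * t)) G = G t := by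
  rw [pair, ← (hasSum_fc hG t).tsum_eq]
  congr 1; ext n; ring

theorem eq_zero_of_fc {G : ℂ → ℂ} (hG : PerEnt G) (h : ∀ n, fc G n = 0) (t : ℂ) : G t = 0 := by
  rw [← (hasSum_fc hG t).tsum_eq]
  simp [h]

theorem hasSum_fc_of_summable {ι : Type*} [Countable ι] {F : ι → ℂ → ℂ} {G : ℂ → ℂ} {u : ι → ℝ}
    (hu : Summable u) (hF : ∀ i, Continuous (F i)) (hb : ∀ i (t : ℝ), ‖F i t‖ ≤ u i)
    (h : ∀ t : ℝ, HasSum (fun i => F i t) (G t)) (n : ℤ) :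
    HasSum (fun i => fc (F i) n) (fc G n) := by
  have he := continuous_ee
  refine intervalIntegral.hasSum_integral_of_dominated_convergence (fun i _ => u i)
    (fun i => ?_) (fun i => .of_forall fun t _ => ?_) (.of_forall fun t _ => hu) (by simp)
    (.of_forall fun t _ => (h t).mul_right _)
  · have := hF i
    exact Continuous.aestronglyMeasurable (by fun_prop)
  · rw [norm_mul, norm_ee]
    simpa using hb i t

theorem fc_one {n : ℤ} (hn : n ≠ 0) : fc (fun _ => 1) n = 0 := by
  have hp : PerEnt fun _ => (1 : ℂ) := ⟨differentiable_const _, fun _ => rfl⟩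
  have hn' : (n : ℂ) ≠ 0 := by exact_mod_cast hn
  have h := fc_comp_add hp n (1 / (2 * n))
  have h2 : ee (n * (1 / (2 * n))) = -1 := by
    rw [← exp_pi_mul_I, ee]
    congr 1
    field_simp
  rw [h2] at h
  linear_combination h / 2

/-- The Fourier coefficients of an absolutely convergent trigonometric series. -/
theorem fc_of_hasSum {G : ℂ → ℂ} {g : ℤ → ℂ} (hg : Summable fun n => ‖g n‖)
    (h : ∀ t : ℝ, HasSum (fun n : ℤ => g n * ee (n * t)) (G t)) (n : ℤ) : fc G n = g n := by
  have h1 := hasSum_fc_of_summable (F := fun k t => g k * ee (k * t)) hg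
    (fun k => continuous_const.mul (continuous_ee.comp (by fun_prop)))
    (fun k t => by rw [norm_mul, norm_ee]; simp) h n
  refine h1.unique ?_
  have h2 : (fun k : ℤ => fc (fun t => g k * ee (k * t)) n) = fun k => if k = n then g n else 0 := by
    ext k
    have := fc_ee_mul (fun _ => 1) k n
    simp only [mul_one] at this
    rw [fc_const_mul, this]
    split_ifs with hk
    · subst hk; simp [fc, ee_zero]
    · rw [fc_one (by omega), mul_zero]
  rw [h2]
  exact hasSum_ite_eq n (g n)

theorem hasSum_pair {ι : Type*} [Countable ι] {φ : ℤ → ℂ} {C R Y : ℝ} (hφ : ExpBdd φ C R)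
    (hY : 0 ≤ Y) (hRY : R * Real.exp (-(2 * Real.pi * Y)) ≤ 1 / 2) {F : ι → ℂ → ℂ} {G : ℂ → ℂ}
    {u : ι → ℝ} (hu : Summable u) (hF : ∀ i, PerEnt (F i))
    (hb : ∀ i (t : ℂ), |t.im| ≤ Y → ‖F i t‖ ≤ u i)
    (h : ∀ t : ℝ, HasSum (fun i => F i t) (G t)) :
    HasSum (fun i => pair φ (F i)) (pair φ G) := by
  have hG : ∀ n, fc G n = ∑' i, fc (F i) n := fun n =>
    (hasSum_fc_of_summable hu (fun i => (hF i).diff.continuous)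
      (fun i t => hb i t (by simpa using hY)) h n).tsum_eq.symm
  have hu0 : ∀ i, 0 ≤ u i := fun i => (norm_nonneg _).trans (hb i 0 (by simpa using hY))
  have hs : Summable (Function.uncurry fun (n : ℤ) (i : ι) => φ n * fc (F i) n) := by
    have h2 : Summable fun p : ℤ × ι => (1 / 2 : ℝ) ^ p.1.natAbs * u p.2 :=
      summable_half_pow_natAbs.mul_of_nonneg hu (fun n => by positivity) hu0
    refine .of_norm_bounded (h2.mul_left C) fun p => ?_
    refine (norm_mul_fc_le (hF p.2) hY hφ.2.1 hφ.1 hRY (hb p.2) (hφ.2.2 p.1)).trans (le_of_eq ?_)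
    ring
  have h1 : pair φ G = ∑' i, pair φ (F i) := by
    simp only [pair, hG, ← tsum_mul_left]
    exact hs.tsum_comm.symm
  rw [h1]
  have hs2 : Summable fun i => pair φ (F i) := hs.prod_symm.prod
  exact hs2.hasSum

/-! ### Dependence on parameters -/

theorem continuous_fc {X : Type*} [TopologicalSpace X] {f : X → ℂ → ℂ}
    (hf : Continuous (Function.uncurry f)) (n : ℤ) : Continuous fun x => fc (f x) n := by
  have he := continuous_ee
  refine intervalIntegral.continuous_parametric_intervalIntegral_of_continuous' ?_ 0 1
  have : Continuous fun p : X × ℝ => f p.1 p.2 :=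
    hf.comp (continuous_fst.prodMk (continuous_ofReal.comp continuous_snd))
  fun_prop

theorem differentiable_fc {f : ℂ → ℂ → ℂ} (hf : Continuous (Function.uncurry f))
    (hd : ∀ t, Differentiable ℂ fun w => f w t) (n : ℤ) : Differentiable ℂ fun w => fc (f w) n := by
  intro w₀
  have he := continuous_ee
  have hf2 : Continuous fun p : ℂ × ℝ => f p.1 p.2 :=
    hf.comp (continuous_fst.prodMk (continuous_ofReal.comp continuous_snd))
  -- Cauchy's estimate bounds the derivative in the parameter
  obtain ⟨M, hM⟩ := ((isCompact_closedBall w₀ 2).prod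
    (isCompact_Icc (a := (0 : ℝ)) (b := 1))).exists_bound_of_continuousOn hf2.continuousOn
  have hder : ∀ t ∈ Set.Icc (0 : ℝ) 1, ∀ w ∈ Metric.ball w₀ 1,
      ‖deriv (fun w => f w t) w‖ ≤ M / 1 := by
    intro t ht w hw
    refine Complex.norm_deriv_le_of_forall_mem_sphere_norm_le one_pos (hd t).diffContOnCl ?_
    intro z hz
    refine hM (z, t) ⟨?_, ht⟩
    rw [Metric.mem_closedBall]
    rw [Metric.mem_ball] at hw
    rw [Metric.mem_sphere] at hz
    linarith [dist_triangle z w w₀]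
  have hsub : ∀ t ∈ Set.uIoc (0 : ℝ) 1, t ∈ Set.Icc (0 : ℝ) 1 := fun t ht => by
    rw [Set.uIoc_of_le zero_le_one] at ht; exact ⟨ht.1.le, ht.2⟩
  refine (intervalIntegral.hasDerivAt_integral_of_dominated_loc_of_deriv_le
    (F := fun w (t : ℝ) => f w t * ee (-(n * t)))
    (F' := fun w (t : ℝ) => deriv (fun w => f w t) w * ee (-(n * t))) (bound := fun _ => M)
    (Metric.ball_mem_nhds w₀ one_pos) (.of_forall fun w => ?_) ?_ ?_ ?_ (by simp)
    ?_).2.differentiableAt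
  · have : Continuous fun t : ℝ => f w t := hf2.comp (by fun_prop : Continuous fun t : ℝ => (w, t))
    exact Continuous.aestronglyMeasurable (by fun_prop)
  · have : Continuous fun t : ℝ => f w₀ t := hf2.comp (by fun_prop : Continuous fun t : ℝ => (w₀, t))
    exact Continuous.intervalIntegrable (by fun_prop) _ _
  · have h1 : Continuous (Function.uncurry fun (t : ℝ) (w : ℂ) => f w t) :=
      hf2.comp continuous_swap
    have h2 : Measurable fun t : ℝ => deriv (fun w => f w t) w₀ :=
      (measurable_deriv_with_param h1).comp (by fun_prop : Measurable fun t : ℝ => (t, w₀))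
    have h3 : Measurable fun t : ℝ => ee (-(n * t)) :=
      Continuous.measurable (by fun_prop)
    exact (h2.mul h3).aestronglyMeasurable
  · refine .of_forall fun t ht w hw => ?_
    rw [norm_mul, norm_ee]
    simpa using hder t (hsub t ht) w hw
  · exact .of_forall fun t _ w _ => ((hd t w).hasDerivAt).mul_const _

theorem continuous_pair {X : Type*} [TopologicalSpace X] [LocallyCompactSpace X] {φ : ℤ → ℂ}
    {C R : ℝ} (hφ : ExpBdd φ C R) {f : X → ℂ → ℂ} (hf : Continuous (Function.uncurry f))
    (hp : ∀ x, PerEnt (f x)) : Continuous fun x => pair φ (f x) := by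
  rw [continuous_iff_continuousAt]
  intro x
  obtain ⟨Y, hY, hRY⟩ := exists_width R
  obtain ⟨K, hK, hxK⟩ := exists_compact_mem_nhds x
  obtain ⟨M, hM0, hM⟩ := exists_strip_bound hf (fun x => (hp x).per) hK Y
  have h : ContinuousOn (fun x => pair φ (f x)) K :=
    continuousOn_tsum (fun n => (continuous_const.mul (continuous_fc hf n)).continuousOn)
      (summable_half_pow_natAbs.mul_left (C * M)) fun n y hy =>
        norm_mul_fc_le (hp y) hY hφ.2.1 hφ.1 hRY (hM y hy) (hφ.2.2 n)
  exact h.continuousAt hxK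

/-- Holomorphic dependence on a parameter of `pair (d w) (f w)`, where the sequence may depend
on the parameter too. -/
theorem differentiableOn_pair {U : Set ℂ} (hU : IsOpen U) {d : ℂ → ℤ → ℂ}
    (hd : ∀ n, DifferentiableOn ℂ (fun w => d w n) U)
    (hb : ∀ w₀ ∈ U, ∃ C R, ∀ᶠ w in nhds w₀, ExpBdd (d w) C R) {f : ℂ → ℂ → ℂ}
    (hf : Continuous (Function.uncurry f)) (hfd : ∀ t, Differentiable ℂ fun w => f w t)
    (hp : ∀ w, PerEnt (f w)) : DifferentiableOn ℂ (fun w => pair (d w) (f w)) U := by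
  intro w₀ hw₀
  obtain ⟨C, R, hCR⟩ := hb w₀ hw₀
  obtain ⟨Y, hY, hRY⟩ := exists_width R
  obtain ⟨r, hr, hrU⟩ := Metric.eventually_nhds_iff_ball.mp (hCR.and (hU.mem_nhds hw₀))
  obtain ⟨M, hM0, hM⟩ := exists_strip_bound hf (fun x => (hp x).per)
    (isCompact_closedBall w₀ r) Y
  have h : DifferentiableOn ℂ (fun w => pair (d w) (f w)) (Metric.ball w₀ r) := by
    refine Complex.differentiableOn_tsum_of_summable_norm
      (summable_half_pow_natAbs.mul_left (C * M)) (fun n => ?_) Metric.isOpen_ball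
      fun n w hw => ?_
    · exact ((hd n).mono fun w hw => (hrU w hw).2).mul (differentiable_fc hf hfd n).differentiableOn
    · have := (hrU w hw).1
      exact norm_mul_fc_le (hp w) hY this.2.1 this.1 hRY (hM w (Metric.ball_subset_closedBall hw))
        (this.2.2 n)
  exact (h.differentiableAt (Metric.ball_mem_nhds w₀ hr)).differentiableWithinAt

theorem differentiable_pair {φ : ℤ → ℂ} {C R : ℝ} (hφ : ExpBdd φ C R) {f : ℂ → ℂ → ℂ}
    (hf : Continuous (Function.uncurry f)) (hfd : ∀ t, Differentiable ℂ fun w => f w t)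
    (hp : ∀ w, PerEnt (f w)) : Differentiable ℂ fun w => pair φ (f w) :=
  differentiableOn_univ.mp (differentiableOn_pair isOpen_univ (d := fun _ => φ)
    (fun _ => differentiableOn_const _) (fun _ _ => ⟨C, R, .of_forall fun _ => hφ⟩) hf hfd hp)

/-! ### Functions of two variables -/

/-- Functions of two complex variables which are entire and periodic in each variable, and
jointly continuous. -/
structure PerEnt2 (f : ℂ → ℂ → ℂ) : Prop where
  cont : Continuous (Function.uncurry f)
  left : ∀ s, PerEnt fun t => f t s
  right : ∀ t, PerEnt (f t)

theorem PerEnt2.swap {f : ℂ → ℂ → ℂ} (hf : PerEnt2 f) : PerEnt2 fun s t => f t s :=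
  ⟨hf.cont.comp continuous_swap, hf.right, hf.left⟩

theorem PerEnt2.mul {f g : ℂ → ℂ → ℂ} (hf : PerEnt2 f) (hg : PerEnt2 g) :
    PerEnt2 fun t s => f t s * g t s :=
  ⟨hf.cont.mul hg.cont, fun s => (hf.left s).mul (hg.left s), fun t => (hf.right t).mul (hg.right t)⟩

theorem PerEnt.fst {f : ℂ → ℂ} (hf : PerEnt f) : PerEnt2 fun t _ => f t :=
  ⟨hf.diff.continuous.comp continuous_fst, fun _ => hf,
    fun _ => ⟨differentiable_const _, fun _ => rfl⟩⟩

theorem PerEnt.snd {f : ℂ → ℂ} (hf : PerEnt f) : PerEnt2 fun _ s => f s :=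
  hf.fst.swap

theorem PerEnt2.fc {f : ℂ → ℂ → ℂ} (hf : PerEnt2 f) (m : ℤ) : PerEnt fun t => fc (f t) m :=
  ⟨differentiable_fc hf.cont (fun s => (hf.left s).diff) m, fun t => by
    simp only [HypergeometricTheta.fc, (hf.left _).per]⟩

/-- Fubini's theorem for Fourier coefficients. -/
theorem fc_fc_comm {f : ℂ → ℂ → ℂ} (hf : PerEnt2 f) (n m : ℤ) :
    fc (fun t => fc (f t) m) n = fc (fun s => fc (fun t => f t s) n) m := by
  have he := continuous_ee
  simp only [fc, ← intervalIntegral.integral_mul_const]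
  simp only [intervalIntegral.integral_of_le zero_le_one]
  rw [MeasureTheory.integral_integral_swap]
  · refine MeasureTheory.integral_congr_ae (.of_forall fun s => ?_)
    refine MeasureTheory.integral_congr_ae (.of_forall fun t => ?_)
    simp only []
    ring
  · have hc : Continuous (Function.uncurry fun (t s : ℝ) =>
        f t s * ee (-(m * s)) * ee (-(n * t))) := by
      have : Continuous fun p : ℝ × ℝ => f p.1 p.2 :=
        hf.cont.comp (by fun_prop : Continuous fun p : ℝ × ℝ => ((p.1 : ℂ), (p.2 : ℂ)))
      exact (this.mul (he.comp (by fun_prop))).mul (he.comp (by fun_prop))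
    rw [MeasureTheory.Measure.prod_restrict]
    exact (hc.continuousOn.integrableOn_compact (isCompact_Icc.prod isCompact_Icc)).mono_set
      (Set.prod_mono Set.Ioc_subset_Icc_self Set.Ioc_subset_Icc_self)

/-- The Fourier coefficients of a function of two variables. -/
def fc2 (f : ℂ → ℂ → ℂ) (p : ℤ × ℤ) : ℂ := fc (fun t => fc (f t) p.2) p.1

/-- The pairing `∑ φ n * ψ m * f̂(n, m)` for functions of two variables. -/
def pair2 (φ ψ : ℤ → ℂ) (f : ℂ → ℂ → ℂ) : ℂ := ∑' p : ℤ × ℤ, φ p.1 * ψ p.2 * fc2 f p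

theorem summable_half_pow_natAbs_prod :
    Summable fun p : ℤ × ℤ => (1 / 2 : ℝ) ^ p.1.natAbs * (1 / 2 : ℝ) ^ p.2.natAbs :=
  summable_half_pow_natAbs.mul_of_nonneg summable_half_pow_natAbs (fun n => by positivity)
    fun n => by positivity

/-- A bound, with summable right-hand side, for the terms of the pairing, uniform with respect to
the coefficients `c`. -/
theorem PerEnt2.exists_bound {f : ℂ → ℂ → ℂ} (hf : PerEnt2 f) {R : ℝ} (hR : 0 ≤ R) :
    ∃ M : ℝ, 0 ≤ M ∧ ∀ (p : ℤ × ℤ) (c : ℂ) (C : ℝ), 0 ≤ C →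
      ‖c‖ ≤ C * (R ^ p.1.natAbs * R ^ p.2.natAbs) →
      ‖c * fc2 f p‖ ≤ C * M * ((1 / 2) ^ p.1.natAbs * (1 / 2) ^ p.2.natAbs) := by
  obtain ⟨Y, hY, hRY⟩ := exists_width R
  have hK : IsCompact (Set.Icc (0 : ℝ) 1 ×ℂ Set.Icc (-Y) Y) := isCompact_Icc.reProdIm isCompact_Icc
  obtain ⟨M, hM0, hM⟩ := exists_strip_bound hf.cont (fun t => (hf.right t).per) hK Y
  have hM' : ∀ t s : ℂ, |t.im| ≤ Y → |s.im| ≤ Y → ‖f t s‖ ≤ M := by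
    intro t s ht hs
    have h1 := PerEnt.add_int (G := fun t => f t s) (hf.left s).per t (-⌊t.re⌋)
    rw [← h1]
    refine hM _ ⟨?_, ?_⟩ s hs
    · simp only [Int.cast_neg, Set.mem_preimage, add_re, neg_re, intCast_re, Set.mem_Icc]
      exact ⟨by linarith [Int.floor_le t.re], by linarith [Int.lt_floor_add_one t.re]⟩
    · simpa [abs_le] using ht
  refine ⟨M, hM0, fun p c C hC hc => ?_⟩
  have h1 : ∀ t : ℂ, |t.im| ≤ Y → ‖HypergeometricTheta.fc (f t) p.2‖ ≤ _ := fun t ht =>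
    norm_fc_le (hf.right t) hY (fun s hs => hM' t s ht hs) p.2
  have h2 := norm_fc_le (hf.fc p.2) hY h1 p.1
  rw [norm_mul]
  refine (mul_le_mul hc h2 (norm_nonneg _) (by positivity)).trans ?_
  have h4 := pow_le_pow_left₀ (by positivity) hRY p.1.natAbs
  have h5 := pow_le_pow_left₀ (by positivity) hRY p.2.natAbs
  calc _ = C * M * ((R * Real.exp (-(2 * Real.pi * Y))) ^ p.1.natAbs *
        (R * Real.exp (-(2 * Real.pi * Y))) ^ p.2.natAbs) := by rw [mul_pow, mul_pow]; ring
    _ ≤ _ := by gcongr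

theorem ExpBdd.mono {φ : ℤ → ℂ} {C R R' : ℝ} (hφ : ExpBdd φ C R) (h : R ≤ R') : ExpBdd φ C R' :=
  ⟨hφ.1, hφ.2.1.trans h, fun n => (hφ.2.2 n).trans
    (mul_le_mul_of_nonneg_left (pow_le_pow_left₀ hφ.2.1 h _) hφ.1)⟩

theorem summable_pair2 {φ ψ : ℤ → ℂ} {C R C' R' : ℝ} (hφ : ExpBdd φ C R) (hψ : ExpBdd ψ C' R')
    {f : ℂ → ℂ → ℂ} (hf : PerEnt2 f) : Summable fun p : ℤ × ℤ => φ p.1 * ψ p.2 * fc2 f p := by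
  replace hφ := hφ.mono (le_max_left R R')
  replace hψ := hψ.mono (le_max_right R R')
  obtain ⟨M, hM0, hM⟩ := hf.exists_bound hφ.2.1
  refine .of_norm_bounded (summable_half_pow_natAbs_prod.mul_left (C * C' * M)) fun p => ?_
  refine hM p _ (C * C') (mul_nonneg hφ.1 hψ.1) ?_
  rw [norm_mul]
  refine (mul_le_mul (hφ.2.2 _) (hψ.2.2 _) (norm_nonneg _)
    (mul_nonneg hφ.1 (pow_nonneg hφ.2.1 _))).trans (le_of_eq ?_)
  ring

theorem pair_pair {φ ψ : ℤ → ℂ} {C R C' R' : ℝ} (hφ : ExpBdd φ C R) (hψ : ExpBdd ψ C' R')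
    {f : ℂ → ℂ → ℂ} (hf : PerEnt2 f) : pair φ (fun t => pair ψ (f t)) = pair2 φ ψ f := by
  rw [pair2, (summable_pair2 hφ hψ hf).tsum_prod, pair]
  congr 1
  ext n
  simp only [mul_assoc, tsum_mul_left]
  congr 1
  obtain ⟨Y, hY, hRY⟩ := exists_width R'
  obtain ⟨M, hM0, hM⟩ := exists_strip_bound hf.cont (fun t => (hf.right t).per)
    (K := Set.Icc (0 : ℝ) 1 ×ℂ {0}) (isCompact_Icc.reProdIm isCompact_singleton) Y
  have hbd : ∀ (m : ℤ) (t : ℝ), ‖ψ m * fc (f t) m‖ ≤ C' * M * (1 / 2) ^ m.natAbs := by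
    intro m t
    refine norm_mul_fc_le (hf.right t) hY hψ.2.1 hψ.1 hRY (fun s hs => ?_) (hψ.2.2 m)
    have h1 := PerEnt.add_int (G := fun t => f t s) (hf.left s).per t (-⌊t⌋)
    rw [← h1]
    refine hM _ ⟨?_, ?_⟩ s hs
    · simp only [Int.cast_neg, Set.mem_preimage, add_re, neg_re, intCast_re, Set.mem_Icc, ofReal_re]
      exact ⟨by linarith [Int.floor_le t], by linarith [Int.lt_floor_add_one t]⟩
    · simp
  have h := hasSum_fc_of_summable (F := fun m t => ψ m * fc (f t) m)
    (G := fun t => pair ψ (f t)) (summable_half_pow_natAbs.mul_left (C' * M))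
    (fun m => continuous_const.mul (hf.fc m).diff.continuous) hbd
    (fun t => (summable_pair hψ (hf.right t)).hasSum) n
  rw [← h.tsum_eq]
  simp only [fc_const_mul, fc2]

theorem pair2_swap {φ ψ : ℤ → ℂ} {f : ℂ → ℂ → ℂ} (hf : PerEnt2 f) :
    pair2 φ ψ f = pair2 ψ φ fun s t => f t s := by
  rw [pair2, pair2, ← (Equiv.prodComm ℤ ℤ).tsum_eq]
  congr 1
  ext p
  simp only [Equiv.prodComm_apply, Prod.fst_swap, Prod.snd_swap, fc2]
  rw [fc_fc_comm hf]
  ring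

/-- Fubini's theorem for the pairings. -/
theorem pair_comm {φ ψ : ℤ → ℂ} {C R C' R' : ℝ} (hφ : ExpBdd φ C R) (hψ : ExpBdd ψ C' R')
    {f : ℂ → ℂ → ℂ} (hf : PerEnt2 f) :
    pair φ (fun t => pair ψ (f t)) = pair ψ fun s => pair φ fun t => f t s := by
  rw [pair_pair hφ hψ hf, pair2_swap hf, pair_pair hψ hφ hf.swap]

/-! ### Infinite products -/

/-- The infinite product `∏ (1 - s i * y)`. -/
def qprod {ι : Type*} (s : ι → ℂ) (y : ℂ) : ℂ := ∏' i, (1 - s i * y)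

section qprod

variable {ι : Type*} {s : ι → ℂ}

theorem summable_norm_mul_const (hs : Summable fun i => ‖s i‖) (y : ℂ) :
    Summable fun i => ‖-(s i * y)‖ := by
  simpa only [norm_neg, norm_mul] using hs.mul_right ‖y‖

theorem multipliable_qprod (hs : Summable fun i => ‖s i‖) (y : ℂ) :
    Multipliable fun i => 1 - s i * y := by
  simpa only [sub_eq_add_neg] using multipliable_one_add_of_summable (summable_norm_mul_const hs y)

theorem qprod_ne_zero (hs : Summable fun i => ‖s i‖) {y : ℂ} (hy : ∀ i, s i * y ≠ 1) :
    qprod s y ≠ 0 := by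
  have := tprod_one_add_ne_zero_of_summable (f := fun i => -(s i * y))
    (fun i => by rw [← sub_eq_add_neg, sub_ne_zero]; exact (hy i).symm)
    (summable_norm_mul_const hs y)
  simpa only [qprod, sub_eq_add_neg] using this

theorem qprod_eq_zero {y : ℂ} {i : ι} (hy : s i * y = 1) : qprod s y = 0 :=
  (hasProd_zero_of_exists_eq_zero ⟨i, by rw [hy, sub_self]⟩).tprod_eq

theorem qprod_eq_zero_iff (hs : Summable fun i => ‖s i‖) {y : ℂ} :
    qprod s y = 0 ↔ ∃ i, s i * y = 1 := by
  constructor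
  · intro h
    by_contra! hcon
    exact qprod_ne_zero hs hcon h
  · rintro ⟨i, hi⟩
    exact qprod_eq_zero hi

theorem differentiable_qprod (hs : Summable fun i => ‖s i‖) : Differentiable ℂ (qprod s) := by
  intro y
  have h := Summable.hasProdLocallyUniformlyOn_one_add (f := fun i y => -(s i * y))
    (u := fun i => ‖s i‖ * (‖y‖ + 1)) (Metric.isOpen_ball (x := (0 : ℂ)) (ε := ‖y‖ + 1))
    (hs.mul_right _) (.of_forall fun i z hz => by
      rw [norm_neg, norm_mul]
      rw [mem_ball_zero_iff] at hz
      exact mul_le_mul_of_nonneg_left hz.le (norm_nonneg _))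
    (fun i => by fun_prop)
  have h2 : DifferentiableOn ℂ (fun y => ∏' i, (1 + -(s i * y))) (Metric.ball 0 (‖y‖ + 1)) := by
    refine TendstoLocallyUniformlyOn.differentiableOn h (.of_forall fun t => ?_) Metric.isOpen_ball
    exact DifferentiableOn.fun_finsetProd fun i _ => by fun_prop
  have h3 := h2.differentiableAt (Metric.isOpen_ball.mem_nhds
    (show y ∈ Metric.ball 0 (‖y‖ + 1) by rw [mem_ball_zero_iff]; linarith))
  simp only [← sub_eq_add_neg] at h3
  exact h3

theorem qprod_split [DecidableEq ι] (hs : Summable fun i => ‖s i‖) (T : Finset ι) (y : ℂ) :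
    qprod s y = (∏ i ∈ T, (1 - s i * y)) * qprod (fun i => if i ∈ T then 0 else s i) y := by
  have h1 : ∏' i, (if i ∈ T then 1 - s i * y else 1) = ∏ i ∈ T, (1 - s i * y) := by
    rw [tprod_eq_prod (s := T) fun i hi => if_neg hi]
    exact Finset.prod_congr rfl fun i hi => if_pos hi
  have hs2 : Summable fun i => ‖if i ∈ T then 0 else s i‖ := by
    refine .of_nonneg_of_le (fun _ => norm_nonneg _) (fun i => ?_) hs
    split_ifs <;> simp
  have hm1 : Multipliable fun i => if i ∈ T then 1 - s i * y else 1 :=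
    (hasProd_prod_of_ne_finset_one (s := T) fun i hi => if_neg hi).multipliable
  rw [← h1, qprod, qprod, ← hm1.tprod_mul (multipliable_qprod hs2 y)]
  congr 1
  ext i
  split_ifs <;> simp

end qprod

/-- The `q`-Pochhammer symbol `(y; q)_∞`. -/
def qpoch (q y : ℂ) : ℂ := qprod (fun j : ℕ => q ^ j) y

/-- The double infinite product `∏ (1 - q ^ j * p ^ k * y)`. -/
def Phi (q p y : ℂ) : ℂ := qprod (fun i : ℕ × ℕ => q ^ i.1 * p ^ i.2) y

theorem summable_pow_norm {q : ℂ} (hq : ‖q‖ < 1) : Summable fun j : ℕ => ‖q ^ j‖ := by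
  simpa only [norm_pow] using summable_geometric_of_lt_one (norm_nonneg _) hq

theorem summable_pow_pow_norm {q p : ℂ} (hq : ‖q‖ < 1) (hp : ‖p‖ < 1) :
    Summable fun i : ℕ × ℕ => ‖q ^ i.1 * p ^ i.2‖ := by
  simpa only [norm_mul] using (summable_pow_norm hq).mul_of_nonneg (summable_pow_norm hp)
    (fun _ => norm_nonneg _) fun _ => norm_nonneg _

theorem qpoch_eq_mul {q : ℂ} (hq : ‖q‖ < 1) (y : ℂ) : qpoch q y = (1 - y) * qpoch q (q * y) := by
  have h := multipliable_qprod (summable_pow_norm hq) (q * y)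
  have e : ∀ j : ℕ, q ^ j * (q * y) = q ^ (j + 1) * y := fun j => by ring
  simp only [e] at h
  have h2 := tprod_eq_zero_mul' (f := fun j : ℕ => 1 - q ^ j * y) h
  rw [pow_zero, one_mul] at h2
  simp only [qpoch, qprod, e]
  exact h2

theorem Phi_comm (q p y : ℂ) : Phi q p y = Phi p q y := by
  rw [Phi, qprod, Phi, qprod, ← (Equiv.prodComm ℕ ℕ).tprod_eq]
  simp [mul_comm]

theorem Phi_eq_mul' {q p : ℂ} (hq : ‖q‖ < 1) (hp : ‖p‖ < 1) (y : ℂ) :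
    Phi q p y = qpoch p y * Phi q p (q * y) := by
  have key : ∀ y, HasProd (fun j : ℕ => qpoch p (q ^ j * y)) (Phi q p y) := fun y =>
    (multipliable_qprod (summable_pow_pow_norm hq hp) y).hasProd.prod_fiberwise fun j => by
      have := (multipliable_qprod (summable_pow_norm hp) (q ^ j * y)).hasProd
      refine this.congr_fun fun k => ?_
      ring
  have h2 := key (q * y)
  have e : ∀ j : ℕ, q ^ j * (q * y) = q ^ (j + 1) * y := fun j => by ring
  simp only [e] at h2
  have h3 := h2.zero_mul (f := fun j : ℕ => qpoch p (q ^ j * y))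
  rw [pow_zero, one_mul] at h3
  exact (key y).unique h3

theorem Phi_eq_mul {q p : ℂ} (hq : ‖q‖ < 1) (hp : ‖p‖ < 1) (y : ℂ) :
    Phi q p y = qpoch q y * Phi q p (p * y) := by
  rw [Phi_comm, Phi_eq_mul' hp hq, Phi_comm q p]

theorem differentiable_qpoch {q : ℂ} (hq : ‖q‖ < 1) : Differentiable ℂ (qpoch q) :=
  differentiable_qprod (summable_pow_norm hq)

theorem differentiable_Phi {q p : ℂ} (hq : ‖q‖ < 1) (hp : ‖p‖ < 1) : Differentiable ℂ (Phi q p) :=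
  differentiable_qprod (summable_pow_pow_norm hq hp)

theorem norm_pow_pow_le {q p : ℂ} (hq : ‖q‖ < 1) (hp : ‖p‖ < 1) (j k : ℕ) :
    ‖q ^ j * p ^ k‖ ≤ 1 := by
  rw [norm_mul, norm_pow, norm_pow]
  exact mul_le_one₀ (pow_le_one₀ (norm_nonneg _) hq.le) (by positivity)
    (pow_le_one₀ (norm_nonneg _) hp.le)

theorem Phi_ne_zero {q p y : ℂ} (hq : ‖q‖ < 1) (hp : ‖p‖ < 1) (hy : ‖y‖ < 1) : Phi q p y ≠ 0 := by
  refine qprod_ne_zero (summable_pow_pow_norm hq hp) fun i h => ?_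
  have h1 := congrArg norm h
  rw [norm_mul, norm_one] at h1
  nlinarith [norm_pow_pow_le hq hp i.1 i.2, norm_nonneg y, norm_nonneg (q ^ i.1 * p ^ i.2)]

theorem qpoch_ne_zero {q y : ℂ} (hq : ‖q‖ < 1) (hy : ‖y‖ < 1) : qpoch q y ≠ 0 := by
  refine qprod_ne_zero (summable_pow_norm hq) fun j h => ?_
  have h1 := congrArg norm h
  rw [norm_mul, norm_one, norm_pow] at h1
  nlinarith [pow_le_one₀ (norm_nonneg q) hq.le (n := j), norm_nonneg y, norm_nonneg q]

/-! ### The theta function -/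

theorem theta_eq (z τ : ℂ) :
    theta z τ = -(exp (Real.pi * I * (τ / 4 + z + 1 / 2)) * jacobiTheta₂ (z + 1 / 2 + τ / 2) τ) := by
  rw [theta, jacobiTheta₂, ← tsum_mul_left]
  congr 2
  ext m
  rw [jacobiTheta₂_term, ← exp_add]
  congr 1
  ring

theorem differentiable_theta {τ : ℂ} (hτ : 0 < τ.im) : Differentiable ℂ fun z => theta z τ := by
  intro z
  simp only [theta_eq]
  have h : DifferentiableAt ℂ (fun z => jacobiTheta₂ (z + 1 / 2 + τ / 2) τ) z :=
    (differentiableAt_jacobiTheta₂_fst (z + 1 / 2 + τ / 2) hτ).comp z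
      (f := fun z => z + 1 / 2 + τ / 2) (by fun_prop)
  fun_prop

theorem exp_int_mul_pi_mul_I (n : ℤ) : exp (n * (Real.pi * I)) = (-1) ^ n := by
  rw [exp_int_mul, exp_pi_mul_I]

theorem theta_add_one (z τ : ℂ) : theta (z + 1) τ = -theta z τ := by
  rw [theta_eq, theta_eq, show z + 1 + 1 / 2 + τ / 2 = z + 1 / 2 + τ / 2 + 1 by ring,
    jacobiTheta₂_add_left, show (Real.pi * I * (τ / 4 + (z + 1) + 1 / 2) : ℂ) =
      Real.pi * I * (τ / 4 + z + 1 / 2) + Real.pi * I by ring, exp_add, exp_pi_mul_I]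
  ring

theorem theta_add_tau (z τ : ℂ) :
    theta (z + τ) τ = -exp (-(Real.pi * I * (2 * z + τ))) * theta z τ := by
  rw [theta_eq, theta_eq, show z + τ + 1 / 2 + τ / 2 = z + 1 / 2 + τ / 2 + τ by ring,
    jacobiTheta₂_add_left']
  have : exp (Real.pi * I * (τ / 4 + (z + τ) + 1 / 2)) * exp (-Real.pi * I * (τ + 2 * (z + 1 / 2 + τ / 2)))
      = -exp (-(Real.pi * I * (2 * z + τ))) * exp (Real.pi * I * (τ / 4 + z + 1 / 2)) := by
    rw [← neg_one_mul (exp _), ← exp_pi_mul_I, ← exp_add, ← exp_add, ← exp_add, exp_eq_exp_iff_exists_int]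
    exact ⟨-1, by push_cast; ring⟩
  linear_combination (-jacobiTheta₂ (z + 1 / 2 + τ / 2) τ) * this

theorem theta_neg (z τ : ℂ) : theta (-z) τ = -theta z τ := by
  have h := theta_add_tau (-(z + τ)) τ
  have h1 := jacobiTheta₂_neg_left (z + 1 / 2 + τ / 2) τ
  rw [theta_eq (-z), theta_eq z, ← h1]
  have h2 := jacobiTheta₂_add_left' (-z - 1 / 2 - τ / 2) τ
  have h3 := jacobiTheta₂_add_left (-z - 1 / 2 + τ / 2) τ
  rw [show -z - 1 / 2 - τ / 2 + τ = -z - 1 / 2 + τ / 2 by ring] at h2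
  rw [show -z - 1 / 2 + τ / 2 + 1 = -z + 1 / 2 + τ / 2 by ring] at h3
  rw [h3, h2, show -(z + 1 / 2 + τ / 2) = -z - 1 / 2 - τ / 2 by ring]
  have : exp (Real.pi * I * (τ / 4 + -z + 1 / 2)) * exp (-Real.pi * I * (τ + 2 * (-z - 1 / 2 - τ / 2)))
      = -exp (Real.pi * I * (τ / 4 + z + 1 / 2)) := by
    rw [← neg_one_mul (exp _), ← exp_pi_mul_I, ← exp_add, ← exp_add, exp_eq_exp_iff_exists_int]
    exact ⟨0, by push_cast; ring⟩
  linear_combination (-jacobiTheta₂ (-z - 1 / 2 - τ / 2) τ) * this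

theorem theta_zero (τ : ℂ) : theta 0 τ = 0 := by
  have := theta_neg 0 τ
  rw [neg_zero] at this
  linear_combination this / 2

theorem theta_add_int (z τ : ℂ) (n : ℤ) : theta (z + n) τ = (-1) ^ n * theta z τ := by
  induction n with
  | zero => simp
  | succ n ih =>
    push_cast at ih ⊢
    rw [← add_assoc, theta_add_one, ih, zpow_add_one₀ (by norm_num)]; ring
  | pred n ih =>
    push_cast at ih ⊢
    have := theta_add_one (z + (-n - 1)) τ
    rw [show z + (-n - 1) + 1 = z + -(n : ℂ) by ring, ih] at this
    rw [zpow_sub_one₀ (by norm_num)]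
    linear_combination this

theorem theta_add_int_mul (z τ : ℂ) (n : ℤ) :
    theta (z + n * τ) τ = (-1) ^ n * exp (-(Real.pi * I * (2 * n * z + n ^ 2 * τ))) * theta z τ := by
  induction n with
  | zero => simp
  | succ n ih =>
    push_cast at ih ⊢
    rw [show z + (n + 1) * τ = z + n * τ + τ by ring, theta_add_tau, ih,
      zpow_add_one₀ (by norm_num), show -(Real.pi * I * (2 * (n + 1) * z + (n + 1) ^ 2 * τ)) =
      -(Real.pi * I * (2 * (z + n * τ) + τ)) + -(Real.pi * I * (2 * n * z + n ^ 2 * τ)) by ring,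
      exp_add]
    ring
  | pred n ih =>
    push_cast at ih ⊢
    have := theta_add_tau (z + (-n - 1) * τ) τ
    rw [show z + (-n - 1) * τ + τ = z + -(n : ℂ) * τ by ring, ih] at this
    rw [zpow_sub_one₀ (by norm_num), show -(Real.pi * I * (2 * (-n - 1) * z + (-n - 1) ^ 2 * τ)) =
      -(Real.pi * I * (2 * -n * z + (-n) ^ 2 * τ)) +
      (Real.pi * I * (2 * (z + (-n - 1) * τ) + τ)) by ring, exp_add]
    have h0 : exp (-(Real.pi * I * (2 * (z + (-n - 1) * τ) + τ))) *
        exp (Real.pi * I * (2 * (z + (-n - 1) * τ) + τ)) = 1 := by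
      rw [← exp_add, neg_add_cancel, exp_zero]
    linear_combination exp (Real.pi * I * (2 * (z + (-n - 1) * τ) + τ)) * this -
      theta (z + (-n - 1) * τ) τ * h0

/-- Entire functions with the same multipliers as `theta`. -/
structure ThetaLike (τ : ℂ) (F : ℂ → ℂ) : Prop where
  diff : Differentiable ℂ F
  add_one : ∀ z, F (z + 1) = -F z
  add_tau : ∀ z, F (z + τ) = -exp (-(Real.pi * I * (2 * z + τ))) * F z

theorem exp_pi_add_one (z : ℂ) : exp (Real.pi * I * (z + 1)) = -exp (Real.pi * I * z) := by
  rw [mul_add, mul_one, exp_add, exp_pi_mul_I]; ring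

theorem ThetaLike.perEnt {τ : ℂ} {F : ℂ → ℂ} (hF : ThetaLike τ F) :
    PerEnt fun z => exp (Real.pi * I * z) * F z := by
  refine ⟨?_, fun z => ?_⟩
  · have := hF.diff
    fun_prop
  · rw [hF.add_one, exp_pi_add_one]; ring

theorem ThetaLike.fc_succ {τ : ℂ} {F : ℂ → ℂ} (hF : ThetaLike τ F) (n : ℤ) :
    fc (fun z => exp (Real.pi * I * z) * F z) (n + 1) =
      -(ee (n * τ) * fc (fun z => exp (Real.pi * I * z) * F z) n) := by
  rw [← fc_comp_add hF.perEnt]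
  have h : (fun z => exp (Real.pi * I * (z + τ)) * F (z + τ)) =
      fun z => (-1) * (ee ((-1 : ℤ) * z) * (exp (Real.pi * I * z) * F z)) := by
    ext z
    rw [hF.add_tau, mul_add, exp_add, ee]
    have : exp (Real.pi * I * τ) * exp (-(Real.pi * I * (2 * z + τ))) =
        exp (2 * Real.pi * I * ((-1 : ℤ) * z)) := by
      rw [← exp_add]; congr 1; push_cast; ring
    linear_combination (-exp (Real.pi * I * z) * F z) * this
  rw [h, fc_const_mul, fc_ee_mul, sub_neg_eq_add]
  ring

/-- The multipliers determine the theta function up to a factor. -/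
theorem ThetaLike.eq_zero {τ : ℂ} {F : ℂ → ℂ} (hF : ThetaLike τ F)
    (h : fc (fun z => exp (Real.pi * I * z) * F z) 0 = 0) (z : ℂ) : F z = 0 := by
  have h2 : ∀ n, fc (fun z => exp (Real.pi * I * z) * F z) n = 0 := by
    intro n
    induction n with
    | zero => exact h
    | succ n ih => rw [hF.fc_succ, ih]; simp
    | pred n ih =>
      have := hF.fc_succ (-n - 1)
      rw [sub_add_cancel, ih, zero_eq_neg] at this
      exact (mul_eq_zero.mp this).resolve_left (ee_ne_zero _)
  have := eq_zero_of_fc hF.perEnt h2 z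
  exact (mul_eq_zero.mp this).resolve_left (exp_ne_zero _)

theorem ThetaLike.exists_eq {τ : ℂ} {F G : ℂ → ℂ} (hF : ThetaLike τ F) (hG : ThetaLike τ G)
    (h0 : ∃ z, G z ≠ 0) : ∃ c, ∀ z, F z = c * G z := by
  obtain ⟨z₀, hz₀⟩ := h0
  have hne : fc (fun z => exp (Real.pi * I * z) * G z) 0 ≠ 0 := fun h => hz₀ (hG.eq_zero h z₀)
  refine ⟨fc (fun z => exp (Real.pi * I * z) * F z) 0 / fc (fun z => exp (Real.pi * I * z) * G z) 0,
    fun z => ?_⟩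
  set c := fc (fun z => exp (Real.pi * I * z) * F z) 0 / fc (fun z => exp (Real.pi * I * z) * G z) 0
    with hc
  have hH : ThetaLike τ fun z => F z + (-c) * G z :=
    ⟨hF.diff.add (hG.diff.const_mul _), fun z => by rw [hF.add_one, hG.add_one]; ring,
      fun z => by rw [hF.add_tau, hG.add_tau]; ring⟩
  have := hH.eq_zero (by
    have e : (fun z => exp (Real.pi * I * z) * (F z + -c * G z)) = fun z =>
        exp (Real.pi * I * z) * F z + (-c) * (exp (Real.pi * I * z) * G z) := by ext z; ring
    rw [e, fc_add hF.perEnt.diff.continuous (hG.perEnt.diff.continuous.const_mul _), fc_const_mul, hc]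
    field_simp
    ring) z
  linear_combination this

theorem thetaLike_theta {τ : ℂ} (hτ : 0 < τ.im) : ThetaLike τ fun z => theta z τ :=
  ⟨differentiable_theta hτ, fun z => theta_add_one z τ, fun z => theta_add_tau z τ⟩

/-- The product side of Jacobi's triple product identity. -/
def thetaProd (z τ : ℂ) : ℂ :=
  exp (-(Real.pi * I * z)) * (qpoch (ee τ) (ee z) * qpoch (ee τ) (ee τ / ee z))

theorem thetaLike_thetaProd {τ : ℂ} (hτ : 0 < τ.im) : ThetaLike τ fun z => thetaProd z τ := by
  have hq := norm_ee_lt_one hτ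
  refine ⟨?_, fun z => ?_, fun z => ?_⟩
  · have h1 : Differentiable ℂ fun z => qpoch (ee τ) (ee z) :=
      (differentiable_qpoch hq).comp differentiable_ee
    have h2 : Differentiable ℂ fun z => qpoch (ee τ) (ee τ / ee z) :=
      (differentiable_qpoch hq).comp ((differentiable_const _).div differentiable_ee ee_ne_zero)
    unfold thetaProd
    fun_prop
  · simp only [thetaProd]
    rw [ee_add, ee_one, mul_one, mul_add, mul_one, neg_add, exp_add, exp_neg (Real.pi * I),
      exp_pi_mul_I]
    ring
  · simp only [thetaProd]
    have h0 := ee_ne_zero z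
    have hq0 := ee_ne_zero τ
    rw [ee_add, show ee τ / (ee z * ee τ) = (ee z)⁻¹ by field_simp, qpoch_eq_mul hq (ee z)⁻¹,
      qpoch_eq_mul hq (ee z), mul_comm (ee z) (ee τ), ← div_eq_mul_inv]
    have : exp (-(Real.pi * I * (z + τ))) = exp (-(Real.pi * I * (2 * z + τ))) *
        exp (-(Real.pi * I * z)) * ee z := by
      rw [ee, ← exp_add, ← exp_add]; congr 1; ring
    rw [this]
    field_simp
    ring

theorem exists_theta_ne_zero {τ : ℂ} (hτ : 0 < τ.im) : ∃ z, theta z τ ≠ 0 := by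
  by_contra! h
  have h1 : ∀ z, jacobiTheta₂ z τ = 0 := fun z => by
    have := h (z - 1 / 2 - τ / 2)
    rw [theta_eq, neg_eq_zero, mul_eq_zero] at this
    rw [← this.resolve_left (exp_ne_zero _)]
    congr 1
    ring
  have h2 := fc_of_hasSum (G := fun z => jacobiTheta₂ z τ)
    (g := fun n => exp (Real.pi * I * n ^ 2 * τ)) (by
      have := ((summable_jacobiTheta₂_term_iff 0 τ).mpr hτ).norm
      simpa [jacobiTheta₂_term] using this)
    (fun t => by
      refine (hasSum_jacobiTheta₂_term t hτ).congr_fun fun n => ?_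
      rw [jacobiTheta₂_term, ee, ← exp_add]
      congr 1
      ring) 0
  simp [h1, fc] at h2

theorem exists_theta_eq_thetaProd {τ : ℂ} (hτ : 0 < τ.im) :
    ∃ c, c ≠ 0 ∧ ∀ z, theta z τ = c * thetaProd z τ := by
  have hq := norm_ee_lt_one hτ
  have h0 : thetaProd (τ / 2) τ ≠ 0 := by
    have h1 : 0 < (τ / 2).im := by
      have : (τ / 2).im = τ.im / 2 := by simp
      rw [this]; positivity
    have h2 : ee τ / ee (τ / 2) = ee (τ / 2) := by rw [← ee_sub]; congr 1; ring
    rw [thetaProd, h2]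
    have := qpoch_ne_zero hq (norm_ee_lt_one h1)
    exact mul_ne_zero (exp_ne_zero _) (mul_ne_zero this this)
  obtain ⟨c, hc⟩ := (thetaLike_theta hτ).exists_eq (thetaLike_thetaProd hτ) ⟨_, h0⟩
  refine ⟨c, ?_, hc⟩
  rintro rfl
  obtain ⟨z, hz⟩ := exists_theta_ne_zero hτ
  exact hz (by rw [hc, zero_mul])

theorem theta_eq_zero_iff {τ : ℂ} (hτ : 0 < τ.im) (z : ℂ) :
    theta z τ = 0 ↔ ∃ r s : ℤ, z = r + s * τ := by
  have hq := norm_ee_lt_one hτ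
  obtain ⟨c, hc, h⟩ := exists_theta_eq_thetaProd hτ
  constructor
  · intro hz
    rw [h, thetaProd, mul_eq_zero, mul_eq_zero, mul_eq_zero] at hz
    rcases (hz.resolve_left hc).resolve_left (exp_ne_zero _) with hz | hz
    · obtain ⟨j, hj⟩ := (qprod_eq_zero_iff (summable_pow_norm hq)).mp hz
      rw [← ee_nat_mul, ← ee_add, ee_eq_one_iff] at hj
      obtain ⟨n, hn⟩ := hj
      exact ⟨n, -j, by push_cast; linear_combination hn⟩
    · obtain ⟨j, hj⟩ := (qprod_eq_zero_iff (summable_pow_norm hq)).mp hz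
      rw [← ee_nat_mul, ← ee_sub, ← ee_add, ee_eq_one_iff] at hj
      obtain ⟨n, hn⟩ := hj
      exact ⟨-n, j + 1, by push_cast; linear_combination -hn⟩
  · rintro ⟨r, s, rfl⟩
    rw [theta_add_int_mul, ← zero_add (r : ℂ), theta_add_int, theta_zero]
    simp

theorem deriv_theta_zero_ne {τ : ℂ} (hτ : 0 < τ.im) : deriv (fun z => theta z τ) 0 ≠ 0 := by
  have hq := norm_ee_lt_one hτ
  obtain ⟨c, hc, h⟩ := exists_theta_eq_thetaProd hτ
  set F : ℂ → ℂ := fun z => c * (exp (-(Real.pi * I * z)) *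
    (qpoch (ee τ) (ee τ * ee z) * qpoch (ee τ) (ee τ / ee z))) with hF
  have e : (fun z => theta z τ) = fun z => (1 - ee z) * F z := by
    ext z
    rw [h, thetaProd, qpoch_eq_mul hq (ee z), hF]
    ring
  have hd : DifferentiableAt ℂ F 0 := by
    have h1 : DifferentiableAt ℂ (fun z => qpoch (ee τ) (ee τ * ee z)) 0 :=
      ((differentiable_qpoch hq).comp (differentiable_ee.const_mul _)) 0
    have h2 : DifferentiableAt ℂ (fun z => qpoch (ee τ) (ee τ / ee z)) 0 :=
      ((differentiable_qpoch hq).comp ((differentiable_const _).div differentiable_ee ee_ne_zero)) 0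
    rw [hF]
    fun_prop
  have hde : HasDerivAt ee (2 * Real.pi * I) 0 := by
    have := ((hasDerivAt_id (0 : ℂ)).const_mul (2 * Real.pi * I)).cexp
    simp only [mul_one, mul_zero, id_eq, exp_zero, one_mul] at this
    exact this
  have h3 := (hde.const_sub 1).mul hd.hasDerivAt
  have h4 : deriv (fun z => theta z τ) 0 = -(2 * Real.pi * I) * F 0 := by
    rw [e]
    refine (h3.deriv).trans ?_
    simp [ee_zero]
  rw [h4]
  have h5 : F 0 ≠ 0 := by
    simp only [hF, ee_zero, mul_one, div_one]
    have := qpoch_ne_zero hq hq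
    exact mul_ne_zero hc (mul_ne_zero (exp_ne_zero _) (mul_ne_zero this this))
  have h6 : (2 * Real.pi * I : ℂ) ≠ 0 := by simp [Real.pi_ne_zero]
  exact mul_ne_zero (neg_ne_zero.mpr h6) h5

/-- All zeros of the theta function are simple. -/
theorem deriv_theta_ne {τ : ℂ} (hτ : 0 < τ.im) {z : ℂ} (hz : theta z τ = 0) :
    deriv (fun z => theta z τ) z ≠ 0 := by
  obtain ⟨r, s, rfl⟩ := (theta_eq_zero_iff hτ z).mp hz
  have hd := differentiable_theta hτ
  have h1 : (fun z => theta (z + (r + s * τ)) τ) = fun z => (-1) ^ s * (-1) ^ r *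
      exp (-(Real.pi * I * (2 * s * (z + r) + s ^ 2 * τ))) * theta z τ := by
    ext z
    rw [← add_assoc, theta_add_int_mul, theta_add_int]
    ring
  have h2 := deriv_comp_add_const (f := fun z => theta z τ) (r + s * τ) 0
  rw [zero_add, h1, deriv_fun_mul (by fun_prop) (hd 0), theta_zero, mul_zero, zero_add] at h2
  rw [← h2]
  refine mul_ne_zero (mul_ne_zero (mul_ne_zero ?_ ?_) (exp_ne_zero _)) (deriv_theta_zero_ne hτ) <;>
    exact zpow_ne_zero _ (by norm_num)

/-! ### Hadamard products of power series -/

open PowerSeries in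
/-- Uniform decay of the coefficients of a family of power series, at least as fast as any
geometric progression of ratio greater than `ρ`. -/
def Decay {ι : Type} (ρ : ℝ) (g : ι → PowerSeries ℂ) : Prop :=
  ∀ ρ' > ρ, ∃ C : ℝ, 0 ≤ C ∧ ∀ i m, ‖coeff m (g i)‖ ≤ C * ρ' ^ m

section Decay

open PowerSeries

variable {ι : Type} {ρ : ℝ} {g g' : ι → PowerSeries ℂ}

theorem Decay.mono {ρ₂ : ℝ} (hg : Decay ρ g) (h : ρ ≤ ρ₂) : Decay ρ₂ g :=
  fun ρ' hρ' => hg ρ' (h.trans_lt hρ')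

theorem Decay.add (hg : Decay ρ g) (hg' : Decay ρ g') :
    Decay ρ fun i => g i + g' i := by
  intro ρ' hρ'
  obtain ⟨C, hC, h⟩ := hg ρ' hρ'
  obtain ⟨C', hC', h'⟩ := hg' ρ' hρ'
  refine ⟨C + C', add_nonneg hC hC', fun i m => ?_⟩
  rw [map_add, add_mul]
  exact (norm_add_le _ _).trans (add_le_add (h i m) (h' i m))

theorem Decay.poly_mul (hρ : 0 ≤ ρ) (P : Polynomial ℂ) (hg : Decay ρ g) :
    Decay ρ fun i => (P : PowerSeries ℂ) * g i := by
  have hC : ∀ (a : ℂ) (g : ι → PowerSeries ℂ), Decay ρ g → Decay ρ fun i => C a * g i := by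
    intro a g hg ρ' hρ'
    obtain ⟨C, hC, h⟩ := hg ρ' hρ'
    refine ⟨‖a‖ * C, by positivity, fun i m => ?_⟩
    rw [coeff_C_mul, norm_mul, mul_assoc]
    exact mul_le_mul_of_nonneg_left (h i m) (norm_nonneg _)
  have hX : ∀ g : ι → PowerSeries ℂ, Decay ρ g → Decay ρ fun i => X * g i := by
    intro g hg ρ' hρ'
    obtain ⟨C, hC, h⟩ := hg ρ' hρ'
    have hpos : 0 < ρ' := hρ.trans_lt hρ'
    refine ⟨C / ρ', by positivity, fun i m => ?_⟩
    rcases m with _ | m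
    · simp only [coeff_zero_X_mul, norm_zero, pow_zero, mul_one]; positivity
    · rw [coeff_succ_X_mul]
      refine (h i m).trans (le_of_eq ?_)
      field_simp
      ring
  induction P using Polynomial.induction_on generalizing g with
  | C a => simpa using hC a g hg
  | add P Q hP hQ =>
    have := (hP hg).add (hQ hg)
    simpa only [Polynomial.coe_add, add_mul] using this
  | monomial n a h =>
    have := h (hX g hg)
    have e : (fun i => ((Polynomial.C a * Polynomial.X ^ (n + 1) : Polynomial ℂ) : PowerSeries ℂ)
        * g i) = fun i => ((Polynomial.C a * Polynomial.X ^ n : Polynomial ℂ) : PowerSeries ℂ)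
        * (X * g i) := by
      ext1 i
      rw [pow_succ, ← mul_assoc, Polynomial.coe_mul, Polynomial.coe_X, mul_assoc]
    rw [e]
    exact this

/-- The Hadamard (coefficientwise) product of power series. -/
def had (g g' : PowerSeries ℂ) : PowerSeries ℂ := PowerSeries.mk fun m => coeff m g * coeff m g'

theorem coeff_had (g g' : PowerSeries ℂ) (m : ℕ) :
    coeff m (had g g') = coeff m g * coeff m g' := by simp [had]

theorem had_comm (g g' : PowerSeries ℂ) : had g g' = had g' g := by
  ext m; rw [coeff_had, coeff_had, mul_comm]

theorem Decay.had (hρ : 0 ≤ ρ) (hg : Decay ρ g) (hg' : Decay 1 g') :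
    Decay ρ fun i => had (g i) (g' i) := by
  intro ρ' hρ'
  obtain ⟨ρ₁, h1, h2⟩ := exists_between hρ'
  have hpos : 0 < ρ₁ := hρ.trans_lt h1
  obtain ⟨C, hC, h⟩ := hg ρ₁ h1
  obtain ⟨C', hC', h'⟩ := hg' (ρ' / ρ₁) (by rw [gt_iff_lt, one_lt_div hpos]; exact h2)
  refine ⟨C * C', by positivity, fun i m => ?_⟩
  rw [coeff_had, norm_mul]
  refine (mul_le_mul (h i m) (h' i m) (norm_nonneg _) (by positivity)).trans (le_of_eq ?_)
  rw [div_pow]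
  field_simp

/-- The polynomial `∏ (1 - s X)`. -/
def linProd (L : List ℂ) : Polynomial ℂ :=
  (L.map fun s => 1 - Polynomial.C s * Polynomial.X).prod

theorem linProd_cons (s : ℂ) (L : List ℂ) :
    linProd (s :: L) = (1 - Polynomial.C s * Polynomial.X) * linProd L := by simp [linProd]

theorem linProd_cons_mul (s : ℂ) (L : List ℂ) (g : PowerSeries ℂ) :
    (linProd (s :: L) : PowerSeries ℂ) * g = (linProd L : PowerSeries ℂ) * ((1 - C s * X) * g) := by
  rw [linProd_cons]; push_cast; ring

theorem coeff_zero_one_sub_mul (s : ℂ) (g : PowerSeries ℂ) :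
    coeff 0 ((1 - C s * X) * g) = coeff 0 g := by
  simp

theorem coeff_succ_one_sub_mul (s : ℂ) (g : PowerSeries ℂ) (m : ℕ) :
    coeff (m + 1) ((1 - C s * X) * g) = coeff (m + 1) g - s * coeff m g := by
  rw [sub_mul, one_mul, map_sub, mul_assoc, coeff_C_mul, coeff_succ_X_mul]

/-- Division by `1 - s X` with `‖s‖ ≤ 1` produces a singularity outside the open unit disc only. -/
theorem Decay.of_one_sub_mul {s : ℂ} (hs : ‖s‖ ≤ 1)
    (hg : Decay 1 fun i => (1 - C s * X) * g i) : Decay 1 g := by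
  intro ρ' hρ'
  obtain ⟨K, hK, h⟩ := hg ρ' hρ'
  have hρ1 : 0 < ρ' - 1 := by linarith
  have hρ0 : 0 < ρ' := by linarith
  have hle : K ≤ K * ρ' / (ρ' - 1) := by
    rw [le_div_iff₀ hρ1]; nlinarith
  refine ⟨K * ρ' / (ρ' - 1), by positivity, fun i m => ?_⟩
  induction m with
  | zero =>
    have := h i 0
    rw [coeff_zero_one_sub_mul] at this
    refine this.trans ?_
    simpa using hle
  | succ m ih =>
    have h1 := h i (m + 1)
    rw [coeff_succ_one_sub_mul] at h1
    have h2 : ‖coeff (m + 1) (g i)‖ ≤ K * ρ' ^ (m + 1) + K * ρ' / (ρ' - 1) * ρ' ^ m := by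
      calc ‖coeff (m + 1) (g i)‖ = ‖(coeff (m + 1) (g i) - s * coeff m (g i)) + s * coeff m (g i)‖ := by
            rw [sub_add_cancel]
        _ ≤ _ := (norm_add_le _ _).trans (add_le_add h1 (by
            rw [norm_mul]
            exact (mul_le_of_le_one_left (norm_nonneg _) hs).trans ih))
    refine h2.trans (le_of_eq ?_)
    field_simp
    ring

theorem Decay.of_linProd_mul {L : List ℂ} (hL : ∀ s ∈ L, ‖s‖ ≤ 1)
    (hg : Decay 1 fun i => (linProd L : PowerSeries ℂ) * g i) : Decay 1 g := by
  induction L generalizing g with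
  | nil => simpa [linProd] using hg
  | cons s L ih =>
    simp only [linProd_cons_mul] at hg
    exact (ih (fun s' hs' => hL s' (List.mem_cons_of_mem _ hs')) hg).of_one_sub_mul
      (hL s List.mem_cons_self)

/-- If multiplication by `1 - s X` improves `g` and multiplication by `1 - s' X` improves `g'`,
then multiplication by `1 - s s' X` reduces the Hadamard product of `g` and `g'` to Hadamard
products with at least one improved factor. -/
theorem one_sub_mul_had (s s' : ℂ) (g g' : PowerSeries ℂ) :
    (1 - C (s * s') * X) * had g g' = had ((1 - C s * X) * g) g' + had g ((1 - C s' * X) * g') -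
      had ((1 - C s * X) * g) ((1 - C s' * X) * g') := by
  ext m
  rcases m with _ | m
  · simp only [map_sub, map_add, coeff_had, coeff_zero_one_sub_mul]
    ring
  · simp only [map_sub, map_add, coeff_had, coeff_succ_one_sub_mul]
    ring

/-- A Hadamard product of meromorphic functions is meromorphic: the reciprocals of its poles are
products of reciprocals of the poles of the factors. The denominator `E` depends only on the poles
of the factors. -/
theorem exists_denominator (hρ : 0 ≤ ρ) (hρ1 : ρ ≤ 1) (L L' : List ℂ) (hL : ∀ s ∈ L, ‖s‖ ≤ 1)
    (hL' : ∀ s ∈ L', ‖s‖ ≤ 1) :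
    ∃ E : Polynomial ℂ, (∀ z, E.eval z = 0 → ∃ s ∈ L, ∃ s' ∈ L', s * s' * z = 1) ∧
      ∀ {ι : Type} (g g' : ι → PowerSeries ℂ), Decay ρ (fun i => (linProd L : PowerSeries ℂ) * g i) →
        Decay ρ (fun i => (linProd L' : PowerSeries ℂ) * g' i) →
        Decay ρ fun i => (E : PowerSeries ℂ) * had (g i) (g' i) := by
  induction L generalizing L' with
  | nil =>
    refine ⟨1, by simp, fun g g' hg hg' => ?_⟩
    simp only [linProd, List.map_nil, List.prod_nil, Polynomial.coe_one, one_mul] at hg ⊢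
    exact hg.had hρ ((hg'.mono hρ1).of_linProd_mul hL')
  | cons s L ih =>
    have hLt : ∀ s ∈ L, ‖s‖ ≤ 1 := fun s hs => hL s (List.mem_cons_of_mem _ hs)
    induction L' with
    | nil =>
      refine ⟨1, by simp, fun g g' hg hg' => ?_⟩
      simp only [linProd, List.map_nil, List.prod_nil, Polynomial.coe_one, one_mul] at hg' ⊢
      simp only [had_comm (g _)]
      exact hg'.had hρ ((hg.mono hρ1).of_linProd_mul hL)
    | cons s' L' ih' =>
      have hLt' : ∀ s ∈ L', ‖s‖ ≤ 1 := fun s hs => hL' s (List.mem_cons_of_mem _ hs)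
      obtain ⟨E₁, hE₁, h₁⟩ := ih (s' :: L') hLt hL'
      obtain ⟨E₂, hE₂, h₂⟩ := ih' hLt'
      obtain ⟨E₃, hE₃, h₃⟩ := ih L' hLt hLt'
      refine ⟨(1 - Polynomial.C (s * s') * Polynomial.X) * (E₁ * E₂ * E₃), fun z hz => ?_,
        fun g g' hg hg' => ?_⟩
      · simp only [Polynomial.eval_mul, Polynomial.eval_sub, Polynomial.eval_one,
          Polynomial.eval_C, Polynomial.eval_X, mul_eq_zero] at hz
        rcases hz with hz | (hz | hz) | hz
        · exact ⟨s, List.mem_cons_self, s', List.mem_cons_self, by linear_combination -hz⟩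
        · obtain ⟨t, ht, t', ht', h⟩ := hE₁ z hz
          exact ⟨t, List.mem_cons_of_mem _ ht, t', ht', h⟩
        · obtain ⟨t, ht, t', ht', h⟩ := hE₂ z hz
          exact ⟨t, ht, t', List.mem_cons_of_mem _ ht', h⟩
        · obtain ⟨t, ht, t', ht', h⟩ := hE₃ z hz
          exact ⟨t, List.mem_cons_of_mem _ ht, t', List.mem_cons_of_mem _ ht', h⟩
      · have hg1 := hg
        have hg1' := hg'
        simp only [linProd_cons_mul] at hg1 hg1'
        have d₁ := (h₁ (fun i => (1 - C s * X) * g i) g' hg1 hg').poly_mul hρ (E₂ * E₃)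
        have d₂ := (h₂ g (fun i => (1 - C s' * X) * g' i) hg hg1').poly_mul hρ (E₁ * E₃)
        have d₃ := (h₃ (fun i => (1 - C s * X) * g i) (fun i => (1 - C s' * X) * g' i)
          hg1 hg1').poly_mul hρ (-(E₁ * E₂))
        have d := (d₁.add d₂).add d₃
        have e : ∀ i, (((1 - Polynomial.C (s * s') * Polynomial.X) * (E₁ * E₂ * E₃) :
            Polynomial ℂ) : PowerSeries ℂ) * had (g i) (g' i) =
            ((E₁ * E₂ * E₃ : Polynomial ℂ) : PowerSeries ℂ) *
            ((1 - C (s * s') * X) * had (g i) (g' i)) := by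
          intro i
          push_cast
          ring
        simp only [e, one_sub_mul_had]
        convert d using 2 with i
        push_cast
        ring

/-! ### Sums of power series -/

/-- The sum of a power series. -/
def psum (g : PowerSeries ℂ) (z : ℂ) : ℂ := ∑' m, coeff m g * z ^ m

theorem hasSum_poly_mul {g : PowerSeries ℂ} {z S : ℂ} (hg : HasSum (fun m => coeff m g * z ^ m) S)
    (P : Polynomial ℂ) :
    HasSum (fun m => coeff m ((P : PowerSeries ℂ) * g) * z ^ m) (P.eval z * S) := by
  induction P using Polynomial.induction_on generalizing g S with
  | C a =>
    simp only [Polynomial.coe_C, coeff_C_mul, Polynomial.eval_C, mul_assoc]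
    exact hg.mul_left a
  | add P Q hP hQ =>
    simp only [Polynomial.coe_add, add_mul, map_add, Polynomial.eval_add]
    exact (hP hg).add (hQ hg)
  | monomial n a h =>
    have hX : HasSum (fun m => coeff m (X * g) * z ^ m) (z * S) := by
      rw [← hasSum_nat_add_iff' 1]
      simp only [Finset.range_one, Finset.sum_singleton, coeff_zero_X_mul, zero_mul, sub_zero,
        coeff_succ_X_mul]
      refine (hg.mul_left z).congr_fun fun m => ?_
      ring
    have h2 := h hX
    have e : ((Polynomial.C a * Polynomial.X ^ (n + 1) : Polynomial ℂ) : PowerSeries ℂ) * g =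
        ((Polynomial.C a * Polynomial.X ^ n : Polynomial ℂ) : PowerSeries ℂ) * (X * g) := by
      rw [pow_succ, ← mul_assoc, Polynomial.coe_mul, Polynomial.coe_X, mul_assoc]
    rw [e]
    convert h2 using 1
    simp only [Polynomial.eval_mul, Polynomial.eval_C, Polynomial.eval_pow, Polynomial.eval_X]
    ring

/-- A uniform summable bound for the terms of a family of power series on a smaller disc. -/
theorem Decay.exists_bound (hg : Decay ρ g) (hρ : 0 ≤ ρ) {r : ℝ} (hr : 0 ≤ r) (hrρ : ρ * r < 1) :
    ∃ (C κ : ℝ), 0 ≤ C ∧ 0 ≤ κ ∧ κ < 1 ∧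
      ∀ i m (z : ℂ), ‖z‖ ≤ r → ‖coeff m (g i) * z ^ m‖ ≤ C * κ ^ m := by
  obtain ⟨ρ', h1, h2⟩ : ∃ ρ' > ρ, ρ' * r < 1 := by
    have hcont : Filter.Tendsto (fun x : ℝ => x * r) (nhdsWithin ρ (Set.Ioi ρ)) (nhds (ρ * r)) :=
      (Continuous.tendsto (by fun_prop) ρ).mono_left nhdsWithin_le_nhds
    obtain ⟨x, hx1, hx2⟩ := ((hcont.eventually (gt_mem_nhds hrρ)).and self_mem_nhdsWithin).exists
    exact ⟨x, hx2, hx1⟩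
  have hpos : 0 < ρ' := hρ.trans_lt h1
  obtain ⟨C, hC, h⟩ := hg ρ' h1
  refine ⟨C, ρ' * r, hC, by positivity, h2, fun i m z hz => ?_⟩
  rw [norm_mul, norm_pow, mul_pow, ← mul_assoc]
  exact mul_le_mul (h i m) (pow_le_pow_left₀ (norm_nonneg _) hz m) (by positivity) (by positivity)

theorem Decay.exists_norm_psum_le (hg : Decay ρ g) (hρ : 0 ≤ ρ) {r : ℝ} (hr : 0 ≤ r)
    (hrρ : ρ * r < 1) : ∃ M : ℝ, 0 ≤ M ∧ ∀ i (z : ℂ), ‖z‖ ≤ r → ‖psum (g i) z‖ ≤ M := by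
  obtain ⟨C, κ, hC, hκ, hκ1, h⟩ := hg.exists_bound hρ hr hrρ
  refine ⟨∑' m, C * κ ^ m, tsum_nonneg fun m => by positivity, fun i z hz => ?_⟩
  exact tsum_of_norm_bounded ((summable_geometric_of_lt_one hκ hκ1).mul_left C).hasSum
    fun m => h i m z hz

theorem Decay.differentiableOn (hg : Decay ρ g) (hρ : 0 ≤ ρ) {r : ℝ} (hr : ρ * r ≤ 1) (i : ι) :
    DifferentiableOn ℂ (psum (g i)) (Metric.ball 0 r) := by
  intro z hz
  rw [mem_ball_zero_iff] at hz
  obtain ⟨t, ht1, ht2⟩ := exists_between hz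
  have hrt : ρ * t < 1 := by
    rcases hρ.eq_or_lt with h | h
    · rw [← h]; simp
    · exact (mul_lt_mul_of_pos_left ht2 h).trans_le hr
  obtain ⟨C, κ, hC, hκ, hκ1, h⟩ := hg.exists_bound hρ ((norm_nonneg z).trans ht1.le) hrt
  have hd : DifferentiableOn ℂ (psum (g i)) (Metric.ball 0 t) := by
    refine Complex.differentiableOn_tsum_of_summable_norm
      ((summable_geometric_of_lt_one hκ hκ1).mul_left C) (fun m => ?_) Metric.isOpen_ball
      fun m w hw => h i m w (mem_ball_zero_iff.mp hw).le
    fun_prop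
  exact (hd.differentiableAt (Metric.isOpen_ball.mem_nhds
    (mem_ball_zero_iff.mpr ht1))).differentiableWithinAt

/-- A power series is determined by its sum near the origin. -/
theorem coeff_eq_of_hasSum {a b : PowerSeries ℂ} {F : ℂ → ℂ} {r : ℝ} (hr : 0 < r)
    (ha : ∀ z : ℂ, ‖z‖ < r → HasSum (fun m => coeff m a * z ^ m) (F z))
    (hb : ∀ z : ℂ, ‖z‖ < r → HasSum (fun m => coeff m b * z ^ m) (F z)) : a = b := by
  have key : ∀ a : PowerSeries ℂ, (∀ z : ℂ, ‖z‖ < r → HasSum (fun m => coeff m a * z ^ m) (F z)) →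
      HasFPowerSeriesAt F (FormalMultilinearSeries.ofScalars ℂ fun m => coeff m a) 0 := by
    intro a ha
    rw [hasFPowerSeriesAt_iff]
    filter_upwards [Metric.ball_mem_nhds (0 : ℂ) hr] with z hz
    rw [zero_add]
    refine (ha z (mem_ball_zero_iff.mp hz)).congr_fun fun m => ?_
    rw [FormalMultilinearSeries.coeff_ofScalars, smul_eq_mul, mul_comm]
  have h := (key a ha).eq_formalMultilinearSeries (key b hb)
  ext m
  have h2 := congrArg (fun p => FormalMultilinearSeries.coeff p m) h
  simpa using h2

/-- The Taylor series at the origin. -/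
def taylor (f : ℂ → ℂ) : PowerSeries ℂ :=
  PowerSeries.mk fun m => iteratedDeriv m f 0 / (m.factorial : ℂ)

theorem hasSum_taylor {f : ℂ → ℂ} {r : ℝ} (hf : DifferentiableOn ℂ f (Metric.ball 0 r)) {z : ℂ}
    (hz : ‖z‖ < r) : HasSum (fun m => coeff m (taylor f) * z ^ m) (f z) := by
  refine (Complex.hasSum_taylorSeries_on_ball hf (mem_ball_zero_iff.mpr hz)).congr_fun fun m => ?_
  rw [taylor, coeff_mk, sub_zero, smul_eq_mul, smul_eq_mul]
  ring

theorem decay_taylor {f : ℂ → ℂ} {r : ℝ} (hr : 0 < r)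
    (hf : DifferentiableOn ℂ f (Metric.ball 0 r)) : Decay r⁻¹ fun _ : Unit => taylor f := by
  intro ρ' hρ'
  have hpos : 0 < ρ' := (inv_pos.mpr hr).trans hρ'
  have hlt : ρ'⁻¹ < r := inv_lt_of_inv_lt₀ hr hρ'
  have hsub : Metric.closedBall (0 : ℂ) ρ'⁻¹ ⊆ Metric.ball 0 r := Metric.closedBall_subset_ball hlt
  obtain ⟨C, hC⟩ := (isCompact_sphere (0 : ℂ) ρ'⁻¹).exists_bound_of_continuousOn
    (hf.continuousOn.mono (Metric.sphere_subset_closedBall.trans hsub))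
  refine ⟨max C 0, le_max_right _ _, fun _ m => ?_⟩
  have h := Complex.norm_iteratedDeriv_le_of_forall_mem_sphere_norm_le m (inv_pos.mpr hpos)
    (DifferentiableOn.diffContOnCl (by
      rw [closure_ball _ (inv_pos.mpr hpos).ne']; exact hf.mono hsub)) hC
  have hm : (0 : ℝ) < m.factorial := by positivity
  rw [taylor, coeff_mk, norm_div, norm_natCast, div_le_iff₀ hm]
  refine h.trans ?_
  rw [inv_pow, div_inv_eq_mul]
  have : C * ρ' ^ m ≤ max C 0 * ρ' ^ m :=
    mul_le_mul_of_nonneg_right (le_max_left _ _) (by positivity)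
  nlinarith

theorem coeff_poly_mul (P : Polynomial ℂ) (g : PowerSeries ℂ) (m : ℕ) :
    coeff m ((P : PowerSeries ℂ) * g) =
      ∑ i ∈ Finset.range (P.natDegree + 1), P.coeff i * if i ≤ m then coeff (m - i) g else 0 := by
  conv_lhs => rw [P.as_sum_range_C_mul_X_pow]
  rw [← Polynomial.coeToPowerSeries.ringHom_apply, map_sum, Finset.sum_mul, map_sum]
  refine Finset.sum_congr rfl fun i _ => ?_
  rw [Polynomial.coeToPowerSeries.ringHom_apply]
  push_cast
  rw [mul_assoc, coeff_C_mul, coeff_X_pow_mul']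

/-- The power series with the coefficients of `g`, starting with index `n`. -/
def shift (g : PowerSeries ℂ) (n : ℕ) : PowerSeries ℂ := PowerSeries.mk fun m => coeff (m + n) g

theorem coeff_shift (g : PowerSeries ℂ) (n m : ℕ) : coeff m (shift g n) = coeff (m + n) g := by
  rw [shift, coeff_mk]

theorem Decay.shift {g : PowerSeries ℂ} {P : Polynomial ℂ} (hρ : 0 ≤ ρ) (hρ1 : ρ < 1)
    (hg : Decay ρ fun _ : Unit => (P : PowerSeries ℂ) * g) {B : ℝ} (hB : ∀ m, ‖coeff m g‖ ≤ B) :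
    Decay ρ fun n : ℕ => (P : PowerSeries ℂ) * shift g n := by
  have key : ∀ ρ', ρ < ρ' → ρ' ≤ 1 → ∃ C : ℝ, 0 ≤ C ∧ ∀ n m,
      ‖coeff m ((P : PowerSeries ℂ) * HypergeometricTheta.shift g n)‖ ≤ C * ρ' ^ m := by
    intro ρ' hρ' hρ'1
    have hpos : 0 < ρ' := hρ.trans_lt hρ'
    obtain ⟨C, hC, h⟩ := hg ρ' hρ'
    have hB0 : 0 ≤ B := (norm_nonneg _).trans (hB 0)
    set A := ∑ i ∈ Finset.range (P.natDegree + 1), ‖P.coeff i‖ * B with hA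
    have hA0 : 0 ≤ A := Finset.sum_nonneg fun i _ => by positivity
    refine ⟨C + A / ρ' ^ P.natDegree, by positivity, fun n m => ?_⟩
    rcases le_or_gt P.natDegree m with hm | hm
    · have e : coeff m ((P : PowerSeries ℂ) * HypergeometricTheta.shift g n) =
          coeff (m + n) ((P : PowerSeries ℂ) * g) := by
        rw [coeff_poly_mul, coeff_poly_mul]
        refine Finset.sum_congr rfl fun i hi => ?_
        have hi' : i ≤ m := by rw [Finset.mem_range] at hi; omega
        rw [if_pos hi', if_pos (by omega), coeff_shift, show m - i + n = m + n - i by omega]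
      rw [e]
      refine (h () (m + n)).trans ?_
      rw [pow_add, ← mul_assoc]
      have h1 : ρ' ^ n ≤ 1 := pow_le_one₀ hpos.le hρ'1
      have h2 : 0 ≤ A / ρ' ^ P.natDegree * ρ' ^ m := by positivity
      have h3 : 0 ≤ C * ρ' ^ m := by positivity
      nlinarith
    · have h1 : ‖coeff m ((P : PowerSeries ℂ) * HypergeometricTheta.shift g n)‖ ≤ A := by
        rw [coeff_poly_mul]
        refine (norm_sum_le _ _).trans (Finset.sum_le_sum fun i _ => ?_)
        rw [norm_mul]
        refine mul_le_mul_of_nonneg_left ?_ (norm_nonneg _)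
        split_ifs
        · rw [coeff_shift]; exact hB _
        · simpa using hB0
      have h2 : A ≤ A / ρ' ^ P.natDegree * ρ' ^ m := by
        rw [div_mul_eq_mul_div, le_div_iff₀ (by positivity)]
        exact mul_le_mul_of_nonneg_left (pow_le_pow_of_le_one hpos.le hρ'1 hm.le) hA0
      have h3 : 0 ≤ C * ρ' ^ m := by positivity
      linarith
  intro ρ' hρ'
  rcases le_or_gt ρ' 1 with h1 | h1
  · exact key ρ' hρ' h1
  · obtain ⟨C, hC, h⟩ := key 1 hρ1 le_rfl
    refine ⟨C, hC, fun n m => (h n m).trans ?_⟩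
    rw [one_pow]
    exact mul_le_mul_of_nonneg_left (one_le_pow₀ h1.le) hC

end Decay

/-! ### The reciprocal of the double product and its coefficients -/

section Reciprocal

open PowerSeries

variable {q p : ℂ}

/-- The Taylor series of `1 / Phi q p` at the origin. -/
def recSeries (q p : ℂ) : PowerSeries ℂ := taylor fun y => (Phi q p y)⁻¹

theorem differentiableOn_inv_Phi (hq : ‖q‖ < 1) (hp : ‖p‖ < 1) :
    DifferentiableOn ℂ (fun y => (Phi q p y)⁻¹) (Metric.ball 0 1) := fun y hy =>
  ((differentiable_Phi hq hp y).inv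
    (Phi_ne_zero hq hp (mem_ball_zero_iff.mp hy))).differentiableWithinAt

theorem hasSum_recSeries (hq : ‖q‖ < 1) (hp : ‖p‖ < 1) {y : ℂ} (hy : ‖y‖ < 1) :
    HasSum (fun m => coeff m (recSeries q p) * y ^ m) (Phi q p y)⁻¹ :=
  hasSum_taylor (differentiableOn_inv_Phi hq hp) hy

open Classical in
/-- Cancelling finitely many poles of `1 / Phi q p`: the remaining factors have no zero in the
disc of radius `R`. -/
theorem linProd_mul_recSeries (hq : ‖q‖ < 1) (hp : ‖p‖ < 1) (T : Finset (ℕ × ℕ)) {R : ℝ}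
    (hR : 1 ≤ R) (hT : ∀ i ∉ T, ‖q ^ i.1 * p ^ i.2‖ * R ≤ 1) :
    ∃ f : ℂ → ℂ, DifferentiableOn ℂ f (Metric.ball 0 R) ∧ (∀ y, ‖y‖ < R → f y ≠ 0) ∧
      (linProd (T.toList.map fun i => q ^ i.1 * p ^ i.2) : PowerSeries ℂ) * recSeries q p =
        taylor f := by
  have hs := summable_pow_pow_norm hq hp
  set s' : ℕ × ℕ → ℂ := fun i => if i ∈ T then 0 else q ^ i.1 * p ^ i.2 with hs'
  have hs2 : Summable fun i => ‖s' i‖ := by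
    refine .of_nonneg_of_le (fun _ => norm_nonneg _) (fun i => ?_) hs
    simp only [hs']
    split_ifs
    · rw [norm_zero]; exact norm_nonneg _
    · exact le_rfl
  have hne : ∀ y, ‖y‖ < R → qprod s' y ≠ 0 := by
    intro y hy
    refine qprod_ne_zero hs2 fun i hi => ?_
    have h1 := congrArg norm hi
    rw [norm_mul, norm_one] at h1
    by_cases hiT : i ∈ T
    · simp [hs', hiT] at h1
    · have h2 := hT i hiT
      simp only [hs', if_neg hiT] at h1
      have h3 : 0 < ‖q ^ i.1 * p ^ i.2‖ := by
        rcases (norm_nonneg (q ^ i.1 * p ^ i.2)).eq_or_lt with h | h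
        · rw [← h, zero_mul] at h1; norm_num at h1
        · exact h
      nlinarith
  have hd : DifferentiableOn ℂ (fun y => (qprod s' y)⁻¹) (Metric.ball 0 R) := fun y hy =>
    ((differentiable_qprod hs2 y).inv (hne y (mem_ball_zero_iff.mp hy))).differentiableWithinAt
  refine ⟨_, hd, fun y hy => inv_ne_zero (hne y hy), ?_⟩
  refine coeff_eq_of_hasSum one_pos (F := fun y => (qprod s' y)⁻¹) (fun y hy => ?_)
    fun y hy => hasSum_taylor hd (hy.trans_le hR)
  have h := hasSum_poly_mul (hasSum_recSeries hq hp hy)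
    (linProd (T.toList.map fun i => q ^ i.1 * p ^ i.2))
  convert h using 1
  have h2 : (linProd (T.toList.map fun i => q ^ i.1 * p ^ i.2)).eval y =
      ∏ i ∈ T, (1 - q ^ i.1 * p ^ i.2 * y) := by
    rw [linProd, List.map_map, Polynomial.eval_list_prod, List.map_map, ← Finset.prod_map_toList]
    congr 1
    refine List.map_congr_left fun i _ => ?_
    simp
  have h3 := qprod_split hs T y
  have h4 := Phi_ne_zero hq hp hy
  rw [Phi, h3] at h4
  rw [h2, Phi, h3, mul_inv, ← mul_assoc, mul_inv_cancel₀ (left_ne_zero_of_mul h4), one_mul]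

theorem finite_norm_pow_pow_gt (hq : ‖q‖ < 1) (hp : ‖p‖ < 1) {ε : ℝ} (hε : 0 < ε) :
    {i : ℕ × ℕ | ¬ ‖q ^ i.1 * p ^ i.2‖ < ε}.Finite :=
  (summable_pow_pow_norm hq hp).tendsto_cofinite_zero.eventually (gt_mem_nhds hε)

/-- The coefficients of `1 / Phi q p` tend to a non-zero limit, since `1` is the only
singularity on the unit circle, a simple pole. -/
theorem exists_tendsto_coeff_recSeries (hq : ‖q‖ < 1) (hp : ‖p‖ < 1) :
    ∃ c : ℂ, c ≠ 0 ∧ Filter.Tendsto (fun m => coeff m (recSeries q p)) Filter.atTop (nhds c) := by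
  classical
  obtain ⟨ρ, hρ1, hρ2⟩ := exists_between (max_lt hq hp)
  have hρ0 : 0 < ρ := (norm_nonneg q).trans_lt ((le_max_left _ _).trans_lt hρ1)
  have hle : ∀ i : ℕ × ℕ, i ∉ ({(0, 0)} : Finset (ℕ × ℕ)) → ‖q ^ i.1 * p ^ i.2‖ * ρ⁻¹ ≤ 1 := by
    intro i hi
    rw [← div_eq_mul_inv, div_le_one hρ0, norm_mul, norm_pow, norm_pow]
    have hq' : ‖q‖ ≤ ρ := (le_max_left _ _).trans hρ1.le
    have hp' : ‖p‖ ≤ ρ := (le_max_right _ _).trans hρ1.le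
    have h1 : ‖q‖ ^ i.1 ≤ 1 := pow_le_one₀ (norm_nonneg _) hq.le
    have h2 : ‖p‖ ^ i.2 ≤ 1 := pow_le_one₀ (norm_nonneg _) hp.le
    have h3 : i.1 ≠ 0 ∨ i.2 ≠ 0 := by
      by_contra! h
      exact hi (by rw [Finset.mem_singleton]; exact Prod.ext h.1 h.2)
    rcases h3 with h3 | h3
    · have : ‖q‖ ^ i.1 ≤ ‖q‖ := pow_le_of_le_one (norm_nonneg _) hq.le h3
      nlinarith [norm_nonneg q, pow_nonneg (norm_nonneg q) i.1, pow_nonneg (norm_nonneg p) i.2]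
    · have : ‖p‖ ^ i.2 ≤ ‖p‖ := pow_le_of_le_one (norm_nonneg _) hp.le h3
      nlinarith [norm_nonneg p, pow_nonneg (norm_nonneg q) i.1, pow_nonneg (norm_nonneg p) i.2]
  obtain ⟨f, hf, hf0, h⟩ := linProd_mul_recSeries hq hp {(0, 0)} ((one_le_inv₀ hρ0).mpr hρ2.le) hle
  have h1R : (1 : ℝ) < ρ⁻¹ := (one_lt_inv₀ hρ0).mpr hρ2
  have hsum := hasSum_taylor hf (z := 1) (by simpa using h1R)
  refine ⟨f 1, hf0 1 (by simpa using h1R), ?_⟩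
  simp only [one_pow, mul_one] at hsum
  -- after multiplication by `1 - X` the partial sums of the series at `1` telescope
  have h2 := hsum.tendsto_sum_nat
  have h3 : ∀ m, ∑ i ∈ Finset.range (m + 1), coeff i (taylor f) = coeff m (recSeries q p) := by
    intro m
    rw [← h]
    have e : ((linProd ((({(0, 0)} : Finset (ℕ × ℕ)).toList).map fun i => q ^ i.1 * p ^ i.2) :
        Polynomial ℂ) : PowerSeries ℂ) * recSeries q p = (1 - C 1 * X) * recSeries q p := by
      simp [linProd]
    rw [e]
    induction m with
    | zero =>
      rw [Finset.sum_range_one, coeff_zero_one_sub_mul]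
    | succ m ih =>
      rw [Finset.sum_range_succ, ih, coeff_succ_one_sub_mul]
      ring
  simp only [← h3]
  exact h2.comp (Filter.tendsto_add_atTop_nat 1)

/-- The limit of the coefficients of `1 / Phi q p`. -/
def recLim (q p : ℂ) : ℂ := Filter.limUnder Filter.atTop fun m => coeff m (recSeries q p)

theorem tendsto_recLim (hq : ‖q‖ < 1) (hp : ‖p‖ < 1) :
    Filter.Tendsto (fun m => coeff m (recSeries q p)) Filter.atTop (nhds (recLim q p)) := by
  obtain ⟨c, _, h⟩ := exists_tendsto_coeff_recSeries hq hp
  rw [recLim, h.limUnder_eq]; exact h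

theorem recLim_ne_zero (hq : ‖q‖ < 1) (hp : ‖p‖ < 1) : recLim q p ≠ 0 := by
  obtain ⟨c, hc, h⟩ := exists_tendsto_coeff_recSeries hq hp
  rw [recLim, h.limUnder_eq]; exact hc

/-- Finitely many linear factors cancel all poles of `1 / Phi q p` in the disc of radius `ρ⁻¹`.
Together with the factor `1 - X` they serve uniformly for the shifted series, and also for the
limit of the shifted series, which has constant coefficients. -/
theorem exists_list (hq : ‖q‖ < 1) (hp : ‖p‖ < 1) {ρ : ℝ} (hρ : 0 < ρ) (hρ1 : ρ < 1) :
    ∃ L : List ℂ, 1 ∈ L ∧ (∀ s ∈ L, ∃ j k : ℕ, s = q ^ j * p ^ k) ∧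
      Decay ρ (fun n : ℕ => (linProd L : PowerSeries ℂ) * shift (recSeries q p) n) ∧
      Decay ρ (fun _ : Unit => (linProd L : PowerSeries ℂ) * recSeries q p) ∧
      Decay ρ (fun _ : Unit => (linProd L : PowerSeries ℂ) *
        PowerSeries.mk fun _ => recLim q p) := by
  classical
  set T := (finite_norm_pow_pow_gt hq hp hρ).toFinset with hT
  set L₀ := T.toList.map fun i => q ^ i.1 * p ^ i.2 with hL₀
  obtain ⟨f, hf, hf0, h⟩ := linProd_mul_recSeries hq hp T ((one_le_inv₀ hρ).mpr hρ1.le) (by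
    intro i hi
    simp only [hT, Set.Finite.mem_toFinset, Set.mem_ofPred_eq, not_not] at hi
    rw [← div_eq_mul_inv, div_le_one hρ]
    exact hi.le)
  have hdec0 : Decay ρ (fun _ : Unit => (linProd L₀ : PowerSeries ℂ) * recSeries q p) := by
    rw [h]
    have := decay_taylor (inv_pos.mpr hρ) hf
    rwa [inv_inv] at this
  have hdec : Decay ρ (fun _ : Unit => (linProd (1 :: L₀) : PowerSeries ℂ) * recSeries q p) := by
    have := hdec0.poly_mul hρ.le (1 - Polynomial.C 1 * Polynomial.X)
    simpa only [linProd_cons, Polynomial.coe_mul, mul_assoc] using this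
  obtain ⟨B, hB⟩ := (tendsto_recLim hq hp).norm.bddAbove_range
  refine ⟨1 :: L₀, List.mem_cons_self, fun s hs => ?_, hdec.shift hρ.le hρ1
    fun m => hB ⟨m, rfl⟩, hdec, ?_⟩
  · rcases List.mem_cons.mp hs with rfl | hs
    · exact ⟨0, 0, by simp⟩
    · obtain ⟨i, _, rfl⟩ := List.mem_map.mp hs
      exact ⟨i.1, i.2, rfl⟩
  · have e : (1 - C (1 : ℂ) * X) * (PowerSeries.mk fun _ => recLim q p) = C (recLim q p) := by
      ext m
      rcases m with _ | m
      · rw [coeff_zero_one_sub_mul]; simp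
      · rw [coeff_succ_one_sub_mul]; simp
    simp only [linProd_cons_mul, e]
    refine Decay.poly_mul hρ.le _ fun ρ' hρ' => ⟨‖recLim q p‖, norm_nonneg _, fun _ m => ?_⟩
    rw [coeff_C]
    split_ifs with hm
    · simp [hm]
    · have : 0 < ρ' := hρ.trans hρ'
      rw [norm_zero]; positivity

/-- The poles of the continued Hadamard products. -/
def poleSet (q p : ℂ) : Set ℂ := {z | ∃ j k : ℕ, q ^ j * p ^ k * z = 1}

/-- A denominator for the series `∑ c (m + n) * c m * z ^ m` in the disc of radius `N + 2`. It does
not depend on `n`, and serves for the limit of these series as well. -/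
theorem exists_denominator_recSeries (hq : ‖q‖ < 1) (hp : ‖p‖ < 1) (N : ℕ) :
    ∃ E : Polynomial ℂ, (∀ z, E.eval z = 0 → z ∈ poleSet q p) ∧
      Decay ((N : ℝ) + 2)⁻¹ (fun n : ℕ => (E : PowerSeries ℂ) *
        had (shift (recSeries q p) n) (recSeries q p)) ∧
      Decay ((N : ℝ) + 2)⁻¹ (fun _ : Unit => (E : PowerSeries ℂ) *
        had (PowerSeries.mk fun _ => recLim q p) (recSeries q p)) := by
  have hN : (0 : ℝ) < ((N : ℝ) + 2)⁻¹ := by positivity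
  have hN1 : ((N : ℝ) + 2)⁻¹ < 1 := inv_lt_one_of_one_lt₀ (by linarith [(Nat.cast_nonneg N : (0 : ℝ) ≤ N)])
  obtain ⟨L, hL1, hL, h1, h2, h3⟩ := exists_list hq hp hN hN1
  have hL' : ∀ s ∈ L, ‖s‖ ≤ 1 := fun s hs => by
    obtain ⟨j, k, rfl⟩ := hL s hs
    exact norm_pow_pow_le hq hp j k
  obtain ⟨E, hE, hdec⟩ := exists_denominator hN.le hN1.le L L hL' hL'
  refine ⟨E, fun z hz => ?_, hdec _ _ h1 fun ρ' hρ' => ?_, hdec _ _ h3 h2⟩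
  · obtain ⟨s, hs, s', hs', h⟩ := hE z hz
    obtain ⟨j, k, rfl⟩ := hL s hs
    obtain ⟨j', k', rfl⟩ := hL s' hs'
    exact ⟨j + j', k + k', by rw [← h]; ring⟩
  · obtain ⟨C, hC, h⟩ := h2 ρ' hρ'
    exact ⟨C, hC, fun _ m => h () m⟩

/-- A polynomial which cancels the poles in the disc of radius `N + 2`; the value is `1` by
convention unless `‖q‖ < 1` and `‖p‖ < 1`. -/
def den (q p : ℂ) (N : ℕ) : Polynomial ℂ :=
  open Classical in if h : ‖q‖ < 1 ∧ ‖p‖ < 1 then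
    (exists_denominator_recSeries h.1 h.2 N).choose else 1

theorem den_spec (hq : ‖q‖ < 1) (hp : ‖p‖ < 1) (N : ℕ) :
    (∀ z, (den q p N).eval z = 0 → z ∈ poleSet q p) ∧
      Decay ((N : ℝ) + 2)⁻¹ (fun n : ℕ => (den q p N : PowerSeries ℂ) *
        had (shift (recSeries q p) n) (recSeries q p)) ∧
      Decay ((N : ℝ) + 2)⁻¹ (fun _ : Unit => (den q p N : PowerSeries ℂ) *
        had (PowerSeries.mk fun _ => recLim q p) (recSeries q p)) := by
  rw [den, dif_pos ⟨hq, hp⟩]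
  exact (exists_denominator_recSeries hq hp N).choose_spec

/-- The product of `den q p N` and the function `∑ c (m + n) * c m * z ^ m`, on the disc of radius
`N + 2`. Here `c` are the coefficients of `1 / Phi q p`. -/
def num (q p : ℂ) (N n : ℕ) (z : ℂ) : ℂ :=
  psum ((den q p N : PowerSeries ℂ) * had (shift (recSeries q p) n) (recSeries q p)) z

/-- The meromorphic continuation of the function `∑ c (m + n) * c m * z ^ m`, where `c` are the
coefficients of `1 / Phi q p`. At each point it is computed on a disc containing the point, of
radius depending on the point. -/
def hcont (q p : ℂ) (n : ℕ) (z : ℂ) : ℂ :=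
  num q p ⌊‖z‖⌋₊ n z / (den q p ⌊‖z‖⌋₊).eval z

theorem hasSum_had (hq : ‖q‖ < 1) (hp : ‖p‖ < 1) (n : ℕ) {z : ℂ} (hz : ‖z‖ < 1) :
    Summable fun m => coeff m (had (shift (recSeries q p) n) (recSeries q p)) * z ^ m := by
  obtain ⟨B, hB⟩ := (tendsto_recLim hq hp).norm.bddAbove_range
  have hB' : ∀ m, ‖coeff m (recSeries q p)‖ ≤ B := fun m => hB ⟨m, rfl⟩
  refine .of_norm_bounded ((hasSum_recSeries hq hp hz).summable.norm.mul_left B) fun m => ?_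
  rw [coeff_had, coeff_shift, mul_assoc, norm_mul]
  exact mul_le_mul_of_nonneg_right (hB' _) (norm_nonneg _)

theorem num_eq (hq : ‖q‖ < 1) (hp : ‖p‖ < 1) (N n : ℕ) {z : ℂ} (hz : ‖z‖ < 1) :
    num q p N n z = (den q p N).eval z *
      psum (had (shift (recSeries q p) n) (recSeries q p)) z :=
  (hasSum_poly_mul (hasSum_had hq hp n hz).hasSum (den q p N)).tsum_eq

theorem radius_mul (N : ℕ) : ((N : ℝ) + 2)⁻¹ * (N + 2) = 1 := by
  have : (N : ℝ) + 2 ≠ 0 := by positivity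
  field_simp

theorem radius_mul_lt {N : ℕ} {r : ℝ} (h : r < N + 2) : ((N : ℝ) + 2)⁻¹ * r < 1 := by
  rw [← radius_mul N]
  exact mul_lt_mul_of_pos_left h (by positivity)

theorem radius_nonneg (N : ℕ) : (0 : ℝ) ≤ ((N : ℝ) + 2)⁻¹ := by positivity

theorem differentiableOn_num (hq : ‖q‖ < 1) (hp : ‖p‖ < 1) (N n : ℕ) :
    DifferentiableOn ℂ (num q p N n) (Metric.ball 0 (N + 2)) :=
  (den_spec hq hp N).2.1.differentiableOn (radius_nonneg N) (radius_mul N).le n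

theorem eqOn_ball_of_eq {f g : ℂ → ℂ} {R : ℝ} (hR : 1 ≤ R)
    (hf : DifferentiableOn ℂ f (Metric.ball 0 R)) (hg : DifferentiableOn ℂ g (Metric.ball 0 R))
    (h : ∀ z, ‖z‖ < 1 → f z = g z) {z : ℂ} (hz : ‖z‖ < R) : f z = g z := by
  refine (hf.analyticOnNhd Metric.isOpen_ball).eqOn_of_preconnected_of_eventuallyEq
    (hg.analyticOnNhd Metric.isOpen_ball) (convex_ball (0 : ℂ) R).isPreconnected
    (Metric.mem_ball_self (one_pos.trans_le hR)) ?_ (mem_ball_zero_iff.mpr hz)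
  filter_upwards [Metric.ball_mem_nhds (0 : ℂ) one_pos] with w hw
  exact h w (mem_ball_zero_iff.mp hw)

/-- The fractions formed on two discs agree on the smaller one. -/
theorem num_mul_den (hq : ‖q‖ < 1) (hp : ‖p‖ < 1) {N N' : ℕ} (h : N ≤ N') (n : ℕ) {z : ℂ}
    (hz : ‖z‖ < N + 2) :
    num q p N n z * (den q p N').eval z = num q p N' n z * (den q p N).eval z := by
  have hN : (0 : ℝ) ≤ N := Nat.cast_nonneg N
  have hNN : (N : ℝ) ≤ N' := Nat.cast_le.mpr h
  have hd : ∀ N, DifferentiableOn ℂ (fun z => (den q p N).eval z) (Metric.ball 0 (N + 2)) :=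
    fun N => (den q p N).differentiable.differentiableOn
  refine eqOn_ball_of_eq (f := fun z => num q p N n z * (den q p N').eval z)
    (g := fun z => num q p N' n z * (den q p N).eval z) (R := (N : ℝ) + 2) (by linarith)
    ((differentiableOn_num hq hp N n).mul (den q p N').differentiable.differentiableOn)
    (((differentiableOn_num hq hp N' n).mono (Metric.ball_subset_ball (by linarith))).mul (hd N))
    (fun w hw => ?_) hz
  rw [num_eq hq hp N n hw, num_eq hq hp N' n hw]
  ring

/-- The value of `hcont` can be computed on any disc containing `z`. -/
theorem hcont_eq (hq : ‖q‖ < 1) (hp : ‖p‖ < 1) (N n : ℕ) {z : ℂ} (hz : ‖z‖ < N + 2)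
    (hzP : z ∉ poleSet q p) : hcont q p n z = num q p N n z / (den q p N).eval z := by
  have hd : ∀ N, (den q p N).eval z ≠ 0 := fun N h => hzP ((den_spec hq hp N).1 z h)
  have hfl := Nat.lt_floor_add_one ‖z‖
  rw [hcont, div_eq_div_iff (hd _) (hd _)]
  rcases le_total ⌊‖z‖⌋₊ N with h | h
  · exact num_mul_den hq hp h n (by linarith)
  · exact (num_mul_den hq hp h n hz).symm

theorem not_mem_poleSet (hq : ‖q‖ < 1) (hp : ‖p‖ < 1) {z : ℂ} (hz : ‖z‖ < 1) :
    z ∉ poleSet q p := by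
  rintro ⟨j, k, h⟩
  have h1 := congrArg norm h
  rw [norm_mul, norm_one] at h1
  nlinarith [norm_pow_pow_le hq hp j k, norm_nonneg z, norm_nonneg (q ^ j * p ^ k)]

theorem hasSum_hcont (hq : ‖q‖ < 1) (hp : ‖p‖ < 1) (n : ℕ) {z : ℂ} (hz : ‖z‖ < 1) :
    HasSum (fun m => coeff (m + n) (recSeries q p) * coeff m (recSeries q p) * z ^ m)
      (hcont q p n z) := by
  have hzP := not_mem_poleSet hq hp hz
  have hd : (den q p 0).eval z ≠ 0 := fun h => hzP ((den_spec hq hp 0).1 z h)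
  rw [hcont_eq hq hp 0 n (by simp; linarith) hzP, num_eq hq hp 0 n hz, mul_div_cancel_left₀ _ hd]
  have := (hasSum_had hq hp n hz).hasSum
  simp only [coeff_had, coeff_shift] at this
  convert this using 1
  simp only [psum, coeff_had, coeff_shift]

theorem differentiableAt_hcont (hq : ‖q‖ < 1) (hp : ‖p‖ < 1) (n : ℕ) {z : ℂ}
    (hz : z ∈ interior (poleSet q p)ᶜ) : DifferentiableAt ℂ (hcont q p n) z := by
  have hfl := Nat.lt_floor_add_one ‖z‖
  set N := ⌊‖z‖⌋₊ with hN
  have hzb : z ∈ Metric.ball (0 : ℂ) (N + 2) := mem_ball_zero_iff.mpr (by linarith)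
  have hd : DifferentiableAt ℂ (fun w => num q p N n w / (den q p N).eval w) z :=
    ((differentiableOn_num hq hp N n).differentiableAt (Metric.isOpen_ball.mem_nhds hzb)).div
      (den q p N).differentiableAt
      fun h => interior_subset hz ((den_spec hq hp N).1 z h)
  refine hd.congr_of_eventuallyEq ?_
  filter_upwards [mem_interior_iff_mem_nhds.mp hz, Metric.isOpen_ball.mem_nhds hzb] with w hw hwb
  exact hcont_eq hq hp N n (mem_ball_zero_iff.mp hwb) hw

/-- The bound is uniform in `n` and locally uniform in `z`. -/
theorem exists_bound_hcont (hq : ‖q‖ < 1) (hp : ‖p‖ < 1) {z : ℂ}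
    (hz : z ∈ interior (poleSet q p)ᶜ) :
    ∃ M : ℝ, 0 ≤ M ∧ ∀ᶠ w in nhds z, ∀ n, ‖hcont q p n w‖ ≤ M := by
  have hfl := Nat.lt_floor_add_one ‖z‖
  set N := ⌊‖z‖⌋₊ with hN
  have hN0 : (0 : ℝ) ≤ N := Nat.cast_nonneg N
  have hd : (den q p N).eval z ≠ 0 := fun h => interior_subset hz ((den_spec hq hp N).1 z h)
  have hzb : z ∈ Metric.ball (0 : ℂ) (N + 1) := mem_ball_zero_iff.mpr hfl
  obtain ⟨M, hM0, hM⟩ := (den_spec hq hp N).2.1.exists_norm_psum_le (radius_nonneg N)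
    (r := N + 1) (by linarith) (radius_mul_lt (by linarith))
  refine ⟨M / (‖(den q p N).eval z‖ / 2), by positivity, ?_⟩
  have hcont : Filter.Tendsto (fun w => ‖(den q p N).eval w‖) (nhds z)
      (nhds ‖(den q p N).eval z‖) := (den q p N).continuous.norm.tendsto z
  have hlt : ‖(den q p N).eval z‖ / 2 < ‖(den q p N).eval z‖ :=
    half_lt_self (norm_pos_iff.mpr hd)
  filter_upwards [mem_interior_iff_mem_nhds.mp hz, Metric.isOpen_ball.mem_nhds hzb,
    hcont.eventually (lt_mem_nhds hlt)] with w hw hwb hwd n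
  have hwb' := mem_ball_zero_iff.mp hwb
  rw [hcont_eq hq hp N n (by linarith) hw, norm_div]
  have h2 : 0 < ‖(den q p N).eval z‖ / 2 := half_pos (norm_pos_iff.mpr hd)
  exact div_le_div₀ hM0 (hM n w hwb'.le) h2 hwd.le

/-- The limit is a non-zero multiple of `1 / Phi q p z`. -/
theorem tendsto_hcont (hq : ‖q‖ < 1) (hp : ‖p‖ < 1) {z : ℂ} (hz : z ∉ poleSet q p) :
    ∃ h : ℂ, h ≠ 0 ∧ Filter.Tendsto (fun n => hcont q p n z) Filter.atTop (nhds h) := by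
  have hfl := Nat.lt_floor_add_one ‖z‖
  set N := ⌊‖z‖⌋₊ with hN
  have hN0 : (0 : ℝ) ≤ N := Nat.cast_nonneg N
  obtain ⟨hden, hdec1, hdec2⟩ := den_spec hq hp N
  have hd : (den q p N).eval z ≠ 0 := fun h => hz (hden z h)
  set G : PowerSeries ℂ := (den q p N : PowerSeries ℂ) *
    had (PowerSeries.mk fun _ => recLim q p) (recSeries q p) with hG
  have hz2 : ‖z‖ < N + 2 := by linarith
  -- the sum of the limit series is proportional to the reciprocal of the double product
  have hlim : psum G z * Phi q p z = recLim q p * (den q p N).eval z := by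
    refine eqOn_ball_of_eq (f := fun z => psum G z * Phi q p z)
      (g := fun z => recLim q p * (den q p N).eval z) (R := (N : ℝ) + 2) (by linarith)
      ((hdec2.differentiableOn (radius_nonneg N) (radius_mul N).le ()).mul
        (differentiable_Phi hq hp).differentiableOn)
      ((den q p N).differentiable.const_mul _).differentiableOn (fun w hw => ?_) hz2
    have h1 := (hasSum_recSeries hq hp hw).mul_left (recLim q p)
    have h2 : HasSum (fun m => coeff m (had (PowerSeries.mk fun _ => recLim q p)
        (recSeries q p)) * w ^ m) (recLim q p * (Phi q p w)⁻¹) := by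
      refine h1.congr_fun fun m => ?_
      rw [coeff_had, coeff_mk]; ring
    have h3 := (hasSum_poly_mul h2 (den q p N)).tsum_eq
    simp only [psum, hG]
    rw [h3]
    have := Phi_ne_zero hq hp hw
    field_simp
  refine ⟨psum G z / (den q p N).eval z, ?_, ?_⟩
  · refine div_ne_zero (fun h => ?_) hd
    rw [h, zero_mul] at hlim
    exact mul_ne_zero (recLim_ne_zero hq hp) hd hlim.symm
  · simp only [hcont_eq hq hp N _ hz2 hz]
    refine Filter.Tendsto.div_const ?_ _
    obtain ⟨C, κ, hC, hκ, hκ1, hb⟩ := hdec1.exists_bound (radius_nonneg N) (norm_nonneg z)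
      (radius_mul_lt hz2)
    refine tendsto_tsum_of_dominated_convergence
      ((summable_geometric_of_lt_one hκ hκ1).mul_left C) (fun m => ?_)
      (.of_forall fun n m => hb n m z le_rfl)
    refine Filter.Tendsto.mul_const _ ?_
    simp only [hG, coeff_poly_mul]
    refine tendsto_finsetSum _ fun i _ => Filter.Tendsto.const_mul _ ?_
    split_ifs
    · simp only [coeff_had, coeff_shift, coeff_mk]
      refine Filter.Tendsto.mul_const _ ?_
      have := (Filter.tendsto_add_atTop_iff_nat (m - i)).mpr (tendsto_recLim hq hp)
      simpa only [add_comm] using this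
    · exact tendsto_const_nhds

end Reciprocal

/-! ### The integral over `γ` in terms of Fourier coefficients -/

theorem isClosed_poleSet {q p : ℂ} (hq : ‖q‖ < 1) (hp : ‖p‖ < 1) : IsClosed (poleSet q p) := by
  have : poleSet q p = Phi q p ⁻¹' {0} := by
    ext z
    rw [Set.mem_preimage, Set.mem_singleton_iff, Phi, qprod_eq_zero_iff (summable_pow_pow_norm hq hp)]
    simp [poleSet]
  rw [this]
  exact isClosed_singleton.preimage (differentiable_Phi hq hp).continuous

theorem ee_mem_poleSet_iff (τ σ η : ℂ) : ee (4 * η) ∈ poleSet (ee τ) (ee σ) ↔ η ∈ pinchSet τ σ := by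
  have key : ∀ j k : ℕ, ee τ ^ j * ee σ ^ k * ee (4 * η) = 1 ↔
      ∃ l : ℤ, 4 * η + l + j * τ + k * σ = 0 := by
    intro j k
    rw [← ee_nat_mul, ← ee_nat_mul, ← ee_add, ← ee_add, ee_eq_one_iff]
    constructor
    · rintro ⟨n, hn⟩
      exact ⟨-n, by push_cast; linear_combination hn⟩
    · rintro ⟨l, hl⟩
      exact ⟨-l, by push_cast; linear_combination hl⟩
  simp only [poleSet, pinchSet, Set.mem_ofPred_eq, key]
  constructor
  · rintro ⟨j, k, l, h⟩; exact ⟨l, j, k, h⟩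
  · rintro ⟨l, j, k, h⟩; exact ⟨j, k, l, h⟩

section Continuation

variable {τ σ η : ℂ}

theorem mem_interior_poleSet_compl (hτ : 0 < τ.im) (hσ : 0 < σ.im) (hη : η ∉ pinchSet τ σ) :
    ee (4 * η) ∈ interior (poleSet (ee τ) (ee σ))ᶜ := by
  rw [(isClosed_poleSet (norm_ee_lt_one hτ) (norm_ee_lt_one hσ)).isOpen_compl.interior_eq]
  exact fun h => hη ((ee_mem_poleSet_iff τ σ η).mp h)

theorem isOpen_pinchSet_compl (hτ : 0 < τ.im) (hσ : 0 < σ.im) : IsOpen (pinchSet τ σ)ᶜ := by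
  have : (pinchSet τ σ)ᶜ = (fun η => ee (4 * η)) ⁻¹' (poleSet (ee τ) (ee σ))ᶜ := by
    ext η
    rw [Set.mem_preimage, Set.mem_compl_iff, Set.mem_compl_iff, ee_mem_poleSet_iff]
  rw [this]
  exact (isClosed_poleSet (norm_ee_lt_one hτ) (norm_ee_lt_one hσ)).isOpen_compl.preimage
    (continuous_ee.comp (by fun_prop))

/-- The (analytically continued) Laurent coefficients, in the variable `exp(2 π i t)`, of the
reciprocal of `Phi (ee (t + 2 η)) * Phi (ee (2 η - t))`. -/
def dco (τ σ η : ℂ) (n : ℤ) : ℂ :=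
  ee (2 * η) ^ n.natAbs * hcont (ee τ) (ee σ) n.natAbs (ee (4 * η))

theorem dco_neg (τ σ η : ℂ) (n : ℤ) : dco τ σ η (-n) = dco τ σ η n := by
  simp [dco]

theorem differentiableOn_dco (hτ : 0 < τ.im) (hσ : 0 < σ.im) (n : ℤ) :
    DifferentiableOn ℂ (fun η => dco τ σ η n) (pinchSet τ σ)ᶜ := by
  intro η hη
  have h1 := differentiableAt_hcont (norm_ee_lt_one hτ) (norm_ee_lt_one hσ) n.natAbs
    (mem_interior_poleSet_compl hτ hσ hη)
  have h2 : DifferentiableAt ℂ (fun η => ee (4 * η)) η :=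
    (differentiable_ee _).comp η (by fun_prop)
  have h3 : DifferentiableAt ℂ (fun η => ee (2 * η)) η :=
    (differentiable_ee _).comp η (by fun_prop)
  exact ((h3.pow _).mul (h1.comp η h2)).differentiableWithinAt

/-- The coefficients grow at most exponentially, locally uniformly in `η`. -/
theorem exists_expBdd_dco (hτ : 0 < τ.im) (hσ : 0 < σ.im) (hη : η ∉ pinchSet τ σ) :
    ∃ C R, ∀ᶠ w in nhds η, ExpBdd (dco τ σ w) C R := by
  obtain ⟨M, hM0, hM⟩ := exists_bound_hcont (norm_ee_lt_one hτ) (norm_ee_lt_one hσ)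
    (mem_interior_poleSet_compl hτ hσ hη)
  have h4 : Filter.Tendsto (fun η => ee (4 * η)) (nhds η) (nhds (ee (4 * η))) :=
    (continuous_ee.comp (by fun_prop)).tendsto η
  have h2 : Filter.Tendsto (fun η => ‖ee (2 * η)‖) (nhds η) (nhds ‖ee (2 * η)‖) :=
    (continuous_ee.comp (by fun_prop)).norm.tendsto η
  refine ⟨M, ‖ee (2 * η)‖ + 1, ?_⟩
  filter_upwards [h4.eventually hM, h2.eventually (gt_mem_nhds (lt_add_one _))] with w hw1 hw2
  refine ⟨hM0, by positivity, fun n => ?_⟩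
  rw [dco, norm_mul, norm_pow, mul_comm]
  exact mul_le_mul (hw1 _) (pow_le_pow_left₀ (norm_nonneg _) hw2.le _) (by positivity) hM0

theorem expBdd_dco (hτ : 0 < τ.im) (hσ : 0 < σ.im) (hη : η ∉ pinchSet τ σ) :
    ∃ C R, ExpBdd (dco τ σ η) C R := by
  obtain ⟨C, R, h⟩ := exists_expBdd_dco hτ hσ hη
  exact ⟨C, R, h.self_of_nhds⟩

/-- The entire numerator of the kernel of the integral. -/
def Nfac (τ σ η t : ℂ) : ℂ :=
  Phi (ee τ) (ee σ) (ee (τ + σ + t - 2 * η)) * Phi (ee τ) (ee σ) (ee (τ + σ - t - 2 * η))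

theorem differentiable_Phi_ee (hτ : 0 < τ.im) (hσ : 0 < σ.im) :
    Differentiable ℂ fun z => Phi (ee τ) (ee σ) (ee z) :=
  (differentiable_Phi (norm_ee_lt_one hτ) (norm_ee_lt_one hσ)).comp differentiable_ee

theorem perEnt_Nfac (hτ : 0 < τ.im) (hσ : 0 < σ.im) (η : ℂ) : PerEnt (Nfac τ σ η) := by
  have h := differentiable_Phi_ee hτ hσ
  refine ⟨?_, fun t => ?_⟩
  · have h1 : Differentiable ℂ fun t => Phi (ee τ) (ee σ) (ee (τ + σ + t - 2 * η)) :=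
      h.comp (f := fun t => τ + σ + t - 2 * η) (by fun_prop)
    have h2 : Differentiable ℂ fun t => Phi (ee τ) (ee σ) (ee (τ + σ - t - 2 * η)) :=
      h.comp (f := fun t => τ + σ - t - 2 * η) (by fun_prop)
    exact h1.mul h2
  · rw [Nfac, Nfac, show τ + σ + (t + 1) - 2 * η = τ + σ + t - 2 * η + 1 by ring,
      show τ + σ - t - 2 * η = τ + σ - (t + 1) - 2 * η + 1 by ring]
    simp only [ee_add _ 1, ee_one, mul_one]

theorem continuous_Nfac (hτ : 0 < τ.im) (hσ : 0 < σ.im) :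
    Continuous (Function.uncurry (Nfac τ σ)) := by
  have h := (differentiable_Phi_ee hτ hσ).continuous
  have h1 : Continuous fun x : ℂ × ℂ => Phi (ee τ) (ee σ) (ee (τ + σ + x.2 - 2 * x.1)) :=
    h.comp (f := fun x : ℂ × ℂ => τ + σ + x.2 - 2 * x.1) (by fun_prop)
  have h2 : Continuous fun x : ℂ × ℂ => Phi (ee τ) (ee σ) (ee (τ + σ - x.2 - 2 * x.1)) :=
    h.comp (f := fun x : ℂ × ℂ => τ + σ - x.2 - 2 * x.1) (by fun_prop)
  exact h1.mul h2

theorem differentiable_Nfac (hτ : 0 < τ.im) (hσ : 0 < σ.im) (t : ℂ) :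
    Differentiable ℂ fun η => Nfac τ σ η t := by
  have h := differentiable_Phi_ee hτ hσ
  have h1 : Differentiable ℂ fun η => Phi (ee τ) (ee σ) (ee (τ + σ + t - 2 * η)) :=
    h.comp (f := fun η => τ + σ + t - 2 * η) (by fun_prop)
  have h2 : Differentiable ℂ fun η => Phi (ee τ) (ee σ) (ee (τ + σ - t - 2 * η)) :=
    h.comp (f := fun η => τ + σ - t - 2 * η) (by fun_prop)
  exact h1.mul h2

theorem Nfac_neg (τ σ η t : ℂ) : Nfac τ σ η (-t) = Nfac τ σ η t := by
  rw [Nfac, Nfac, mul_comm]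
  congr 3 <;> ring

/-- The integral over `γ`, up to a constant factor, as a functional of the entire function `f`. -/
def Lam (τ σ η : ℂ) (f : ℂ → ℂ) : ℂ := pair (dco τ σ η) fun t => Nfac τ σ η t * f t

theorem differentiableOn_Lam (hτ : 0 < τ.im) (hσ : 0 < σ.im) {f : ℂ → ℂ → ℂ}
    (hf : Continuous (Function.uncurry f)) (hfd : ∀ t, Differentiable ℂ fun w => f w t)
    (hp : ∀ w, PerEnt (f w)) : DifferentiableOn ℂ (fun η => Lam τ σ η (f η)) (pinchSet τ σ)ᶜ :=
  differentiableOn_pair (isOpen_pinchSet_compl hτ hσ) (differentiableOn_dco hτ hσ)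
    (fun _ hη => exists_expBdd_dco hτ hσ hη) ((continuous_Nfac hτ hσ).mul hf)
    (fun t => (differentiable_Nfac hτ hσ t).mul (hfd t)) fun w => (perEnt_Nfac hτ hσ w).mul (hp w)

theorem Lam_neg (hτ : 0 < τ.im) (hσ : 0 < σ.im) (η : ℂ) {f : ℂ → ℂ} (hf : PerEnt f) :
    Lam τ σ η (fun t => f (-t)) = Lam τ σ η f := by
  have h := pair_neg (dco_neg τ σ η) ((perEnt_Nfac hτ hσ η).mul hf)
  simp only [Nfac_neg] at h
  exact h

/-! ### Agreement with the integral over the interval -/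

/-- Pairs of natural numbers, by their difference and their minimum. -/
def intNatEquiv : ℤ × ℕ ≃ ℕ × ℕ where
  toFun x := (x.2 + x.1.toNat, x.2 + (-x.1).toNat)
  invFun y := ((y.1 : ℤ) - y.2, min y.1 y.2)
  left_inv x := by ext <;> simp <;> omega
  right_inv y := by ext <;> simp <;> omega

theorem intNatEquiv_ofNat (m k : ℕ) : intNatEquiv ((m : ℤ), k) = (k + m, k) := by
  simp [intNatEquiv]

theorem intNatEquiv_neg (m k : ℕ) : intNatEquiv (-(m : ℤ), k) = (k, k + m) := by
  simp [intNatEquiv]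

/-- The powers of `ee (t + 2 η)` and of `ee (2 η - t)`, sorted by the resulting frequency `n`. -/
theorem mul_pow_intNatEquiv (c : ℕ → ℂ) (η t : ℂ) (n : ℤ) (k : ℕ) :
    c (intNatEquiv (n, k)).1 * ee (t + 2 * η) ^ (intNatEquiv (n, k)).1 *
      (c (intNatEquiv (n, k)).2 * ee (2 * η - t) ^ (intNatEquiv (n, k)).2) =
    ee (2 * η) ^ n.natAbs * ee (n * t) * (c (k + n.natAbs) * c k * ee (4 * η) ^ k) := by
  rcases le_total 0 n with hn | hn
  · obtain ⟨m, rfl⟩ := Int.eq_ofNat_of_zero_le hn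
    have : ee ((k + m : ℕ) * (t + 2 * η)) * ee (k * (2 * η - t)) =
        ee (m * (2 * η)) * ee (m * t) * ee (k * (4 * η)) := by
      simp only [← ee_add]; congr 1; push_cast; ring
    rw [intNatEquiv_ofNat, Int.natAbs_natCast, Int.cast_natCast, ← ee_nat_mul, ← ee_nat_mul,
      ← ee_nat_mul, ← ee_nat_mul]
    linear_combination (c (k + m) * c k) * this
  · obtain ⟨m, hm⟩ := Int.eq_ofNat_of_zero_le (neg_nonneg.mpr hn)
    obtain rfl : n = -(m : ℤ) := by omega
    have : ee (k * (t + 2 * η)) * ee ((k + m : ℕ) * (2 * η - t)) =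
        ee (m * (2 * η)) * ee ((-(m : ℤ) : ℤ) * t) * ee (k * (4 * η)) := by
      simp only [← ee_add]; congr 1; push_cast; ring
    rw [intNatEquiv_neg, Int.natAbs_neg, Int.natAbs_natCast, ← ee_nat_mul, ← ee_nat_mul,
      ← ee_nat_mul, ← ee_nat_mul]
    linear_combination (c (k + m) * c k) * this

theorem hasSum_mul_prod {f g : ℕ → ℂ} {a b : ℂ} (hf : HasSum f a) (hg : HasSum g b) :
    HasSum (fun x : ℕ × ℕ => f x.1 * g x.2) (a * b) := by
  have h1 : Summable fun n => ‖f n‖ := hf.summable.norm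
  have h2 : Summable fun n => ‖g n‖ := hg.summable.norm
  exact hf.mul hg (summable_mul_of_summable_norm h1 h2)

/-- For `Im η > 0` both factors are given by power series; their product is rearranged as a Laurent
series in `exp(2 π i t)`. -/
theorem hasSum_dco (hτ : 0 < τ.im) (hσ : 0 < σ.im) (hη : 0 < η.im) (t : ℝ) :
    HasSum (fun n : ℤ => dco τ σ η n * ee (n * t))
      ((Phi (ee τ) (ee σ) (ee (t + 2 * η)))⁻¹ * (Phi (ee τ) (ee σ) (ee (2 * η - t)))⁻¹) := by
  have hq := norm_ee_lt_one hτ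
  have hp := norm_ee_lt_one hσ
  have h4η : 0 < ((4 : ℂ) * η).im := by simp [hη]
  have hy1 : ‖ee (t + 2 * η)‖ < 1 := norm_ee_lt_one (by simpa using hη)
  have hy2 : ‖ee (2 * η - t)‖ < 1 := norm_ee_lt_one (by simpa using hη)
  have h1 := hasSum_recSeries hq hp hy1
  have h2 := hasSum_recSeries hq hp hy2
  have h3 := hasSum_mul_prod h1 h2
  have h4 := intNatEquiv.hasSum_iff.mpr h3
  have h5 : ∀ n : ℤ, HasSum (fun k : ℕ => ee (2 * η) ^ n.natAbs * ee (n * t) *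
      (PowerSeries.coeff (k + n.natAbs) (recSeries (ee τ) (ee σ)) *
        PowerSeries.coeff k (recSeries (ee τ) (ee σ)) * ee (4 * η) ^ k))
      (dco τ σ η n * ee (n * t)) := by
    intro n
    have := (hasSum_hcont hq hp n.natAbs (norm_ee_lt_one h4η)).mul_left
      (ee (2 * η) ^ n.natAbs * ee (n * t))
    rw [dco, mul_right_comm]
    exact this
  refine HasSum.prod_fiberwise (f := fun x : ℤ × ℕ => ee (2 * η) ^ x.1.natAbs * ee (x.1 * t) *
      (PowerSeries.coeff (x.2 + x.1.natAbs) (recSeries (ee τ) (ee σ)) *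
        PowerSeries.coeff x.2 (recSeries (ee τ) (ee σ)) * ee (4 * η) ^ x.2)) ?_ h5
  refine h4.congr_fun fun x => ?_
  exact (mul_pow_intNatEquiv (fun k => PowerSeries.coeff k (recSeries (ee τ) (ee σ))) η t
    x.1 x.2).symm

/-- For `Im η > 0` the functional `Lam` is the integral over `[0, 1]` against the kernel
`Nfac / (Phi * Phi)`. -/
theorem Lam_eq_integral (hτ : 0 < τ.im) (hσ : 0 < σ.im) (hη : 0 < η.im) {f : ℂ → ℂ}
    (hf : PerEnt f) : Lam τ σ η f = ∫ t in (0 : ℝ)..1, Nfac τ σ η t * f t *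
      ((Phi (ee τ) (ee σ) (ee (t + 2 * η)))⁻¹ * (Phi (ee τ) (ee σ) (ee (2 * η - t)))⁻¹) := by
  set G : ℂ → ℂ := fun t => Nfac τ σ η t * f t with hG
  have hGp : PerEnt G := (perEnt_Nfac hτ hσ η).mul hf
  obtain ⟨M, hM0, hM⟩ := hGp.exists_bound 0
  have hs : Summable fun n : ℤ => ‖dco τ σ η n‖ := by
    have := (hasSum_dco hτ hσ hη 0).summable.norm
    simpa [ee_zero] using this
  set H : ℂ → ℂ := fun t => G t *
    ((Phi (ee τ) (ee σ) (ee (t + 2 * η)))⁻¹ * (Phi (ee τ) (ee σ) (ee (2 * η - t)))⁻¹) with hH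
  have h := hasSum_fc_of_summable (F := fun (n : ℤ) t => dco τ σ η n * (ee ((-n : ℤ) * t) * G t))
    (G := H) (u := fun n => ‖dco τ σ η n‖ * M) (hs.mul_right M)
    (fun n => continuous_const.mul ((continuous_ee.comp (by fun_prop)).mul hGp.diff.continuous))
    (fun n t => by
      rw [norm_mul, norm_mul, norm_ee]
      refine mul_le_mul_of_nonneg_left ?_ (norm_nonneg _)
      simpa using hM t (by simp))
    (fun t => by
      have h1 := (hasSum_dco hτ hσ hη t).mul_left (G t)
      rw [← (Equiv.neg ℤ).hasSum_iff] at h1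
      refine h1.congr_fun fun n => ?_
      simp only [Function.comp_apply, Equiv.neg_apply, dco_neg]
      push_cast
      ring) 0
  have h2 : Lam τ σ η f = fc H 0 := by
    rw [Lam, pair, ← h.tsum_eq]
    congr 1
    ext n
    rw [fc_const_mul, fc_ee_mul, zero_sub, neg_neg]
  rw [h2, fc]
  congr 1
  ext t
  simp [hH, hG, ee_zero]

end Continuation

section Integral

variable {τ σ η : ℂ}

theorem hasProd_Phi_ee (hτ : 0 < τ.im) (hσ : 0 < σ.im) (z : ℂ) :
    HasProd (fun p : ℕ × ℕ => 1 - exp (2 * Real.pi * I * (z + p.1 * τ + p.2 * σ)))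
      (Phi (ee τ) (ee σ) (ee z)) := by
  refine (multipliable_qprod (summable_pow_pow_norm (norm_ee_lt_one hτ) (norm_ee_lt_one hσ))
    (ee z)).hasProd.congr_fun fun p => ?_
  rw [← ee_nat_mul, ← ee_nat_mul, ← ee_add, ← ee_add, ee]
  congr 3
  ring

theorem Omega_eq (hτ : 0 < τ.im) (hσ : 0 < σ.im) {a t : ℂ}
    (h1 : Phi (ee τ) (ee σ) (ee (t + a)) ≠ 0) (h2 : Phi (ee τ) (ee σ) (ee (τ + σ - t + a)) ≠ 0) :
    Omega a t τ σ = (Phi (ee τ) (ee σ) (ee (t - a)) * Phi (ee τ) (ee σ) (ee (τ + σ - t - a))) /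
      (Phi (ee τ) (ee σ) (ee (t + a)) * Phi (ee τ) (ee σ) (ee (τ + σ - t + a))) := by
  have e := ((hasProd_Phi_ee hτ hσ (t - a)).mul (hasProd_Phi_ee hτ hσ (τ + σ - t - a))).div₀
    ((hasProd_Phi_ee hτ hσ (t + a)).mul (hasProd_Phi_ee hτ hσ (τ + σ - t + a)))
    (mul_ne_zero h1 h2)
  rw [Omega, ← e.tprod_eq]
  congr 1
  ext p
  congr 4 <;> ring_nf

/-- The integrand of `intervalInt` is, up to a constant factor, the kernel `Nfac / (Phi * Phi)`
away from the zeros of the theta functions. -/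
theorem exists_Omega_div_theta (hτ : 0 < τ.im) (hσ : 0 < σ.im) : ∃ c, c ≠ 0 ∧ ∀ η t : ℂ,
    Phi (ee τ) (ee σ) (ee (t + 2 * η)) ≠ 0 → Phi (ee τ) (ee σ) (ee (2 * η - t)) ≠ 0 →
    theta (t - 2 * η) τ ≠ 0 → theta (t - 2 * η) σ ≠ 0 → ∀ w,
    Omega (2 * η) t τ σ * (w / (theta (t - 2 * η) τ * theta (t - 2 * η) σ)) =
      c * (Nfac τ σ η t * w *
      ((Phi (ee τ) (ee σ) (ee (t + 2 * η)))⁻¹ * (Phi (ee τ) (ee σ) (ee (2 * η - t)))⁻¹)) := by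
  have hq := norm_ee_lt_one hτ
  have hp := norm_ee_lt_one hσ
  obtain ⟨c1, hc1, h1⟩ := exists_theta_eq_thetaProd hτ
  obtain ⟨c2, hc2, h2⟩ := exists_theta_eq_thetaProd hσ
  refine ⟨-(c1 * c2)⁻¹, by simp [hc1, hc2], fun η t hP1 hP2 hθ1 hθ2 w => ?_⟩
  have e1 : Phi (ee τ) (ee σ) (ee (t - 2 * η)) * (1 - ee (t - 2 * η)) =
      qpoch (ee τ) (ee (t - 2 * η)) * qpoch (ee σ) (ee (t - 2 * η)) *
        Phi (ee τ) (ee σ) (ee (τ + σ + t - 2 * η)) := by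
    rw [Phi_eq_mul hq hp, Phi_eq_mul' hq hp (ee σ * _), qpoch_eq_mul hp (ee (t - 2 * η)),
      show ee (τ + σ + t - 2 * η) = ee τ * (ee σ * ee (t - 2 * η)) by
        rw [← ee_add, ← ee_add]; congr 1; ring]
    ring
  have e2 : Phi (ee τ) (ee σ) (ee (2 * η - t)) = (1 - ee (2 * η - t)) *
      (qpoch (ee τ) (ee τ / ee (t - 2 * η)) * qpoch (ee σ) (ee σ / ee (t - 2 * η))) *
        Phi (ee τ) (ee σ) (ee (τ + σ - t + 2 * η)) := by
    rw [Phi_eq_mul hq hp, Phi_eq_mul' hq hp (ee σ * _), qpoch_eq_mul hq (ee (2 * η - t)),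
      show ee (τ + σ - t + 2 * η) = ee τ * (ee σ * ee (2 * η - t)) by
        rw [← ee_add, ← ee_add]; congr 1; ring,
      show ee τ / ee (t - 2 * η) = ee τ * ee (2 * η - t) by
        rw [← ee_sub, ← ee_add]; congr 1; ring,
      show ee σ / ee (t - 2 * η) = ee σ * ee (2 * η - t) by
        rw [← ee_sub, ← ee_add]; congr 1; ring]
    ring
  have hy : ee (2 * η - t) = (ee (t - 2 * η))⁻¹ := by rw [← ee_neg]; congr 1; ring
  have hP2' := hP2
  rw [e2] at hP2'
  have hA := right_ne_zero_of_mul hP2'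
  have hB := left_ne_zero_of_mul (left_ne_zero_of_mul hP2')
  have hC := right_ne_zero_of_mul (left_ne_zero_of_mul hP2')
  have hC1 := left_ne_zero_of_mul hC
  have hC2 := right_ne_zero_of_mul hC
  rw [Omega_eq hτ hσ hP1 hA, h1, h2, thetaProd, thetaProd, Nfac, e2]
  rw [h1, thetaProd] at hθ1
  rw [h2, thetaProd] at hθ2
  have hD1 := left_ne_zero_of_mul (right_ne_zero_of_mul (right_ne_zero_of_mul hθ1))
  have hD2 := left_ne_zero_of_mul (right_ne_zero_of_mul (right_ne_zero_of_mul hθ2))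
  have hE : exp (-(Real.pi * I * (t - 2 * η))) * exp (-(Real.pi * I * (t - 2 * η))) =
      ee (2 * η - t) := by
    rw [← exp_add, ee]; congr 1; ring
  have hx := exp_ne_zero (-(Real.pi * I * (t - 2 * η)))
  have hY := ee_ne_zero (2 * η - t)
  have hy2 : ee (t - 2 * η) = (ee (2 * η - t))⁻¹ := by rw [hy, inv_inv]
  generalize Phi (ee τ) (ee σ) (ee (t - 2 * η)) = P0 at *
  generalize Phi (ee τ) (ee σ) (ee (t + 2 * η)) = P1 at *
  generalize Phi (ee τ) (ee σ) (ee (τ + σ - t - 2 * η)) = P3 at *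
  generalize Phi (ee τ) (ee σ) (ee (τ + σ + t - 2 * η)) = P4 at *
  generalize Phi (ee τ) (ee σ) (ee (τ + σ - t + 2 * η)) = P5 at *
  generalize qpoch (ee τ) (ee (t - 2 * η)) = A1 at *
  generalize qpoch (ee σ) (ee (t - 2 * η)) = A2 at *
  generalize qpoch (ee τ) (ee τ / ee (t - 2 * η)) = B1 at *
  generalize qpoch (ee σ) (ee σ / ee (t - 2 * η)) = B2 at *
  rw [hy2] at e1
  generalize ee (2 * η - t) = Y at *
  generalize exp (-(Real.pi * I * (t - 2 * η))) = X at *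
  have hYm : Y - 1 ≠ 0 := fun h => hB (by linear_combination -h)
  have e3 : P0 * (Y - 1) = Y * (A1 * A2 * P4) := by
    rw [← e1]; field_simp
  have hP0 : P0 = Y * (A1 * A2 * P4) / (Y - 1) := by
    rw [← e3]; field_simp
  rw [hP0, ← hE] at *
  have hB' : (1 : ℂ) - X * X = -(X * X - 1) := by ring
  rw [hB']
  field_simp

/-- The zeros of the theta functions are countable, hence do not affect the integral. -/
theorem exists_intervalInt_eq (hτ : 0 < τ.im) (hσ : 0 < σ.im) : ∃ c, c ≠ 0 ∧
    ∀ f, PerEnt f → ∀ η : ℂ, 0 < η.im → intervalInt τ σ η f = c * Lam τ σ η f := by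
  obtain ⟨c, hc, h⟩ := exists_Omega_div_theta hτ hσ
  refine ⟨c, hc, fun f hf η hη => ?_⟩
  rw [Lam_eq_integral hτ hσ hη hf, intervalInt, ← intervalIntegral.integral_const_mul]
  have hcount : ∀ {ρ : ℂ}, 0 < ρ.im → {t : ℝ | theta (t - 2 * η) ρ = 0}.Countable := by
    intro ρ hρ
    refine ((Set.countable_range fun p : ℤ × ℤ => (2 * η + p.1 + p.2 * ρ)).preimage
      ofReal_injective).mono fun t ht => ?_
    obtain ⟨r, s, hrs⟩ := (theta_eq_zero_iff hρ _).mp ht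
    exact ⟨(r, s), by simp only; linear_combination -hrs⟩
  refine intervalIntegral.integral_congr_ae ?_
  filter_upwards [((hcount hτ).union (hcount hσ)).ae_notMem MeasureTheory.volume] with t ht _
  rw [Set.mem_union, not_or] at ht
  refine h η t (Phi_ne_zero (norm_ee_lt_one hτ) (norm_ee_lt_one hσ) (norm_ee_lt_one ?_))
    (Phi_ne_zero (norm_ee_lt_one hτ) (norm_ee_lt_one hσ) (norm_ee_lt_one ?_)) ht.1 ht.2 (f t)
  · simpa using hη
  · simpa using hη

theorem exists_isContinuation (hτ : 0 < τ.im) (hσ : 0 < σ.im) : ∃ c, c ≠ 0 ∧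
    ∀ f, PerEnt f → IsContinuation τ σ f fun η => c * Lam τ σ η f := by
  obtain ⟨c, hc, h⟩ := exists_intervalInt_eq hτ hσ
  refine ⟨c, hc, fun f hf => ⟨?_, fun η hη => (h f hf η hη).symm⟩⟩
  have h1 : DifferentiableOn ℂ (fun η => Lam τ σ η f) (pinchSet τ σ)ᶜ :=
    differentiableOn_Lam hτ hσ (f := fun _ => f) (hf.diff.continuous.comp continuous_snd)
      (fun t => differentiable_const _) fun _ => hf
  exact (h1.const_mul c).analyticOnNhd (isOpen_pinchSet_compl hτ hσ)

/-- The integral over `γ` is defined for every entire function with period `1`, and is a constant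
multiple of `Lam`. -/
theorem exists_gammaInt_eq (hτ : 0 < τ.im) (hσ : 0 < σ.im) : ∃ c, c ≠ 0 ∧
    ∀ f, PerEnt f → ∀ η ∉ pinchSet τ σ,
      GammaIntegrable τ σ η f ∧ gammaInt τ σ η f = c * Lam τ σ η f := by
  obtain ⟨c, hc, h⟩ := exists_isContinuation hτ hσ
  exact ⟨c, hc, fun f hf η hη => ⟨⟨hη, _, h f hf⟩, gammaInt_eq hτ hσ (h f hf) hη⟩⟩

end Integral

section Series

variable {τ σ η : ℂ}

/-! ### Linearity, summation and parameters in the integral -/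

theorem Lam_const_mul (c : ℂ) (f : ℂ → ℂ) : Lam τ σ η (fun t => c * f t) = c * Lam τ σ η f := by
  rw [Lam, Lam, ← pair_const_mul]
  congr 1
  ext t
  ring

theorem hasSum_Lam (hτ : 0 < τ.im) (hσ : 0 < σ.im) (hη : η ∉ pinchSet τ σ) {ι : Type*}
    [Countable ι] {F : ι → ℂ → ℂ} {G : ℂ → ℂ} (hF : ∀ i, PerEnt (F i))
    (hb : ∀ Y : ℝ, ∃ u : ι → ℝ, Summable u ∧ ∀ i (t : ℂ), |t.im| ≤ Y → ‖F i t‖ ≤ u i)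
    (h : ∀ t : ℝ, HasSum (fun i => F i t) (G t)) :
    HasSum (fun i => Lam τ σ η (F i)) (Lam τ σ η G) := by
  obtain ⟨C, R, hCR⟩ := expBdd_dco hτ hσ hη
  obtain ⟨Y, hY, hRY⟩ := exists_width R
  obtain ⟨u, hu, hub⟩ := hb Y
  have hN := perEnt_Nfac hτ hσ η
  obtain ⟨M, hM0, hM⟩ := hN.exists_bound Y
  refine hasSum_pair hCR hY hRY (hu.mul_left M) (fun i => hN.mul (hF i)) (fun i t ht => ?_)
    fun t => (h t).mul_left _
  rw [norm_mul]
  exact mul_le_mul (hM t ht) (hub i t ht) (norm_nonneg _) hM0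

theorem differentiable_Lam (hτ : 0 < τ.im) (hσ : 0 < σ.im) (hη : η ∉ pinchSet τ σ)
    {f : ℂ → ℂ → ℂ} (hf : Continuous (Function.uncurry f))
    (hfd : ∀ t, Differentiable ℂ fun w => f w t) (hp : ∀ w, PerEnt (f w)) :
    Differentiable ℂ fun w => Lam τ σ η (f w) := by
  obtain ⟨C, R, hCR⟩ := expBdd_dco hτ hσ hη
  have hN := perEnt_Nfac hτ hσ η
  exact differentiable_pair hCR ((hN.diff.continuous.comp continuous_snd).mul hf)
    (fun t => (hfd t).const_mul _) fun w => hN.mul (hp w)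

theorem continuous_theta (hτ : 0 < τ.im) : Continuous fun z => theta z τ :=
  (differentiable_theta hτ).continuous

theorem differentiable_theta_comp (hτ : 0 < τ.im) {g : ℂ → ℂ} (hg : Differentiable ℂ g) :
    Differentiable ℂ fun z => theta (g z) τ :=
  (differentiable_theta hτ).comp hg

theorem continuous_theta_comp (hτ : 0 < τ.im) {X : Type*} [TopologicalSpace X] {g : X → ℂ}
    (hg : Continuous g) : Continuous fun x => theta (g x) τ :=
  (continuous_theta hτ).comp hg

theorem perEnt_uFactor (hτ : 0 < τ.im) (hσ : 0 < σ.im) (z μ : ℂ) : PerEnt (uFactor z μ τ σ) := by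
  refine ⟨(differentiable_theta_comp hτ (by fun_prop)).mul
    (differentiable_theta_comp hσ (by fun_prop)), fun t => ?_⟩
  rw [uFactor, uFactor, ← add_assoc, ← add_assoc, theta_add_one, theta_add_one]
  ring

theorem differentiable_jacobiTheta₂ (hτ : 0 < τ.im) : Differentiable ℂ fun z => jacobiTheta₂ z τ :=
  fun z => differentiableAt_jacobiTheta₂_fst z hτ

/-! ### The terms of the series -/

variable {κ : ℕ}

theorem im_two_mul_pos (hκ : 0 < κ) (hτ : 0 < τ.im) : 0 < (2 * κ * τ).im := by
  have : (2 * κ * τ : ℂ).im = 2 * κ * τ.im := by simp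
  rw [this]; positivity

/-- The integrand of `repInt` with the level theta function replaced by its `r`-th term. -/
def repTerm (κ : ℕ) (l : ℤ) (z τ η : ℂ) (r : ℤ) (t : ℂ) : ℂ :=
  uFactor z (2 * η * l) τ (-2 * η * κ) t * (exp (Real.pi * I * (l ^ 2 * τ / (2 * κ) - l * z)) *
    jacobiTheta₂_term r (l * τ + 2 * t - κ * z) (2 * κ * τ))

theorem repFactor_eq (hκ : (κ : ℂ) ≠ 0) (l : ℤ) (z τ η t : ℂ) : repFactor κ l z τ η t =
    uFactor z (2 * η * l) τ (-2 * η * κ) t * (exp (Real.pi * I * (l ^ 2 * τ / (2 * κ) - l * z)) *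
      jacobiTheta₂ (l * τ + 2 * t - κ * z) (2 * κ * τ)) := by
  rw [repFactor, uFactor, thetaLevel, jacobiTheta₂, mul_assoc (theta _ _ * theta _ _)]
  congr 1
  rw [← tsum_mul_left, ← tsum_mul_left]
  congr 1
  ext m
  rw [jacobiTheta₂_term, ← exp_add, ← exp_add]
  congr 1
  field_simp
  ring

theorem perEnt_repTerm (hτ : 0 < τ.im) (hσ : 0 < (-2 * η * κ).im) (l : ℤ) (z : ℂ) (r : ℤ) :
    PerEnt (repTerm κ l z τ η r) := by
  refine (perEnt_uFactor hτ hσ _ _).mul ⟨?_, fun t => ?_⟩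
  · simp only [jacobiTheta₂_term]
    fun_prop
  · simp only [jacobiTheta₂_term]
    congr 1
    rw [exp_eq_exp_iff_exists_int]
    exact ⟨2 * r, by push_cast; ring⟩

theorem perEnt_repFactor (hτ : 0 < τ.im) (hκ : 0 < κ) (hσ : 0 < (-2 * η * κ).im) (l : ℤ) (z : ℂ) :
    PerEnt (repFactor κ l z τ η) := by
  have hκ' : (κ : ℂ) ≠ 0 := by exact_mod_cast hκ.ne'
  have hτ' := im_two_mul_pos hκ hτ
  have : repFactor κ l z τ η = _ := funext fun t => repFactor_eq hκ' l z τ η t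
  rw [this]
  refine (perEnt_uFactor hτ hσ _ _).mul ⟨?_, fun t => ?_⟩
  · exact ((differentiable_jacobiTheta₂ hτ').comp
      (f := fun t => l * τ + 2 * t - κ * z) (by fun_prop)).const_mul _
  · rw [show l * τ + 2 * (t + 1) - κ * z = l * τ + 2 * t - κ * z + 1 + 1 by ring,
      jacobiTheta₂_add_left, jacobiTheta₂_add_left]

theorem theta_add_two_int_mul (z σ : ℂ) (n : ℤ) : theta (z + 2 * n * σ) σ =
    exp (-(4 * Real.pi * I * (n * z + n ^ 2 * σ))) * theta z σ := by
  have := theta_add_int_mul z σ (2 * n)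
  push_cast at this
  rw [this, zpow_mul]
  norm_num
  left
  congr 1
  ring

theorem uFactor_add (z μ τ σ t : ℂ) (n : ℤ) : uFactor z (μ + 2 * n * σ) τ σ t =
    exp (-(4 * Real.pi * I * (n * (μ + t) + n ^ 2 * σ))) * uFactor z μ τ σ t := by
  rw [uFactor, uFactor, show μ + 2 * n * σ + t = μ + t + 2 * n * σ by ring, theta_add_two_int_mul]
  ring

theorem Q_add (μ σ η : ℂ) (n : ℤ) : Q (μ + 2 * n * σ) σ η =
    exp (8 * Real.pi * I * (n * μ + n ^ 2 * σ)) * Q μ σ η := by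
  rw [Q, Q, show μ + 2 * n * σ - 2 * η = μ - 2 * η + 2 * n * σ by ring,
    show μ + 2 * n * σ + 2 * η = μ + 2 * η + 2 * n * σ by ring, theta_add_two_int_mul,
    theta_add_two_int_mul]
  have : exp (-(4 * Real.pi * I * (n * (μ - 2 * η) + n ^ 2 * σ))) *
      exp (-(4 * Real.pi * I * (n * (μ + 2 * η) + n ^ 2 * σ))) =
      (exp (8 * Real.pi * I * (n * μ + n ^ 2 * σ)))⁻¹ := by
    rw [← exp_add, ← exp_neg]; congr 1; ring
  rw [mul_mul_mul_comm, this]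
  simp only [div_eq_mul_inv, mul_inv, inv_inv]
  ring

/-- Passing from the index `l` to `l + 2 κ r` translates `μ` by `-2 r σ` with `σ = -2 η κ`. The
multipliers so obtained combine to the `r`-th term of the level theta function. -/
theorem deltaTerm_eq (hη0 : η ≠ 0) (hκ : (κ : ℂ) ≠ 0) {c : ℂ}
    (hc : ∀ z μ, gammaInt τ (-2 * η * κ) η (uFactor z μ τ (-2 * η * κ)) =
      c * Lam τ (-2 * η * κ) η (uFactor z μ τ (-2 * η * κ))) (l : ℤ) (z : ℂ) (r : ℤ) :
    deltaTerm κ (l + 2 * κ * r) z τ η = exp (2 * Real.pi * I * η / κ * l ^ 2) *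
      Q (2 * η * l) (-2 * η * κ) η * c * Lam τ (-2 * η * κ) η (repTerm κ l z τ η r) := by
  have e1 : 2 * η * ((l + 2 * κ * r : ℤ) : ℂ) =
      2 * η * l + 2 * ((-r : ℤ) : ℂ) * (-2 * η * κ) := by
    push_cast; ring
  rw [deltaTerm, u, hc, e1, Q_add, funext fun t => uFactor_add z (2 * η * l) τ (-2 * η * κ) t (-r)]
  set σ := -2 * η * κ with hσ
  have e2 : (fun t => exp (-(4 * Real.pi * I * (((-r : ℤ) : ℂ) * (2 * η * l + t) +
      ((-r : ℤ) : ℂ) ^ 2 * σ))) * uFactor z (2 * η * l) τ σ t) =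
      fun t => exp (-(4 * Real.pi * I * (((-r : ℤ) : ℂ) * (2 * η * l) + ((-r : ℤ) : ℂ) ^ 2 * σ)) -
        (Real.pi * I * (l ^ 2 * τ / (2 * κ) - l * z)) - 2 * Real.pi * I * r * (l * τ - κ * z) -
        Real.pi * I * r ^ 2 * (2 * κ * τ)) * repTerm κ l z τ η r t := by
    ext t
    rw [repTerm, jacobiTheta₂_term, ← exp_add]
    rw [mul_comm (uFactor _ _ _ _ _), ← mul_assoc (exp _) (exp _), ← exp_add]
    congr 2
    push_cast
    ring
  rw [e2, Lam_const_mul]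
  have e3 : ∀ a b d f Q c L : ℂ, a * (c * (b * L)) * (d * Q) * f =
      (a * b * d * f) * Q * c * L := by intros; ring
  rw [e3, ← exp_add, ← exp_add, ← exp_add]
  congr 4
  rw [hσ]
  push_cast
  field_simp
  ring

theorem hasSum_Lam_repTerm (hτ : 0 < τ.im) (hκ : 0 < κ) (hσ : 0 < (-2 * η * κ).im)
    (hη : η ∉ pinchSet τ (-2 * η * κ)) (l : ℤ) (z : ℂ) :
    HasSum (fun r => Lam τ (-2 * η * κ) η (repTerm κ l z τ η r))
      (Lam τ (-2 * η * κ) η (repFactor κ l z τ η)) := by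
  have hκ' : (κ : ℂ) ≠ 0 := by exact_mod_cast hκ.ne'
  have hτ' := im_two_mul_pos hκ hτ
  refine hasSum_Lam hτ hσ hη (fun r => perEnt_repTerm hτ hσ l z r) (fun Y => ?_) fun t => ?_
  · obtain ⟨M, hM0, hM⟩ := (perEnt_uFactor hτ hσ z (2 * η * l)).exists_bound Y
    set E := exp (Real.pi * I * (l ^ 2 * τ / (2 * κ) - l * z))
    have hs := summable_pow_mul_jacobiTheta₂_term_bound (|(l * τ - κ * z).im| + 2 * Y) hτ' 0
    simp only [pow_zero, one_mul] at hs
    refine ⟨_, (hs.mul_left ‖E‖).mul_left M, fun r t ht => ?_⟩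
    rw [repTerm, norm_mul, norm_mul]
    refine mul_le_mul (hM t ht) (mul_le_mul_of_nonneg_left
      (norm_jacobiTheta₂_term_le hτ' ?_ le_rfl r) (norm_nonneg _)) (by positivity) hM0
    have : (l * τ + 2 * t - κ * z).im = (l * τ - κ * z).im + 2 * t.im := by
      simp; ring
    rw [this]
    refine (abs_add_le _ _).trans ?_
    rw [abs_mul, abs_two]
    linarith
  · simp only [repFactor_eq hκ', repTerm]
    exact ((hasSum_jacobiTheta₂_term _ hτ').mul_left _).mul_left _

/-- No pinching occurs for `σ = -2 η κ`. -/
theorem not_mem_pinchSet (hκ : 4 ≤ κ) (hη : η.im < 0) (hτ : 0 < τ.im)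
    (hreg : ∀ j : ℕ, 1 ≤ j → ∀ n : ℤ, (j : ℂ) * τ + 4 * η ≠ (n : ℂ)) :
    η ∉ pinchSet τ (-2 * η * κ) := by
  rintro ⟨l, m, n, h⟩
  have hm : 0 ≤ (m : ℝ) * τ.im := by positivity
  have him := congrArg Complex.im h
  simp only [add_im, mul_im, re_ofNat, im_ofNat, zero_mul, add_zero, intCast_im, natCast_re,
    natCast_im, neg_re, neg_im, zero_im, mul_re, sub_zero, neg_zero, mul_zero] at him
  rcases Nat.eq_zero_or_pos n with rfl | hn
  · rcases Nat.eq_zero_or_pos m with rfl | hm'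
    · simp at him; linarith
    · exact hreg m hm' (-l) (by push_cast at h ⊢; linear_combination h)
  · have h1 : (4 : ℝ) ≤ n * κ := by
      have : (1 : ℝ) ≤ n := by exact_mod_cast hn
      have : (4 : ℝ) ≤ κ := by exact_mod_cast hκ
      nlinarith
    nlinarith

end Series

section FunctionalEquation

variable {τ σ η : ℂ}

/-! ### The functional equation of the integral -/

/-- The identity theorem on the complement of the pinching values, which is connected since these
are countable. -/
theorem eq_of_eq_of_im_pos (hτ : 0 < τ.im) (hσ : 0 < σ.im) {F G : ℂ → ℂ}
    (hF : DifferentiableOn ℂ F (pinchSet τ σ)ᶜ) (hG : DifferentiableOn ℂ G (pinchSet τ σ)ᶜ)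
    (h : ∀ η : ℂ, 0 < η.im → F η = G η) (hη : η ∉ pinchSet τ σ) : F η = G η := by
  have hc : (pinchSet τ σ).Countable := by
    refine (Set.countable_range
      fun p : ℤ × ℕ × ℕ => -((p.1 : ℂ) + p.2.1 * τ + p.2.2 * σ) / 4).mono ?_
    rintro x ⟨l, m, n, h⟩
    exact ⟨(l, m, n), by simp only; linear_combination -h / 4⟩
  have hconn : IsPreconnected (pinchSet τ σ)ᶜ :=
    (hc.isPathConnected_compl_of_one_lt_rank
      (by rw [Complex.rank_real_complex]; norm_num)).isConnected.isPreconnected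
  have hI : I ∈ (pinchSet τ σ)ᶜ := by
    rintro ⟨l, m, n, h⟩
    have h' := congrArg Complex.im h
    simp at h'
    have : 0 ≤ (m : ℝ) * τ.im := by positivity
    have : 0 ≤ (n : ℝ) * σ.im := by positivity
    linarith
  have ho := isOpen_pinchSet_compl hτ hσ
  refine (hF.analyticOnNhd ho).eqOn_of_preconnected_of_eventuallyEq (hG.analyticOnNhd ho) hconn
    hI ?_ hη
  filter_upwards [(isOpen_lt continuous_const Complex.continuous_im).mem_nhds
    (show (0 : ℝ) < I.im by simp)] with z hz using h z hz

/-- For `Im η > 0` this is Cauchy's theorem: the integrand on the left, as a function of `t`, is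
holomorphic for `0 ≤ Im t ≤ Im σ`, and its translate by `σ` is the negative of the integrand on
the right. -/
theorem Lam_theta_sub_of_im_pos (hτ : 0 < τ.im) (hσ : 0 < σ.im) (hη : 0 < η.im) {h : ℂ → ℂ}
    (hh : Differentiable ℂ h) (hh1 : ∀ t, h (t + 1) = -h t) :
    Lam τ σ η (fun t => theta (t - 2 * η) τ * h t) =
      -Lam τ σ η (fun t => theta (t + 2 * η) τ * exp (Real.pi * I * (2 * t + σ)) * h (t + σ)) := by
  have hq := norm_ee_lt_one hτ
  have hp := norm_ee_lt_one hσ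
  obtain ⟨c, hc, hθ⟩ := exists_theta_eq_thetaProd hτ
  have hPd := differentiable_Phi_ee hτ hσ
  have p1 : PerEnt fun t => theta (t - 2 * η) τ * h t := by
    refine ⟨(differentiable_theta_comp hτ (by fun_prop)).mul hh, fun t => ?_⟩
    rw [hh1, show t + 1 - 2 * η = t - 2 * η + 1 by ring, theta_add_one]; ring
  have p2 : PerEnt fun t => theta (t + 2 * η) τ * exp (Real.pi * I * (2 * t + σ)) * h (t + σ) := by
    refine ⟨((differentiable_theta_comp hτ (by fun_prop)).mul (by fun_prop)).mul
      (hh.comp (by fun_prop)), fun t => ?_⟩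
    rw [show t + 1 + σ = t + σ + 1 by ring, hh1, show t + 1 + 2 * η = t + 2 * η + 1 by ring,
      theta_add_one, show (Real.pi * I * (2 * (t + 1) + σ) : ℂ) =
        Real.pi * I * (2 * t + σ) + 2 * Real.pi * I by ring, exp_add, exp_two_pi_mul_I]
    ring
  rw [Lam_eq_integral hτ hσ hη p1, Lam_eq_integral hτ hσ hη p2]
  -- the integrand on the left, with the zeros of the theta function cancelled against the
  -- denominator
  set K : ℂ → ℂ := fun t => -c * exp (Real.pi * I * (t - 2 * η)) *
    (Phi (ee τ) (ee σ) (ee (τ + t - 2 * η)) * Phi (ee τ) (ee σ) (ee (τ + σ - t - 2 * η)) /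
      (Phi (ee τ) (ee σ) (ee (t + 2 * η)) * Phi (ee τ) (ee σ) (ee (σ - t + 2 * η)))) * h t with hK
  have hKper : ∀ t, K (t + 1) = K t := by
    intro t
    have e1 : ee (τ + (t + 1) - 2 * η) = ee (τ + t - 2 * η) := by
      rw [show τ + (t + 1) - 2 * η = τ + t - 2 * η + 1 by ring, ee_add _ 1, ee_one, mul_one]
    have e2 : ee (τ + σ - (t + 1) - 2 * η) = ee (τ + σ - t - 2 * η) := by
      rw [show τ + σ - t - 2 * η = τ + σ - (t + 1) - 2 * η + 1 by ring, ee_add _ 1, ee_one, mul_one]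
    have e3 : ee (t + 1 + 2 * η) = ee (t + 2 * η) := by
      rw [show t + 1 + 2 * η = t + 2 * η + 1 by ring, ee_add _ 1, ee_one, mul_one]
    have e4 : ee (σ - (t + 1) + 2 * η) = ee (σ - t + 2 * η) := by
      rw [show σ - t + 2 * η = σ - (t + 1) + 2 * η + 1 by ring, ee_add _ 1, ee_one, mul_one]
    simp only [hK, e1, e2, e3, e4, hh1]
    rw [show t + 1 - 2 * η = t - 2 * η + 1 by ring, exp_pi_add_one]
    ring
  have hT := integral_translate hKper σ (fun t ht => by
    rw [Set.uIcc_of_le hσ.le] at ht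
    have d1 : DifferentiableAt ℂ (fun t => Phi (ee τ) (ee σ) (ee (τ + t - 2 * η))) t :=
      (hPd _).comp t (f := fun t => τ + t - 2 * η) (by fun_prop)
    have d2 : DifferentiableAt ℂ (fun t => Phi (ee τ) (ee σ) (ee (τ + σ - t - 2 * η))) t :=
      (hPd _).comp t (f := fun t => τ + σ - t - 2 * η) (by fun_prop)
    have d3 : DifferentiableAt ℂ (fun t => Phi (ee τ) (ee σ) (ee (t + 2 * η))) t :=
      (hPd _).comp t (f := fun t => t + 2 * η) (by fun_prop)
    have d4 : DifferentiableAt ℂ (fun t => Phi (ee τ) (ee σ) (ee (σ - t + 2 * η))) t :=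
      (hPd _).comp t (f := fun t => σ - t + 2 * η) (by fun_prop)
    have n3 : Phi (ee τ) (ee σ) (ee (t + 2 * η)) ≠ 0 := Phi_ne_zero hq hp (norm_ee_lt_one (by
      have : (t + 2 * η).im = t.im + 2 * η.im := by simp
      rw [this]; linarith [ht.1]))
    have n4 : Phi (ee τ) (ee σ) (ee (σ - t + 2 * η)) ≠ 0 := Phi_ne_zero hq hp (norm_ee_lt_one (by
      have : (σ - t + 2 * η).im = σ.im - t.im + 2 * η.im := by simp
      rw [this]; linarith [ht.2]))
    exact (DifferentiableAt.mul (by fun_prop) ((d1.mul d2).div (d3.mul d4) (mul_ne_zero n3 n4))).mul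
      (hh t))
  rw [← intervalIntegral.integral_neg]
  refine Eq.trans ?_ (hT.trans ?_)
  · refine intervalIntegral.integral_congr fun t _ => ?_
    have n2 : Phi (ee τ) (ee σ) (ee (2 * η - t)) ≠ 0 :=
      Phi_ne_zero hq hp (norm_ee_lt_one (by simpa using hη))
    have n3 : Phi (ee τ) (ee σ) (ee (t + 2 * η)) ≠ 0 :=
      Phi_ne_zero hq hp (norm_ee_lt_one (by simpa using hη))
    have e1 : qpoch (ee τ) (ee (t - 2 * η)) * Phi (ee τ) (ee σ) (ee (τ + σ + t - 2 * η)) =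
        (1 - ee (t - 2 * η)) * Phi (ee τ) (ee σ) (ee (τ + t - 2 * η)) := by
      rw [qpoch_eq_mul hq, show τ + t - 2 * η = τ + (t - 2 * η) by ring, ee_add τ,
        Phi_eq_mul hq hp (ee τ * _), ← ee_add, ← ee_add,
        show σ + (τ + (t - 2 * η)) = τ + σ + t - 2 * η by ring]
      ring
    have e2 : Phi (ee τ) (ee σ) (ee (2 * η - t)) = (1 - ee (2 * η - t)) *
        qpoch (ee τ) (ee τ / ee (t - 2 * η)) * Phi (ee τ) (ee σ) (ee (σ - t + 2 * η)) := by
      rw [Phi_eq_mul hq hp, qpoch_eq_mul hq (ee (2 * η - t)), ← ee_add, ← ee_add, ← ee_sub,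
        show τ + (2 * η - t) = τ - (t - 2 * η) by ring,
        show σ + (2 * η - t) = σ - t + 2 * η by ring]
    have e3 : ee (2 * η - t) = (ee (t - 2 * η))⁻¹ := by rw [← ee_neg]; congr 1; ring
    have e4 : exp (Real.pi * I * (t - 2 * η)) =
        ee (t - 2 * η) * exp (-(Real.pi * I * (t - 2 * η))) := by
      rw [ee, ← exp_add]; congr 1; ring
    simp only [hK, hθ, thetaProd, Nfac]
    rw [e2] at n2 ⊢
    have m1 := right_ne_zero_of_mul n2
    have m2 := left_ne_zero_of_mul (left_ne_zero_of_mul n2)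
    have m3 := right_ne_zero_of_mul (left_ne_zero_of_mul n2)
    rw [e3] at m2 ⊢
    rw [e4]
    have m4 := ee_ne_zero (t - 2 * η)
    generalize ee (t - 2 * η) = y at *
    generalize qpoch (ee τ) y = A at *
    generalize qpoch (ee τ) (ee τ / y) = B at *
    generalize Phi (ee τ) (ee σ) (ee (τ + σ + t - 2 * η)) = P1 at *
    generalize Phi (ee τ) (ee σ) (ee (σ - t + 2 * η)) = P2 at *
    generalize Phi (ee τ) (ee σ) (ee (t + 2 * η)) = P3 at *
    generalize Phi (ee τ) (ee σ) (ee (τ + t - 2 * η)) = P4 at *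
    generalize Phi (ee τ) (ee σ) (ee (τ + σ - t - 2 * η)) = P5 at *
    generalize exp (-(Real.pi * I * (t - 2 * η))) = X at *
    have m5 : y - 1 ≠ 0 := fun h => m2 (by rw [sub_eq_zero.mp h]; simp)
    field_simp
    linear_combination (P5 * X * h t) * e1
  · refine intervalIntegral.integral_congr fun t _ => ?_
    have n2 : Phi (ee τ) (ee σ) (ee (2 * η - t)) ≠ 0 :=
      Phi_ne_zero hq hp (norm_ee_lt_one (by simpa using hη))
    have n3 : Phi (ee τ) (ee σ) (ee (t + 2 * η)) ≠ 0 :=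
      Phi_ne_zero hq hp (norm_ee_lt_one (by simpa using hη))
    have e1 : qpoch (ee τ) (ee τ / ee (t + 2 * η)) * Phi (ee τ) (ee σ) (ee (τ + σ - t - 2 * η)) =
        Phi (ee τ) (ee σ) (ee (τ - t - 2 * η)) := by
      rw [Phi_eq_mul hq hp (ee (τ - t - 2 * η)), ← ee_sub, ← ee_add,
        show τ - (t + 2 * η) = τ - t - 2 * η by ring,
        show σ + (τ - t - 2 * η) = τ + σ - t - 2 * η by ring]
    have e2 : Phi (ee τ) (ee σ) (ee (t + 2 * η)) =
        qpoch (ee τ) (ee (t + 2 * η)) * Phi (ee τ) (ee σ) (ee (t + σ + 2 * η)) := by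
      rw [Phi_eq_mul hq hp, ← ee_add, show σ + (t + 2 * η) = t + σ + 2 * η by ring]
    have e3 : exp (Real.pi * I * (t + σ - 2 * η)) =
        exp (-(Real.pi * I * (t + 2 * η))) * exp (Real.pi * I * (2 * t + σ)) := by
      rw [← exp_add]; congr 1; ring
    simp only [hK, hθ, thetaProd, Nfac]
    rw [show τ + (t + σ) - 2 * η = τ + σ + t - 2 * η by ring,
      show τ + σ - (t + σ) - 2 * η = τ - t - 2 * η by ring,
      show σ - (t + σ) + 2 * η = 2 * η - t by ring, e3, ← e1, e2]
    rw [e2] at n3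
    have m1 := left_ne_zero_of_mul n3
    have m2 := right_ne_zero_of_mul n3
    field_simp

/-- The functional equation extends to all `η` without pinching, by analytic continuation. -/
theorem Lam_theta_sub (hτ : 0 < τ.im) (hσ : 0 < σ.im) (hη : η ∉ pinchSet τ σ) {h : ℂ → ℂ}
    (hh : Differentiable ℂ h) (hh1 : ∀ t, h (t + 1) = -h t) :
    Lam τ σ η (fun t => theta (t - 2 * η) τ * h t) =
      -Lam τ σ η (fun t => theta (t + 2 * η) τ * exp (Real.pi * I * (2 * t + σ)) * h (t + σ)) := by
  refine eq_of_eq_of_im_pos hτ hσ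
    (F := fun η => Lam τ σ η (fun t => theta (t - 2 * η) τ * h t))
    (G := fun η => -Lam τ σ η (fun t => theta (t + 2 * η) τ * exp (Real.pi * I * (2 * t + σ)) *
      h (t + σ))) ?_ ?_
    (fun η hη => Lam_theta_sub_of_im_pos hτ hσ hη hh hh1) hη
  · refine differentiableOn_Lam hτ hσ (f := fun η t => theta (t - 2 * η) τ * h t) ?_ (fun t => ?_)
      fun η => ⟨?_, fun t => ?_⟩
    · exact (continuous_theta_comp hτ (g := fun x : ℂ × ℂ => x.2 - 2 * x.1) (by fun_prop)).mul
        (hh.continuous.comp continuous_snd)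
    · exact (differentiable_theta_comp hτ (by fun_prop)).mul_const _
    · exact (differentiable_theta_comp hτ (by fun_prop)).mul hh
    · rw [hh1, show t + 1 - 2 * η = t - 2 * η + 1 by ring, theta_add_one]; ring
  · refine (differentiableOn_Lam hτ hσ (f := fun η t => theta (t + 2 * η) τ *
      exp (Real.pi * I * (2 * t + σ)) * h (t + σ)) ?_ (fun t => ?_) fun η => ⟨?_, fun t => ?_⟩).neg
    · exact ((continuous_theta_comp hτ (g := fun x : ℂ × ℂ => x.2 + 2 * x.1) (by fun_prop)).mul
        (by fun_prop)).mul (hh.continuous.comp (g := h) (f := fun x : ℂ × ℂ => x.2 + σ)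
          (by fun_prop))
    · exact ((differentiable_theta_comp hτ (by fun_prop)).mul_const _).mul_const _
    · exact ((differentiable_theta_comp hτ (by fun_prop)).mul (by fun_prop)).mul
        (hh.comp (by fun_prop))
    · rw [show t + 1 + σ = t + σ + 1 by ring, hh1, show t + 1 + 2 * η = t + 2 * η + 1 by ring,
        theta_add_one, show (Real.pi * I * (2 * (t + 1) + σ) : ℂ) =
          Real.pi * I * (2 * t + σ) + 2 * Real.pi * I by ring, exp_add, exp_two_pi_mul_I]
      ring

/-! ### The hypergeometric theta functions as theta functions -/

theorem jacobiTheta₂_add_int_mul (z τ : ℂ) (n : ℤ) : jacobiTheta₂ (z + n * τ) τ =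
    exp (-(Real.pi * I * (n ^ 2 * τ + 2 * n * z))) * jacobiTheta₂ z τ := by
  rw [jacobiTheta₂, jacobiTheta₂, ← tsum_mul_left,
    ← (Equiv.addRight n).tsum_eq fun m => exp (-(Real.pi * I * (n ^ 2 * τ + 2 * n * z))) *
      jacobiTheta₂_term m z τ]
  congr 1
  ext m
  rw [jacobiTheta₂_term, jacobiTheta₂_term, ← exp_add, Equiv.coe_addRight]
  congr 1
  push_cast
  ring

theorem jacobiTheta₂_add_int (z τ : ℂ) (n : ℤ) : jacobiTheta₂ (z + n) τ = jacobiTheta₂ z τ := by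
  rw [jacobiTheta₂, jacobiTheta₂]
  congr 1
  ext m
  rw [jacobiTheta₂_term, jacobiTheta₂_term, exp_eq_exp_iff_exists_int]
  exact ⟨m * n, by push_cast; ring⟩

theorem theta_add_lattice (z τ : ℂ) (r s : ℤ) : theta (z + r + s * τ) τ =
    exp (Real.pi * I * (r + s - 2 * s * z - s ^ 2 * τ)) * theta z τ := by
  rw [theta_add_int_mul, theta_add_int, ← exp_int_mul_pi_mul_I, ← exp_int_mul_pi_mul_I,
    ← mul_assoc, ← exp_add, ← exp_add]
  congr 1
  rw [exp_eq_exp_iff_exists_int]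
  exact ⟨-(s * r), by push_cast; ring⟩

variable {κ : ℕ}

theorem differentiable_Lam_repFactor (hτ : 0 < τ.im) (hκ : 0 < κ) (hσ : 0 < (-2 * η * κ).im)
    (hη : η ∉ pinchSet τ (-2 * η * κ)) (l : ℤ) :
    Differentiable ℂ fun z => Lam τ (-2 * η * κ) η (repFactor κ l z τ η) := by
  have hκ' : (κ : ℂ) ≠ 0 := by exact_mod_cast hκ.ne'
  have hJ := differentiable_jacobiTheta₂ (im_two_mul_pos hκ hτ)
  refine differentiable_Lam hτ hσ hη (f := fun z => repFactor κ l z τ η) ?_ (fun t => ?_)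
    fun z => perEnt_repFactor hτ hκ hσ l z
  · have : (Function.uncurry fun z => repFactor κ l z τ η) = fun x : ℂ × ℂ => _ :=
      funext fun x => repFactor_eq hκ' l x.1 τ η x.2
    rw [this]
    simp only [uFactor]
    have h1 : Continuous fun x : ℂ × ℂ => theta (x.1 + x.2) τ :=
      continuous_theta_comp hτ (by fun_prop)
    have h2 : Continuous fun x : ℂ × ℂ => theta (2 * η * l + x.2) (-2 * η * κ) :=
      continuous_theta_comp hσ (by fun_prop)
    have h3 : Continuous fun x : ℂ × ℂ => jacobiTheta₂ (l * τ + 2 * x.2 - κ * x.1) (2 * κ * τ) :=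
      hJ.continuous.comp (f := fun x : ℂ × ℂ => l * τ + 2 * x.2 - κ * x.1) (by fun_prop)
    fun_prop
  · simp only [repFactor_eq hκ', uFactor]
    have h1 : Differentiable ℂ fun z => theta (z + t) τ :=
      differentiable_theta_comp hτ (by fun_prop)
    have h3 : Differentiable ℂ fun z => jacobiTheta₂ (l * τ + 2 * t - κ * z) (2 * κ * τ) :=
      hJ.comp (f := fun z => l * τ + 2 * t - κ * z) (by fun_prop)
    fun_prop

theorem repFactor_add (hκ : (κ : ℂ) ≠ 0) (l : ℤ) (z τ η t : ℂ) (r s : ℤ) :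
    repFactor κ l (z + 2 * r + 2 * s * τ) τ η t =
      exp (-2 * Real.pi * I * (κ + 2 : ℕ) * ((s : ℂ) ^ 2 * τ + s * z)) * repFactor κ l z τ η t := by
  rw [repFactor_eq hκ, repFactor_eq hκ, uFactor, uFactor,
    show z + 2 * r + 2 * s * τ + t = z + t + (2 * r : ℤ) + (2 * s : ℤ) * τ by push_cast; ring,
    theta_add_lattice, show (l * τ + 2 * t - κ * (z + 2 * r + 2 * s * τ) : ℂ) =
      (l * τ + 2 * t - κ * z + (-s : ℤ) * (2 * κ * τ)) + (-2 * κ * r : ℤ) by push_cast; ring,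
    jacobiTheta₂_add_int, jacobiTheta₂_add_int_mul]
  have key : exp (Real.pi * I * ((2 * r : ℤ) + (2 * s : ℤ) - 2 * (2 * s : ℤ) * (z + t) -
      ((2 * s : ℤ) : ℂ) ^ 2 * τ)) * exp (Real.pi * I * (l ^ 2 * τ / (2 * κ) -
        l * (z + 2 * r + 2 * s * τ))) * exp (-(Real.pi * I * (((-s : ℤ) : ℂ) ^ 2 * (2 * κ * τ) +
          2 * (-s : ℤ) * (l * τ + 2 * t - κ * z)))) =
      exp (-2 * Real.pi * I * (κ + 2 : ℕ) * ((s : ℂ) ^ 2 * τ + s * z)) *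
        exp (Real.pi * I * (l ^ 2 * τ / (2 * κ) - l * z)) := by
    rw [← exp_add, ← exp_add, ← exp_add, exp_eq_exp_iff_exists_int]
    exact ⟨r + s - l * r, by push_cast; ring⟩
  linear_combination (theta (z + t) τ * theta (2 * η * l + t) (-2 * η * κ) *
    jacobiTheta₂ (l * τ + 2 * t - κ * z) (2 * κ * τ)) * key

/-- At the points of `2 η + ℤ + ℤ τ` the integral representation takes the same value at `z`
and `-z`; this is an instance of the functional equation of the integral. -/
theorem Lam_repFactor_eq_neg (hτ : 0 < τ.im) (hκ : 0 < κ) (hσ : 0 < (-2 * η * κ).im)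
    (hη : η ∉ pinchSet τ (-2 * η * κ)) (l r s : ℤ) :
    Lam τ (-2 * η * κ) η (repFactor κ l (2 * η + r + s * τ) τ η) =
      Lam τ (-2 * η * κ) η (repFactor κ l (-(2 * η + r + s * τ)) τ η) := by
  have hκ' : (κ : ℂ) ≠ 0 := by exact_mod_cast hκ.ne'
  set z := 2 * η + r + s * τ with hz
  set E : ℂ → ℂ := fun t => exp (Real.pi * I * (-r - s + 2 * s * (t - 2 * η) - s ^ 2 * τ +
    (l ^ 2 * τ / (2 * κ) + l * z))) with hE
  set h : ℂ → ℂ := fun t => E t * theta (2 * η * l + t) (-2 * η * κ) *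
    jacobiTheta₂ (l * τ + 2 * t + κ * z) (2 * κ * τ) with hh
  have hJ := differentiable_jacobiTheta₂ (im_two_mul_pos hκ hτ)
  have e1 : repFactor κ l (-z) τ η = fun t => theta (t - 2 * η) τ * h t := by
    ext t
    rw [repFactor_eq hκ', uFactor,
      show -z + t = t - 2 * η + (-r : ℤ) + (-s : ℤ) * τ by rw [hz]; push_cast; ring,
      theta_add_lattice, show l * τ + 2 * t - κ * (-z) = l * τ + 2 * t + κ * z by ring]
    have key : exp (Real.pi * I * ((-r : ℤ) + (-s : ℤ) - 2 * (-s : ℤ) * (t - 2 * η) -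
        ((-s : ℤ) : ℂ) ^ 2 * τ)) * exp (Real.pi * I * (l ^ 2 * τ / (2 * κ) - l * (-z))) = E t := by
      rw [hE, ← exp_add]; congr 1; push_cast; ring
    simp only [hh]
    linear_combination (theta (t - 2 * η) τ * theta (2 * η * l + t) (-2 * η * κ) *
      jacobiTheta₂ (l * τ + 2 * t + κ * z) (2 * κ * τ)) * key
  have e2 : repFactor κ l z τ η = fun t => (-1) * (theta (t + 2 * η) τ *
      exp (Real.pi * I * (2 * t + (-2 * η * κ))) * h (t + (-2 * η * κ))) := by
    ext t
    simp only [hh]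
    rw [repFactor_eq hκ', uFactor, show z + t = t + 2 * η + r + s * τ by rw [hz]; ring,
      theta_add_lattice, show 2 * η * l + (t + (-2 * η * κ)) =
        2 * η * l + t + (-2 * η * κ) by ring, theta_add_tau,
      show l * τ + 2 * (t + (-2 * η * κ)) + κ * z = (l * τ + 2 * t - κ * z +
        s * (2 * κ * τ)) + (2 * κ * r : ℤ) by rw [hz]; push_cast; ring,
      jacobiTheta₂_add_int, jacobiTheta₂_add_int_mul]
    have key : exp (Real.pi * I * (r + s - 2 * s * (t + 2 * η) - s ^ 2 * τ)) *
        exp (Real.pi * I * (l ^ 2 * τ / (2 * κ) - l * z)) =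
        exp (Real.pi * I * (2 * t + (-2 * η * κ))) * E (t + (-2 * η * κ)) *
          exp (-(Real.pi * I * (2 * (2 * η * l + t) + (-2 * η * κ)))) *
          exp (-(Real.pi * I * (s ^ 2 * (2 * κ * τ) + 2 * s * (l * τ + 2 * t - κ * z)))) := by
      simp only [hE]
      rw [← exp_add, ← exp_add, ← exp_add, ← exp_add, exp_eq_exp_iff_exists_int]
      exact ⟨r + s - l * r - s * κ * r, by rw [hz]; push_cast; ring⟩
    linear_combination (theta (t + 2 * η) τ * theta (2 * η * l + t) (-2 * η * κ) *
      jacobiTheta₂ (l * τ + 2 * t - κ * z) (2 * κ * τ)) * key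
  rw [e1, e2, Lam_const_mul, Lam_theta_sub hτ hσ hη (h := h)]
  · ring
  · have h2 : Differentiable ℂ fun t => theta (2 * η * l + t) (-2 * η * κ) :=
      differentiable_theta_comp hσ (by fun_prop)
    have h3 : Differentiable ℂ fun t => jacobiTheta₂ (l * τ + 2 * t + κ * z) (2 * κ * τ) :=
      hJ.comp (f := fun t => l * τ + 2 * t + κ * z) (by fun_prop)
    simp only [hh, hE]
    fun_prop
  · intro t
    simp only [hh, hE]
    rw [show 2 * η * l + (t + 1) = 2 * η * l + t + 1 by ring, theta_add_one,
      show l * τ + 2 * (t + 1) + κ * z =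
      l * τ + 2 * t + κ * z + (2 : ℤ) by push_cast; ring, jacobiTheta₂_add_int,
      show (Real.pi * I * (-r - s + 2 * s * (t + 1 - 2 * η) - s ^ 2 * τ +
        (l ^ 2 * τ / (2 * κ) + l * z)) : ℂ) = Real.pi * I * (-r - s + 2 * s * (t - 2 * η) -
          s ^ 2 * τ + (l ^ 2 * τ / (2 * κ) + l * z)) + s * (2 * Real.pi * I) by ring, exp_add,
      exp_int_mul_two_pi_mul_I]
    ring

/-- Odd theta functions vanish at the lattice points. -/
theorem eq_zero_of_odd {k : ℕ} {f : ℂ → ℂ} (hf : f ∈ thetaSpace k τ) (hodd : ∀ z, f (-z) = -f z)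
    (r s : ℤ) : f (r + s * τ) = 0 := by
  have h := hf.2 (-(r + s * τ)) r s
  have e : exp (-2 * Real.pi * I * k * ((s : ℂ) ^ 2 * τ + s * (-(r + s * τ)))) = 1 := by
    rw [exp_eq_one_iff]
    exact ⟨k * s * r, by push_cast; ring⟩
  rw [e, show -(r + s * τ) + 2 * r + 2 * s * τ = (r + s * τ : ℂ) by ring, hodd, one_mul] at h
  linear_combination h / 2

/-- Antisymmetrization kills the values at points where `f z = f (-z)`; at the lattice points
oddness suffices. -/
theorem antisymm_mem_oddVanishingSpace {f : ℂ → ℂ} (hf : f ∈ thetaSpace (κ + 2) τ)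
    (hz : ∀ r s : ℤ, f (2 * η + r + s * τ) = f (-(2 * η + r + s * τ))) :
    (fun z => f z - f (-z)) ∈ oddVanishingSpace κ τ η := by
  have hT : (fun z => f z - f (-z)) ∈ thetaSpace (κ + 2) τ := by
    refine sub_mem hf ⟨hf.1.comp differentiable_neg, fun z r s => ?_⟩
    have := hf.2 (-z) (-r) (-s)
    simp only
    rw [show -(z + 2 * r + 2 * s * τ) = -z + 2 * (-r : ℤ) + 2 * (-s : ℤ) * τ by push_cast; ring,
      this]
    congr 2
    push_cast
    ring
  have hodd : ∀ z, (fun z => f z - f (-z)) (-z) = -(fun z => f z - f (-z)) z := fun z => by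
    simp only [neg_neg]; ring
  refine ⟨hT, hodd, fun j h1 h2 r s => ?_⟩
  obtain rfl | rfl | rfl : j = -1 ∨ j = 0 ∨ j = 1 := by omega
  · have := hz (-r) (-s)
    push_cast at this ⊢
    rw [show 2 * η * -1 + r + s * τ = -(2 * η + -r + -s * τ) by ring, neg_neg, this, sub_self]
  · have := eq_zero_of_odd hT hodd r s
    simpa using this
  · have := hz r s
    push_cast
    rw [mul_one, this, sub_self]

end FunctionalEquation

section Dimension

variable {τ η : ℂ}

/-! ### The dimension of the space of odd vanishing theta functions -/

theorem differentiable_dslope {F : ℂ → ℂ} (hF : Differentiable ℂ F) (z : ℂ) :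
    Differentiable ℂ (dslope F z) :=
  differentiableOn_univ.mp ((Complex.differentiableOn_dslope Filter.univ_mem).mpr
    hF.differentiableOn)

/-- The zeros of the theta function are simple, so that an entire function vanishing at these
zeros is divisible by it. -/
theorem exists_eq_theta_mul (hτ : 0 < τ.im) {F : ℂ → ℂ} (hF : Differentiable ℂ F) {w : ℂ}
    (h : ∀ r s : ℤ, F (w + r + s * τ) = 0) :
    ∃ g : ℂ → ℂ, Differentiable ℂ g ∧ ∀ z, F z = theta (z - w) τ * g z := by
  classical
  set T : ℂ → ℂ := fun z => theta (z - w) τ with hT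
  have hTd : Differentiable ℂ T := differentiable_theta_comp hτ (by fun_prop)
  have hFT : ∀ z, T z = 0 → F z = 0 := fun z hz => by
    obtain ⟨r, s, hrs⟩ := (theta_eq_zero_iff hτ _).mp hz
    rw [show z = w + r + s * τ by linear_combination hrs]
    exact h r s
  have hder : ∀ z, T z = 0 → deriv T z ≠ 0 := fun z hz => by
    have := deriv_theta_ne hτ hz
    rwa [hT, deriv_comp_sub_const (f := fun z => theta z τ)]
  set g : ℂ → ℂ := fun z => if T z = 0 then deriv F z / deriv T z else F z / T z with hg
  refine ⟨g, fun z₀ => ?_, fun z => ?_⟩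
  · by_cases hz : T z₀ = 0
    · have h1 : DifferentiableAt ℂ (fun z => dslope F z₀ z / dslope T z₀ z) z₀ :=
        (differentiable_dslope hF z₀ z₀).div (differentiable_dslope hTd z₀ z₀)
          (by rw [dslope_same]; exact hder z₀ hz)
      refine h1.congr_of_eventuallyEq ?_
      have h2 : ∀ᶠ z in nhds z₀, dslope T z₀ z ≠ 0 :=
        (differentiable_dslope hTd z₀).continuous.continuousAt.eventually_ne
          (by rw [dslope_same]; exact hder z₀ hz)
      filter_upwards [h2] with z hz2
      rcases eq_or_ne z z₀ with rfl | hne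
      · simp only [hg, if_pos hz, dslope_same]
      · have e1 := sub_smul_dslope T z₀ z
        have e2 := sub_smul_dslope F z₀ z
        rw [hz, sub_zero, smul_eq_mul] at e1
        rw [hFT _ hz, sub_zero, smul_eq_mul] at e2
        have hsub : z - z₀ ≠ 0 := sub_ne_zero.mpr hne
        have hTz : T z ≠ 0 := by rw [← e1]; exact mul_ne_zero hsub hz2
        simp only [hg, if_neg hTz]
        rw [← e1, ← e2, mul_div_mul_left _ _ hsub]
    · have h1 : DifferentiableAt ℂ (fun z => F z / T z) z₀ := (hF z₀).div (hTd z₀) hz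
      refine h1.congr_of_eventuallyEq ?_
      filter_upwards [hTd.continuous.continuousAt.eventually_ne hz] with z hz2
      simp only [hg, if_neg hz2]
  · change F z = T z * g z
    by_cases hz : T z = 0
    · rw [hFT z hz, hz, zero_mul]
    · simp only [hg, if_neg hz]
      field_simp

/-- The space of even theta functions of level `k`. -/
def evenSpace (k : ℕ) (τ : ℂ) : Submodule ℂ (ℂ → ℂ) where
  carrier := {f | f ∈ thetaSpace k τ ∧ ∀ z, f (-z) = f z}
  add_mem' := by
    rintro f g ⟨hf, hf'⟩ ⟨hg, hg'⟩
    exact ⟨add_mem hf hg, fun z => by simp only [Pi.add_apply, hf', hg']⟩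
  zero_mem' := ⟨zero_mem _, fun z => by simp⟩
  smul_mem' := by
    rintro c f ⟨hf, hf'⟩
    exact ⟨Submodule.smul_mem _ c hf, fun z => by simp [hf']⟩

theorem perEnt_of_mem_thetaSpace {k : ℕ} {f : ℂ → ℂ} (hf : f ∈ thetaSpace k τ) :
    PerEnt fun x => f (2 * x) := by
  refine ⟨hf.1.comp (f := fun x => 2 * x) (by fun_prop), fun x => ?_⟩
  have := hf.2 (2 * x) 1 0
  simp only [Int.cast_one, Int.cast_zero, mul_one, mul_zero, zero_mul, add_zero, ne_eq,
    OfNat.ofNat_ne_zero, not_false_eq_true, zero_pow, exp_zero, one_mul] at this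
  rw [← this]
  congr 1
  ring

theorem fc_add_two_mul {k : ℕ} {f : ℂ → ℂ} (hf : f ∈ thetaSpace k τ) (n : ℤ) :
    ee (n * τ) * fc (fun x => f (2 * x)) n = ee (-(k * τ)) * fc (fun x => f (2 * x)) (n + 2 * k) := by
  have hG := perEnt_of_mem_thetaSpace hf
  rw [← fc_comp_add hG]
  have e : (fun x => f (2 * (x + τ))) =
      fun x => ee (-(k * τ)) * (ee ((-(2 * k : ℤ) : ℤ) * x) * f (2 * x)) := by
    ext x
    have := hf.2 (2 * x) 0 1
    simp only [Int.cast_one, Int.cast_zero, mul_zero, mul_one, add_zero, one_mul, one_pow] at this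
    rw [mul_add, this, ← mul_assoc, ← ee_add, ee]
    congr 2
    push_cast
    ring
  rw [e, fc_const_mul, fc_ee_mul, sub_neg_eq_add]

/-- An even theta function of level `k` is determined by its Fourier coefficients of index
`0, …, k`. -/
theorem eq_zero_of_mem_evenSpace (hτ : 0 < τ.im) {k : ℕ} {f : ℂ → ℂ} (hf : f ∈ evenSpace k τ)
    (h : ∀ n : ℕ, n ≤ k → fc (fun x => f (2 * x)) n = 0) : f = 0 := by
  have hG := perEnt_of_mem_thetaSpace hf.1
  set c := fc (fun x => f (2 * x)) with hc
  have hneg : ∀ n, c (-n) = c n := fun n => by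
    rw [hc, ← fc_neg hG]
    congr 1
    ext x
    rw [mul_neg, hf.2]
  have hrec : ∀ n, c (n + 2 * k) = 0 ↔ c n = 0 := fun n => by
    have := fc_add_two_mul hf.1 n
    rw [← hc] at this
    constructor
    · intro h0
      rw [h0, mul_zero] at this
      exact (mul_eq_zero.mp this).resolve_left (ee_ne_zero _)
    · intro h0
      rw [h0, mul_zero] at this
      exact (mul_eq_zero.mp this.symm).resolve_left (ee_ne_zero _)
  have hall : ∀ n, c n = 0 := by
    rcases Nat.eq_zero_or_pos k with rfl | hk
    · intro n
      rcases eq_or_ne n 0 with rfl | hn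
      · exact h 0 le_rfl
      · have := fc_add_two_mul hf.1 n
        simp only [← hc, Nat.cast_zero, mul_zero, add_zero, zero_mul, neg_zero, ee_zero,
          one_mul] at this
        by_contra hcn
        have h1 : ee (n * τ) = 1 := mul_right_cancel₀ hcn (by rw [this, one_mul])
        obtain ⟨m, hm⟩ := (ee_eq_one_iff _).mp h1
        have := congrArg Complex.im hm
        simp at this
        rcases this with h2 | h2
        · exact hn h2
        · exact hτ.ne' h2
    · have hper : ∀ (m : ℤ) n, c (n + m * (2 * k)) = 0 ↔ c n = 0 := by
        intro m
        induction m with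
        | zero => simp
        | succ m ih =>
          intro n
          rw [← ih n, ← hrec (n + m * (2 * k))]
          congr! 2
          ring
        | pred m ih =>
          intro n
          rw [← ih n, ← hrec]
          congr! 2
          ring
      intro n
      have hk0 : (0 : ℤ) < 2 * k := by positivity
      have h1 := Int.emod_nonneg n hk0.ne'
      have h2 := Int.emod_lt_of_pos n hk0
      have h3 := Int.emod_add_ediv_mul n (2 * k)
      set b := n % (2 * k) with hb
      rw [← h3, hper]
      rcases le_total b k with hbk | hbk
      · obtain ⟨a, ha⟩ : ∃ a : ℕ, (a : ℤ) = b := ⟨b.toNat, by omega⟩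
        rw [← ha]
        exact h a (by omega)
      · rw [← hneg, ← hrec]
        obtain ⟨a, ha⟩ : ∃ a : ℕ, (a : ℤ) = -b + 2 * k := ⟨(-b + 2 * k).toNat, by omega⟩
        rw [← ha]
        exact h a (by omega)
  ext z
  have := eq_zero_of_fc hG hall (z / 2)
  rwa [mul_div_cancel₀ z two_ne_zero] at this

/-- The Fourier coefficients of index `0, …, k` of an even theta function of level `k`. -/
def evenCoeff (k : ℕ) (τ : ℂ) : evenSpace k τ →ₗ[ℂ] Fin (k + 1) → ℂ where
  toFun f := fun i => fc (fun x => (f : ℂ → ℂ) (2 * x)) (i : ℕ)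
  map_add' f g := by
    ext i
    exact fc_add (perEnt_of_mem_thetaSpace f.2.1).diff.continuous
      (perEnt_of_mem_thetaSpace g.2.1).diff.continuous _
  map_smul' a f := by
    ext i
    exact fc_const_mul a _ _

theorem evenCoeff_injective (hτ : 0 < τ.im) (k : ℕ) : Function.Injective (evenCoeff k τ) := by
  rw [injective_iff_map_eq_zero]
  intro f hf
  refine Subtype.ext (eq_zero_of_mem_evenSpace hτ f.2 fun n hn => ?_)
  exact congrFun hf ⟨n, by omega⟩

/-- The odd function of level `6` by which the elements of `oddVanishingSpace` are divisible. -/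
def divisor (τ η z : ℂ) : ℂ := theta z τ * (theta (z - 2 * η) τ * theta (z + 2 * η) τ)

theorem divisor_neg (τ η z : ℂ) : divisor τ η (-z) = -divisor τ η z := by
  rw [divisor, divisor, show -z - 2 * η = -(z + 2 * η) by ring,
    show -z + 2 * η = -(z - 2 * η) by ring, theta_neg, theta_neg, theta_neg]
  ring

theorem divisor_add (τ η z : ℂ) (r s : ℤ) : divisor τ η (z + 2 * r + 2 * s * τ) =
    exp (-2 * Real.pi * I * 6 * ((s : ℂ) ^ 2 * τ + s * z)) * divisor τ η z := by
  have key : ∀ w, theta (w + 2 * r + 2 * s * τ) τ =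
      exp (-(4 * Real.pi * I * (s * w + s ^ 2 * τ))) * theta w τ := by
    intro w
    have := theta_add_int w τ (2 * r)
    rw [theta_add_two_int_mul]
    push_cast at this
    rw [this, zpow_mul]
    norm_num
    left
    rw [exp_eq_exp_iff_exists_int]
    exact ⟨-4 * s * r, by push_cast; ring⟩
  rw [divisor, divisor, show z + 2 * r + 2 * s * τ - 2 * η = z - 2 * η + 2 * r + 2 * s * τ by ring,
    show z + 2 * r + 2 * s * τ + 2 * η = z + 2 * η + 2 * r + 2 * s * τ by ring, key, key, key]
  have : exp (-2 * Real.pi * I * 6 * ((s : ℂ) ^ 2 * τ + s * z)) =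
      exp (-(4 * Real.pi * I * (s * z + s ^ 2 * τ))) *
      exp (-(4 * Real.pi * I * (s * (z - 2 * η) + s ^ 2 * τ))) *
      exp (-(4 * Real.pi * I * (s * (z + 2 * η) + s ^ 2 * τ))) := by
    rw [← exp_add, ← exp_add]; congr 1; ring
  rw [this]
  ring

theorem eq_of_divisor_mul_eq (hτ : 0 < τ.im) {f g : ℂ → ℂ} (hf : Continuous f)
    (hg : Continuous g) (h : ∀ z, divisor τ η z * f z = divisor τ η z * g z) (z : ℂ) :
    f z = g z := by
  have hcount : ∀ w, {z : ℂ | theta (z - w) τ = 0}.Countable := by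
    intro w
    refine (Set.countable_range fun p : ℤ × ℤ => (w + p.1 + p.2 * τ)).mono fun t ht => ?_
    obtain ⟨r, s, hrs⟩ := (theta_eq_zero_iff hτ _).mp ht
    exact ⟨(r, s), by simp only; linear_combination -hrs⟩
  have hc : {z : ℂ | divisor τ η z = 0}.Countable := by
    refine ((hcount 0).union ((hcount (2 * η)).union (hcount (-2 * η)))).mono fun z hz => ?_
    simp only [divisor, Set.mem_ofPred_eq, mul_eq_zero] at hz
    simp only [Set.mem_union, Set.mem_ofPred_eq, sub_zero]
    rwa [show z - -2 * η = z + 2 * η by ring]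
  have hd : Dense {z : ℂ | divisor τ η z = 0}ᶜ := hc.dense_compl ℂ
  exact congrFun (hf.ext_on hd hg fun z hz => mul_left_cancel₀ hz (h z)) z

/-- The three families of zeros are disjoint since `2 η` and `4 η` are not lattice points. -/
theorem exists_eq_divisor_mul (hτ : 0 < τ.im) {κ : ℕ} (hκ : 4 ≤ κ)
    (h4 : ∀ r s : ℤ, 4 * η ≠ r + s * τ) {f : ℂ → ℂ} (hf : f ∈ oddVanishingSpace κ τ η) :
    ∃ g ∈ evenSpace (κ - 4) τ, f = fun z => divisor τ η z * g z := by
  have hne : ∀ z, (∀ r s : ℤ, z ≠ r + s * τ) → theta z τ ≠ 0 := fun z hz h => by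
    obtain ⟨r, s, hrs⟩ := (theta_eq_zero_iff hτ _).mp h
    exact hz r s hrs
  have h2 : ∀ r s : ℤ, 2 * η ≠ r + s * τ := fun r s h => h4 (2 * r) (2 * s) (by
    push_cast; linear_combination 2 * h)
  obtain ⟨hfT, hodd, hv⟩ := hf
  obtain ⟨g₁, hg₁, e₁⟩ := exists_eq_theta_mul hτ hfT.1 (w := 0) fun r s => by
    have := hv 0 (by norm_num) (by norm_num) r s
    simpa using this
  obtain ⟨g₂, hg₂, e₂⟩ := exists_eq_theta_mul hτ hg₁ (w := 2 * η) fun r s => by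
    have := hv 1 (by norm_num) (by norm_num) r s
    rw [e₁] at this
    simp only [Int.cast_one, mul_one, sub_zero] at this
    refine (mul_eq_zero.mp this).resolve_left (hne _ fun r' s' h => ?_)
    exact h2 (r' - r) (s' - s) (by push_cast; linear_combination h)
  obtain ⟨g, hg, e₃⟩ := exists_eq_theta_mul hτ hg₂ (w := -2 * η) fun r s => by
    have := hv (-1) (by norm_num) (by norm_num) r s
    rw [e₁, e₂] at this
    simp only [Int.cast_neg, Int.cast_one, mul_neg, mul_one, sub_zero] at this
    have h5 := (mul_eq_zero.mp this).resolve_left (hne _ fun r' s' h =>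
      h2 (r - r') (s - s') (by push_cast; linear_combination -h))
    have h6 := (mul_eq_zero.mp h5).resolve_left (hne _ fun r' s' h =>
      h4 (r - r') (s - s') (by push_cast; linear_combination -h))
    rwa [neg_mul]
  have e : f = fun z => divisor τ η z * g z := by
    ext z
    rw [e₁, e₂, e₃, divisor, sub_zero, show z - -2 * η = z + 2 * η by ring]
    ring
  refine ⟨g, ⟨⟨hg, fun z r s => ?_⟩, fun z => ?_⟩, e⟩
  · refine eq_of_divisor_mul_eq (η := η) hτ (f := fun z => g (z + 2 * r + 2 * s * τ))
      (g := fun z => exp (-2 * Real.pi * I * (κ - 4 : ℕ) * ((s : ℂ) ^ 2 * τ + s * z)) * g z)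
      (hg.continuous.comp (by fun_prop)) ?_ (fun z => ?_) z
    · have := hg.continuous
      fun_prop
    · have h7 := hfT.2 z r s
      simp only [e] at h7
      rw [divisor_add] at h7
      have h8 : exp (-2 * Real.pi * I * (κ + 2 : ℕ) * ((s : ℂ) ^ 2 * τ + s * z)) =
          exp (-2 * Real.pi * I * 6 * ((s : ℂ) ^ 2 * τ + s * z)) *
          exp (-2 * Real.pi * I * (κ - 4 : ℕ) * ((s : ℂ) ^ 2 * τ + s * z)) := by
        rw [← exp_add]
        congr 1
        obtain ⟨m, rfl⟩ := Nat.exists_eq_add_of_le hκ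
        rw [Nat.add_sub_cancel_left]
        push_cast
        ring
      rw [h8] at h7
      refine mul_left_cancel₀ (exp_ne_zero (-2 * Real.pi * I * 6 * ((s : ℂ) ^ 2 * τ + s * z))) ?_
      linear_combination h7
  · refine eq_of_divisor_mul_eq (η := η) hτ (f := fun z => g (-z))
      (hg.continuous.comp (by fun_prop)) hg.continuous (fun z => ?_) z
    have h7 := hodd z
    simp only [e] at h7
    rw [divisor_neg] at h7
    linear_combination -h7

theorem finrank_oddVanishingSpace_le (hτ : 0 < τ.im) {κ : ℕ} (hκ : 4 ≤ κ)
    (h4 : ∀ r s : ℤ, 4 * η ≠ r + s * τ) :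
    Module.Finite ℂ (oddVanishingSpace κ τ η) ∧
      Module.finrank ℂ (oddVanishingSpace κ τ η) ≤ κ - 3 := by
  have hinj := evenCoeff_injective hτ (κ - 4)
  have hfin : Module.Finite ℂ (evenSpace (κ - 4) τ) := Module.Finite.of_injective _ hinj
  have hrank : Module.finrank ℂ (evenSpace (κ - 4) τ) ≤ κ - 3 := by
    have := LinearMap.finrank_le_finrank_of_injective hinj
    rw [Module.finrank_fin_fun] at this
    omega
  set M : (ℂ → ℂ) →ₗ[ℂ] (ℂ → ℂ) := LinearMap.mulLeft ℂ (divisor τ η) with hM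
  have hle : oddVanishingSpace κ τ η ≤ (evenSpace (κ - 4) τ).map M := by
    intro f hf
    obtain ⟨g, hg, rfl⟩ := exists_eq_divisor_mul hτ hκ h4 hf
    exact ⟨g, hg, rfl⟩
  exact ⟨Submodule.finiteDimensional_of_le hle, (Submodule.finrank_mono hle).trans
    ((Submodule.finrank_map_le M _).trans hrank)⟩

end Dimension

section Inversion

variable {τ η : ℂ}

/-! ### Inversion of a difference operator -/

/-- The difference of the powers with exponent `n` of `ee (2 η)` and of its inverse. -/
def powDiff (η : ℂ) (n : ℤ) : ℂ := ee (n * (2 * η)) - ee (-(n * (2 * η)))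

theorem norm_powDiff_le (η : ℂ) (n : ℤ) :
    ‖powDiff η n‖ ≤ 2 * Real.exp (4 * Real.pi * |η.im|) ^ n.natAbs := by
  have key : ∀ m : ℤ, ‖ee (m * (2 * η))‖ ≤ Real.exp (4 * Real.pi * |η.im|) ^ m.natAbs := by
    intro m
    rw [norm_ee, ← Real.exp_nat_mul, Real.exp_le_exp]
    have h1 : (m * (2 * η)).im = m * (2 * η.im) := by simp
    have h2 : (m.natAbs : ℝ) = |(m : ℝ)| := by rw [Nat.cast_natAbs, Int.cast_abs]
    rw [h1, h2]
    have h3 := neg_abs_le ((m : ℝ) * η.im)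
    rw [abs_mul] at h3
    nlinarith [Real.pi_pos]
  refine (norm_sub_le _ _).trans ?_
  have h1 := key n
  have h2 := key (-n)
  rw [Int.natAbs_neg] at h2
  push_cast at h2
  rw [neg_mul] at h2
  linarith

theorem powDiff_neg (η : ℂ) (n : ℤ) : powDiff η (-n) = -powDiff η n := by
  rw [powDiff, powDiff]
  push_cast
  rw [neg_mul, neg_neg]
  ring

theorem powDiff_zero (η : ℂ) : powDiff η 0 = 0 := by simp [powDiff]

/-- The `m`-th term of the series for `ellNat`. -/
def ellTerm (τ η : ℂ) (n m : ℕ) : ℂ :=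
  ee (((m : ℂ) * (n + m)) * τ) * powDiff η (n + 2 * m : ℕ)

theorem exists_bound_ellTerm (hτ : 0 < τ.im) (η : ℂ) : ∃ u : ℕ → ℝ, Summable u ∧ ∀ n m : ℕ,
    ‖ellTerm τ η n m‖ ≤ Real.exp (4 * Real.pi * |η.im|) ^ n * u m := by
  set A := Real.exp (4 * Real.pi * |η.im|) with hA
  have hT : (0 : ℝ) < 2 * τ.im := by positivity
  have hs := (summable_pow_mul_jacobiTheta₂_term_bound (4 * |η.im|) hT 0).comp_injective
    Nat.cast_injective
  refine ⟨_, hs.mul_left 2, fun n m => ?_⟩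
  rw [ellTerm, norm_mul]
  have h1 := norm_powDiff_le η (n + 2 * m : ℕ)
  rw [Int.natAbs_natCast, ← hA, pow_add] at h1
  have h2 : ‖ee (((m : ℂ) * (n + m)) * τ)‖ ≤ Real.exp (-(2 * Real.pi * (m ^ 2 * τ.im))) := by
    rw [norm_ee, Real.exp_le_exp]
    have : (((m : ℂ) * (n + m)) * τ).im = (m * (n + m)) * τ.im := by
      have : ((m : ℂ) * (n + m)) = ((m * (n + m) : ℝ) : ℂ) := by push_cast; ring
      rw [this, im_ofReal_mul]
    rw [this]
    have h3 : (0 : ℝ) ≤ m * n * τ.im := by positivity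
    nlinarith [Real.pi_pos]
  refine (mul_le_mul h2 h1 (norm_nonneg _) (Real.exp_nonneg _)).trans (le_of_eq ?_)
  have h3 : A ^ (2 * m) = Real.exp (2 * m * (4 * Real.pi * |η.im|)) := by
    rw [hA, ← Real.exp_nat_mul]; push_cast; ring_nf
  have h4 : Real.exp (-Real.pi * (2 * τ.im * (m : ℤ) ^ 2 - 2 * (4 * |η.im|) * |(m : ℤ)|)) =
      Real.exp (-(2 * Real.pi * (m ^ 2 * τ.im))) * Real.exp (2 * m * (4 * Real.pi * |η.im|)) := by
    rw [← Real.exp_add]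
    congr 1
    rw [Nat.abs_cast]
    push_cast
    ring
  simp only [Function.comp_apply, pow_zero, one_mul]
  push_cast at h4 ⊢
  rw [h4, h3]
  ring

/-- The sum `∑ ee (m * (n + m) * τ) * powDiff η (n + 2 * m)`, which solves the recursion of `ell`
for non-negative indices. -/
def ellNat (τ η : ℂ) (n : ℕ) : ℂ := ∑' m, ellTerm τ η n m

theorem summable_ellTerm (hτ : 0 < τ.im) (η : ℂ) (n : ℕ) : Summable (ellTerm τ η n) := by
  obtain ⟨u, hu, hb⟩ := exists_bound_ellTerm hτ η
  exact .of_norm_bounded (hu.mul_left _) (hb n)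

/-- The terms of `ellNat n` after the first are those of `ee ((n + 1) τ) * ellNat (n + 2)`. -/
theorem ellNat_sub (hτ : 0 < τ.im) (η : ℂ) (n : ℕ) :
    ellNat τ η n - ee ((n + 1) * τ) * ellNat τ η (n + 2) = powDiff η n := by
  rw [ellNat, (summable_ellTerm hτ η n).tsum_eq_zero_add, ellNat, ← tsum_mul_left]
  have e : ∀ m, ellTerm τ η n (m + 1) = ee ((n + 1) * τ) * ellTerm τ η (n + 2) m := fun m => by
    rw [ellTerm, ellTerm, ← mul_assoc, ← ee_add, show n + 2 * (m + 1) = n + 2 + 2 * m by ring]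
    congr 2
    push_cast
    ring
  simp only [e, add_sub_cancel_right]
  simp [ellTerm, ee_zero]

/-- A solution of exponential growth of the recursion
`ell n - q ^ (n + 1) * ell (n + 2) = powDiff n`, where `q = ee τ`. For negative `n` it is given by
`ell n = ell (-n) + powDiff n`. -/
def ell (τ η : ℂ) (n : ℤ) : ℂ := ellNat τ η n.natAbs - if n < 0 then powDiff η n.natAbs else 0

theorem exists_expBdd_ell (hτ : 0 < τ.im) (η : ℂ) : ∃ C R, ExpBdd (ell τ η) C R := by
  obtain ⟨u, hu, hb⟩ := exists_bound_ellTerm hτ η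
  have hu0 : ∀ m, 0 ≤ u m := fun m => by
    have := (norm_nonneg _).trans (hb 0 m)
    simpa using this
  refine ⟨∑' m, u m + 2, Real.exp (4 * Real.pi * |η.im|),
    add_nonneg (tsum_nonneg hu0) (by norm_num), Real.exp_nonneg _, fun n => ?_⟩
  have h1 : ‖ellNat τ η n.natAbs‖ ≤ Real.exp (4 * Real.pi * |η.im|) ^ n.natAbs * ∑' m, u m := by
    rw [← tsum_mul_left]
    exact tsum_of_norm_bounded (hu.mul_left _).hasSum (hb _)
  have h2 : ‖if n < 0 then powDiff η n.natAbs else 0‖ ≤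
      2 * Real.exp (4 * Real.pi * |η.im|) ^ n.natAbs := by
    split_ifs
    · have := norm_powDiff_le η n.natAbs
      rwa [Int.natAbs_natCast] at this
    · rw [norm_zero]; positivity
  rw [ell]
  refine (norm_sub_le _ _).trans ?_
  linarith

theorem ell_sub (hτ : 0 < τ.im) (η : ℂ) (n : ℤ) :
    ell τ η n - ee ((n + 1) * τ) * ell τ η (n + 2) = powDiff η n := by
  obtain ⟨m, rfl⟩ | rfl | ⟨m, rfl⟩ :
      (∃ m : ℕ, n = m) ∨ n = -1 ∨ ∃ m : ℕ, n = -(m + 2 : ℕ) := by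
    rcases le_or_gt 0 n with h | h
    · exact .inl ⟨n.toNat, by omega⟩
    · rcases eq_or_ne n (-1) with h1 | h1
      · exact .inr (.inl h1)
      · exact .inr (.inr ⟨(-n - 2).toNat, by omega⟩)
  · have h1 : ((m : ℤ) + 2).natAbs = m + 2 := by omega
    rw [ell, ell, if_neg (by omega), if_neg (by omega), sub_zero, sub_zero, h1, Int.natAbs_natCast]
    exact ellNat_sub hτ η m
  · norm_num [ell, ee_zero, powDiff_neg]
  · have h1 : (-((m + 2 : ℕ) : ℤ) + 2).natAbs = m := by omega
    have h2 : (-((m + 2 : ℕ) : ℤ)).natAbs = m + 2 := by omega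
    rw [ell, ell, if_pos (by omega), h1, h2, powDiff_neg]
    have h3 : (if -((m + 2 : ℕ) : ℤ) + 2 < 0 then powDiff η m else 0) = powDiff η m := by
      split_ifs with h
      · rfl
      · obtain rfl : m = 0 := by omega
        simp [powDiff_zero]
    have h4 : ee (((-((m + 2 : ℕ) : ℤ) : ℤ) + 1) * τ) * ee ((m + 1) * τ) = 1 := by
      rw [← ee_add, show ((-((m + 2 : ℕ) : ℤ) : ℤ) + 1) * τ + (m + 1) * τ = 0 by push_cast; ring,
        ee_zero]
    rw [h3, ← ellNat_sub hτ η m]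
    linear_combination (-ellNat τ η (m + 2)) * h4

/-- The functional `pair (ell τ η)` inverts the difference operator
`g ↦ g - exp(4 π i z + 2 π i τ) g(z + τ)`, up to evaluations at `± 2 η`. -/
theorem pair_ell_sub (hτ : 0 < τ.im) (η : ℂ) {g : ℂ → ℂ} (hg : PerEnt g) :
    pair (ell τ η) g - pair (ell τ η) (fun z => ee (2 * z + τ) * g (z + τ)) =
      g (2 * η) - g (-(2 * η)) := by
  obtain ⟨C, R, hCR⟩ := exists_expBdd_ell hτ η
  have hgτ : PerEnt fun z => g (z + τ) :=
    ⟨hg.diff.comp (by fun_prop), fun z => by rw [add_right_comm, hg.per]⟩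
  have e1 : ∀ n, fc (fun z => ee (2 * z + τ) * g (z + τ)) n = ee ((n - 1) * τ) * fc g (n - 2) := by
    intro n
    have : (fun z => ee (2 * z + τ) * g (z + τ)) =
        fun z => ee τ * (ee ((2 : ℤ) * z) * g (z + τ)) := by
      ext z
      rw [ee_add]
      push_cast
      ring
    rw [this, fc_const_mul, fc_ee_mul, fc_comp_add hg, ← mul_assoc, ← ee_add]
    congr 2
    push_cast
    ring
  have h1 := summable_pair hCR hg
  have hp : PerEnt fun z => ee (2 * z + τ) * g (z + τ) := by
    refine PerEnt.mul ⟨differentiable_ee.comp (f := fun z => 2 * z + τ) (by fun_prop),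
      fun z => ?_⟩ hgτ
    rw [show 2 * (z + 1) + τ = 2 * z + τ + (2 : ℤ) by push_cast; ring, ee_add _ ((2 : ℤ) : ℂ),
      ee_int, mul_one]
  have h2 := summable_pair hCR hp
  have h3 := (hasSum_fc hg (2 * η)).sub (hasSum_fc hg (-(2 * η)))
  -- translating the index by `2` makes the second pairing comparable with the first
  have h5 := h1.tsum_sub ((Equiv.addRight (2 : ℤ)).summable_iff.mpr h2)
  simp only [Function.comp_def] at h5
  rw [← h3.tsum_eq, pair, pair, ← (Equiv.addRight (2 : ℤ)).tsum_eq fun n =>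
    ell τ η n * fc (fun z => ee (2 * z + τ) * g (z + τ)) n, ← h5]
  congr 1
  ext n
  rw [Equiv.coe_addRight, e1, add_sub_cancel_right]
  have := ell_sub hτ η n
  rw [powDiff] at this
  rw [mul_neg]
  push_cast
  rw [show ((n : ℂ) + 2 - 1) * τ = (n + 1) * τ by ring]
  linear_combination (fc g n) * this

end Inversion

/-! ### Pairings in two variables with translated coefficients -/

theorem pair2_add {φ ψ : ℤ → ℂ} {C R C' R' : ℝ} (hφ : ExpBdd φ C R) (hψ : ExpBdd ψ C' R')
    {f g : ℂ → ℂ → ℂ} (hf : PerEnt2 f) (hg : PerEnt2 g) :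
    pair2 φ ψ (fun t s => f t s + g t s) = pair2 φ ψ f + pair2 φ ψ g := by
  rw [pair2, pair2, pair2, ← (summable_pair2 hφ hψ hf).tsum_add (summable_pair2 hφ hψ hg)]
  congr 1
  ext p
  rw [fc2, fc2, fc2, ← mul_add, ← fc_add (hf.fc p.2).diff.continuous (hg.fc p.2).diff.continuous]
  congr 2
  ext t
  exact fc_add (hf.right t).diff.continuous (hg.right t).diff.continuous _

theorem perEnt2_mul_fst_snd {f g : ℂ → ℂ} (hf : PerEnt f) (hg : PerEnt g) :
    PerEnt2 fun t s => f t * g s :=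
  hf.fst.mul hg.snd

/-- The pairing of a product splits. -/
theorem pair2_mul {φ ψ : ℤ → ℂ} {C R C' R' : ℝ} (hφ : ExpBdd φ C R) (hψ : ExpBdd ψ C' R')
    {f g : ℂ → ℂ} (hf : PerEnt f) (hg : PerEnt g) :
    pair2 φ ψ (fun t s => f t * g s) = pair φ f * pair ψ g := by
  rw [← pair_pair hφ hψ (perEnt2_mul_fst_snd hf hg)]
  simp only [pair_const_mul]
  simp only [mul_comm (f _), pair_const_mul]
  ring

theorem pair2_const_mul (φ ψ : ℤ → ℂ) (c : ℂ) (f : ℂ → ℂ → ℂ) :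
    pair2 φ ψ (fun t s => c * f t s) = c * pair2 φ ψ f := by
  simp only [pair2, fc2, fc_const_mul, ← tsum_mul_left]
  congr 1
  ext p
  ring

theorem expBdd_ee (z : ℂ) : ExpBdd (fun n => ee (n * z)) 1 (Real.exp (2 * Real.pi * |z.im|)) := by
  refine ⟨zero_le_one, Real.exp_nonneg _, fun n => ?_⟩
  rw [one_mul, norm_ee, ← Real.exp_nat_mul, Real.exp_le_exp]
  have h1 : (n * z).im = n * z.im := by simp
  have h2 : (n.natAbs : ℝ) = |(n : ℝ)| := by rw [Nat.cast_natAbs, Int.cast_abs]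
  rw [h1, h2]
  have h3 := neg_abs_le ((n : ℝ) * z.im)
  rw [abs_mul] at h3
  nlinarith [Real.pi_pos]

/-- Fourier inversion in two variables. -/
theorem hasSum_fc2 {f : ℂ → ℂ → ℂ} (hf : PerEnt2 f) (x y : ℂ) :
    HasSum (fun p : ℤ × ℤ => ee (p.1 * x) * ee (p.2 * y) * fc2 f p) (f x y) := by
  have h1 := summable_pair2 (expBdd_ee x) (expBdd_ee y) hf
  have h2 := pair_pair (expBdd_ee x) (expBdd_ee y) hf
  have h3 : pair (fun n => ee (n * x)) (fun t => pair (fun n => ee (n * y)) (f t)) = f x y := by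
    simp only [pair_ee (hf.right _)]
    exact pair_ee (hf.left y) x
  rw [← h3, h2]
  exact h1.hasSum

/-- The pairing with the coefficients translated by `n` in both variables. -/
def pairShift (φ ψ : ℤ → ℂ) (f : ℂ → ℂ → ℂ) (n : ℤ) : ℂ :=
  ∑' p : ℤ × ℤ, φ (p.1 - n) * ψ (p.2 - n) * fc2 f p

theorem fc2_ee_mul (f : ℂ → ℂ → ℂ) (w : ℂ) (n : ℤ) (p : ℤ × ℤ) :
    fc2 (fun t s => ee (n * (w - t - s)) * f t s) p =
      ee (n * w) * fc2 f (p.1 + n, p.2 + n) := by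
  have e : ∀ t s : ℂ, ee (n * (w - t - s)) * f t s =
      ee (n * w) * (ee ((-n : ℤ) * t) * (ee ((-n : ℤ) * s) * f t s)) := by
    intro t s
    rw [← mul_assoc, ← mul_assoc, ← ee_add, ← ee_add]
    congr 2
    push_cast
    ring
  simp only [fc2, e, fc_const_mul]
  simp only [fc_ee_mul, sub_neg_eq_add]

/-- Multiplication by a power of `ee (w - t - s)` amounts to a translation of the coefficients. -/
theorem pair2_ee_mul (φ ψ : ℤ → ℂ) (f : ℂ → ℂ → ℂ) (w : ℂ) (n : ℤ) :
    pair2 φ ψ (fun t s => ee (n * (w - t - s)) * f t s) = ee (n * w) * pairShift φ ψ f n := by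
  rw [pair2, pairShift, ← tsum_mul_left, ← ((Equiv.addRight n).prodCongr
    (Equiv.addRight n)).tsum_eq fun p : ℤ × ℤ => ee (n * w) * (φ (p.1 - n) * ψ (p.2 - n) * fc2 f p)]
  congr 1
  ext p
  rw [fc2_ee_mul]
  simp only [Equiv.prodCongr_apply, Equiv.coe_addRight,
    add_sub_cancel_right, Prod.map]
  ring

theorem pairShift_zero (φ ψ : ℤ → ℂ) (f : ℂ → ℂ → ℂ) : pairShift φ ψ f 0 = pair2 φ ψ f := by
  simp [pairShift, pair2]

section Asymptotics

variable {τ σ η : ℂ}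

theorem exists_bound_hcont_ee (hτ : 0 < τ.im) (hσ : 0 < σ.im) (hη : η ∉ pinchSet τ σ) :
    ∃ M : ℝ, 0 ≤ M ∧ ∀ n, ‖hcont (ee τ) (ee σ) n (ee (4 * η))‖ ≤ M := by
  obtain ⟨M, hM0, hM⟩ := exists_bound_hcont (norm_ee_lt_one hτ) (norm_ee_lt_one hσ)
    (mem_interior_poleSet_compl hτ hσ hη)
  exact ⟨M, hM0, hM.self_of_nhds⟩

/-- The coefficients `dco η` and `dco (-η)` grow and decay at inverse rates, so that their
product remains bounded under simultaneous translations. -/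
theorem exists_bound_dco_mul (hτ : 0 < τ.im) (hσ : 0 < σ.im) (hη0 : η.im < 0)
    (hη : η ∉ pinchSet τ σ) (hη' : -η ∉ pinchSet τ σ) :
    ∃ C R : ℝ, 0 ≤ C ∧ 0 ≤ R ∧ ∀ u v n : ℤ,
      ‖dco τ σ η (u - n) * dco τ σ (-η) (v - n)‖ ≤ C * (R ^ u.natAbs * R ^ v.natAbs) := by
  obtain ⟨M, hM0, hM⟩ := exists_bound_hcont_ee hτ hσ hη
  obtain ⟨M', hM0', hM'⟩ := exists_bound_hcont_ee hτ hσ hη'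
  set A := ‖ee (2 * η)‖ with hA
  have hA1 : 1 ≤ A := by
    rw [hA, norm_ee, Real.one_le_exp_iff]
    have : (2 * η).im = 2 * η.im := by simp
    rw [this]
    nlinarith [Real.pi_pos]
  have hA' : ‖ee (2 * -η)‖ = A⁻¹ := by rw [mul_neg, ee_neg, norm_inv]
  refine ⟨M * M', A, mul_nonneg hM0 hM0', by linarith, fun u v n => ?_⟩
  rw [dco, dco, norm_mul, norm_mul, norm_mul, norm_pow, norm_pow, hA', ← hA]
  have h1 : A ^ (u - n).natAbs * A⁻¹ ^ (v - n).natAbs ≤ A ^ u.natAbs * A ^ v.natAbs := by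
    rw [inv_pow, ← div_eq_mul_inv, div_le_iff₀ (by positivity), ← pow_add, ← pow_add]
    exact pow_le_pow_right₀ hA1 (by omega)
  calc _ = A ^ (u - n).natAbs * A⁻¹ ^ (v - n).natAbs *
        (‖hcont (ee τ) (ee σ) (u - n).natAbs (ee (4 * η))‖ *
          ‖hcont (ee τ) (ee σ) (v - n).natAbs (ee (4 * -η))‖) := by ring
    _ ≤ (A ^ u.natAbs * A ^ v.natAbs) * (M * M') := by
        gcongr
        · exact hM _
        · exact hM' _
    _ = _ := by ring

theorem exists_bound_pairShift (hτ : 0 < τ.im) (hσ : 0 < σ.im) (hη0 : η.im < 0)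
    (hη : η ∉ pinchSet τ σ) (hη' : -η ∉ pinchSet τ σ) {f : ℂ → ℂ → ℂ} (hf : PerEnt2 f) :
    ∃ B, ∀ n, ‖pairShift (dco τ σ η) (dco τ σ (-η)) f n‖ ≤ B := by
  obtain ⟨C, R, hC, hR, h⟩ := exists_bound_dco_mul hτ hσ hη0 hη hη'
  obtain ⟨M, hM0, hM⟩ := hf.exists_bound hR
  exact ⟨_, fun n => tsum_of_norm_bounded (summable_half_pow_natAbs_prod.mul_left (C * M)).hasSum
    fun p => hM p _ C hC (h p.1 p.2 n)⟩

/-- The asymptotics of the coefficients at `-∞`. -/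
theorem tendsto_dco (hτ : 0 < τ.im) (hσ : 0 < σ.im) (hη : η ∉ pinchSet τ σ) :
    ∃ h : ℂ, h ≠ 0 ∧ ∀ u : ℤ, Filter.Tendsto
      (fun n : ℕ => ee (-(n * (2 * η))) * dco τ σ η (u - n)) Filter.atTop
        (nhds (ee (u * (-(2 * η))) * h)) := by
  obtain ⟨h, h0, hh⟩ := tendsto_hcont (norm_ee_lt_one hτ) (norm_ee_lt_one hσ)
    (z := ee (4 * η)) (fun hmem => hη ((ee_mem_poleSet_iff τ σ η).mp hmem))
  refine ⟨h, h0, fun u => ?_⟩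
  have h1 : Filter.Tendsto (fun n : ℕ => (u - n).natAbs) Filter.atTop Filter.atTop := by
    refine Filter.tendsto_atTop.mpr fun b => ?_
    filter_upwards [Filter.eventually_ge_atTop (b + u.natAbs)] with n hn
    omega
  refine ((hh.comp h1).const_mul (ee (u * (-(2 * η))))).congr' ?_
  filter_upwards [Filter.eventually_ge_atTop u.natAbs] with n hn
  rw [dco, ← ee_nat_mul, ← mul_assoc, ← ee_add, Function.comp_apply]
  congr 2
  have : ((u - n).natAbs : ℤ) = n - u := by omega
  have h2 : ((u - n).natAbs : ℂ) = n - u := by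
    rw [← Int.cast_natCast (R := ℂ), this]; push_cast; rfl
  rw [h2]
  ring

/-- The exponential factors in the asymptotics of the two sequences cancel. What remains is the
Fourier series of `f` at the point `(-2 η, 2 η)`. -/
theorem tendsto_pairShift (hτ : 0 < τ.im) (hσ : 0 < σ.im) (hη0 : η.im < 0)
    (hη : η ∉ pinchSet τ σ) (hη' : -η ∉ pinchSet τ σ) :
    ∃ c : ℂ, c ≠ 0 ∧ ∀ f : ℂ → ℂ → ℂ, PerEnt2 f → Filter.Tendsto
      (fun n : ℕ => pairShift (dco τ σ η) (dco τ σ (-η)) f n) Filter.atTop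
        (nhds (c * f (-(2 * η)) (2 * η))) := by
  obtain ⟨h, h0, hh⟩ := tendsto_dco hτ hσ hη
  obtain ⟨h', h0', hh'⟩ := tendsto_dco hτ hσ hη'
  refine ⟨h * h', mul_ne_zero h0 h0', fun f hf => ?_⟩
  obtain ⟨C, R, hC, hR, hb⟩ := exists_bound_dco_mul hτ hσ hη0 hη hη'
  obtain ⟨M, hM0, hM⟩ := hf.exists_bound hR
  rw [← (hasSum_fc2 hf (-(2 * η)) (2 * η)).tsum_eq, ← tsum_mul_left]
  refine tendsto_tsum_of_dominated_convergence
    (summable_half_pow_natAbs_prod.mul_left (C * M)) (fun p => ?_)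
    (.of_forall fun n p => hM p _ C hC (hb p.1 p.2 n))
  have h1 := ((hh p.1).mul (hh' p.2)).mul_const (fc2 f p)
  refine (h1.congr fun n => ?_).trans (le_of_eq ?_)
  · have : ee (-(n * (2 * η))) * ee (-(n * (2 * -η))) = 1 := by
      rw [← ee_add, ← ee_zero]; congr 1; ring
    linear_combination (dco τ σ η (p.1 - n) * dco τ σ (-η) (p.2 - n) * fc2 f p) * this
  · congr 1
    rw [show -(2 * -η) = 2 * η by ring]
    ring

/-- If `pair2 (X ^ n * f)` with `X = ee (w - t - s)` does not depend on `n`, it can be evaluated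
by letting `n` tend to infinity. -/
theorem pair2_eq_of_invariant (hτ : 0 < τ.im) (hσ : 0 < σ.im) (hη0 : η.im < 0)
    (hη : η ∉ pinchSet τ σ) (hη' : -η ∉ pinchSet τ σ) : ∃ c : ℂ, c ≠ 0 ∧
    ∀ (f : ℂ → ℂ → ℂ) (d : ℤ), PerEnt2 f →
    (∀ n : ℤ, pair2 (dco τ σ η) (dco τ σ (-η)) (fun t s => ee (n * (d * τ - t - s)) * f t s) =
      pair2 (dco τ σ η) (dco τ σ (-η)) (fun t s => ee ((n + 1 : ℤ) * (d * τ - t - s)) * f t s)) →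
    pair2 (dco τ σ η) (dco τ σ (-η)) f = if d = 0 then c * f (-(2 * η)) (2 * η) else 0 := by
  obtain ⟨c, hc, hlim⟩ := tendsto_pairShift hτ hσ hη0 hη hη'
  refine ⟨c, hc, fun f d hf hinv => ?_⟩
  set P := pair2 (dco τ σ η) (dco τ σ (-η)) f with hP
  have hD : ∀ n : ℤ, ee (n * (d * τ)) * pairShift (dco τ σ η) (dco τ σ (-η)) f n = P := by
    simp only [pair2_ee_mul] at hinv
    intro n
    induction n with
    | zero => simp [ee_zero, pairShift_zero, hP]
    | succ n ih => rw [← hinv]; exact ih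
    | pred n ih =>
      rw [hinv, sub_add_cancel]; exact ih
  split_ifs with hd
  · subst hd
    refine tendsto_nhds_unique ?_ (hlim f hf)
    refine tendsto_const_nhds.congr fun n => ?_
    rw [← hD n]
    simp [ee_zero]
  · obtain ⟨B, hB⟩ := exists_bound_pairShift hτ hσ hη0 hη hη' hf
    have h1 : ∀ n : ℕ, ‖P‖ ≤ ‖ee τ‖ ^ n * B := by
      intro n
      rw [← hD (n * d), norm_mul]
      refine mul_le_mul ?_ (hB _) (norm_nonneg _) (by positivity)
      rw [← norm_pow, ← ee_nat_mul, norm_ee, norm_ee, Real.exp_le_exp]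
      have e1 : (((n * d : ℤ) : ℂ) * (d * τ)).im = (n * (d * d)) * τ.im := by
        have : ((n * d : ℤ) : ℂ) * (d * τ) = ((n * (d * d) : ℝ) : ℂ) * τ := by push_cast; ring
        rw [this, im_ofReal_mul]
      have e2 : (n * τ).im = n * τ.im := by simp
      rw [e1, e2]
      have h2 : (1 : ℝ) ≤ d * d := by
        have : (1 : ℤ) ≤ d * d := by
          rcases lt_or_gt_of_ne hd with h | h <;> nlinarith
        exact_mod_cast this
      have h3 : (0 : ℝ) ≤ n * τ.im := by positivity
      nlinarith [mul_nonneg Real.pi_pos.le (mul_nonneg h3 (sub_nonneg.mpr h2))]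
    have h2 : Filter.Tendsto (fun n : ℕ => ‖ee τ‖ ^ n * B) Filter.atTop (nhds (0 * B)) :=
      (tendsto_pow_atTop_nhds_zero_of_lt_one (norm_nonneg _) (norm_ee_lt_one hτ)).mul_const B
    rw [zero_mul] at h2
    exact norm_le_zero_iff.mp (ge_of_tendsto' h2 h1)

end Asymptotics

section Kernel

variable {τ σ η : ℂ}

/-! ### Products of two hypergeometric integrals -/

theorem antiperiodic_theta (z τ t : ℂ) : theta (z + (t + 1)) τ = -theta (z + t) τ := by
  rw [← add_assoc, theta_add_one]

theorem antiperiodic_theta' (z τ t : ℂ) : theta (t + 1 + z) τ = -theta (t + z) τ := by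
  rw [add_right_comm, theta_add_one]

theorem ee_int_mul_add_one (d : ℤ) (x : ℂ) : ee (d * (x + 1)) = ee (d * x) :=
  (perEnt_ee d).per x

/-- The kernel obtained by applying `pair ell` to a product of two theta functions. -/
def ellKer (τ η : ℂ) (d : ℤ) (t s : ℂ) : ℂ :=
  pair (ell τ η) fun x => ee (d * x) * (theta (x + t) τ * theta (x + s) τ)

theorem perEnt_ellKer_integrand (hτ : 0 < τ.im) (d : ℤ) (t s : ℂ) :
    PerEnt fun x => ee (d * x) * (theta (x + t) τ * theta (x + s) τ) := by
  refine (perEnt_ee d).mul ⟨(differentiable_theta_comp hτ (by fun_prop)).mul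
    (differentiable_theta_comp hτ (by fun_prop)), fun x => ?_⟩
  rw [antiperiodic_theta', antiperiodic_theta', neg_mul_neg]

theorem continuous_ellKer (hτ : 0 < τ.im) (η : ℂ) (d : ℤ) :
    Continuous (Function.uncurry (ellKer τ η d)) := by
  obtain ⟨C, R, hCR⟩ := exists_expBdd_ell hτ η
  refine continuous_pair hCR (f := fun p : ℂ × ℂ => fun x =>
    ee (d * x) * (theta (x + p.1) τ * theta (x + p.2) τ)) ?_
    fun p => perEnt_ellKer_integrand hτ d p.1 p.2
  have h1 : Continuous fun p : (ℂ × ℂ) × ℂ => ee (d * p.2) := continuous_ee.comp (by fun_prop)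
  exact h1.mul ((continuous_theta_comp hτ (by fun_prop)).mul
    (continuous_theta_comp hτ (by fun_prop)))

theorem ellKer_comm (τ η : ℂ) (d : ℤ) (t s : ℂ) : ellKer τ η d t s = ellKer τ η d s t := by
  simp only [ellKer, mul_comm (theta (_ + t) τ)]

theorem differentiable_ellKer (hτ : 0 < τ.im) (η : ℂ) (d : ℤ) (s : ℂ) :
    Differentiable ℂ fun t => ellKer τ η d t s := by
  obtain ⟨C, R, hCR⟩ := exists_expBdd_ell hτ η
  refine differentiable_pair hCR (f := fun t x =>
    ee (d * x) * (theta (x + t) τ * theta (x + s) τ)) ?_ (fun x => ?_)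
    fun t => perEnt_ellKer_integrand hτ d t s
  · have h1 : Continuous fun p : ℂ × ℂ => ee (d * p.2) := continuous_ee.comp (by fun_prop)
    exact h1.mul ((continuous_theta_comp hτ (by fun_prop)).mul
      (continuous_theta_comp hτ (by fun_prop)))
  · exact ((differentiable_theta_comp hτ (by fun_prop)).mul_const _).const_mul _

theorem ellKer_add_one (τ η : ℂ) (d : ℤ) (t s : ℂ) :
    ellKer τ η d (t + 1) s = -ellKer τ η d t s := by
  rw [ellKer, ellKer, ← neg_one_mul, ← pair_const_mul]
  congr 1
  ext x
  rw [antiperiodic_theta]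
  ring

/-- Quasi-periodicity of the theta functions turns the difference operator inverted by `pair ell`
into multiplication by a function of `t` and `s`. -/
theorem one_sub_mul_ellKer (hτ : 0 < τ.im) (η : ℂ) (d : ℤ) (t s : ℂ) :
    (1 - ee (d * τ - t - s)) * ellKer τ η d t s =
      ee (d * (2 * η)) * (theta (t + 2 * η) τ * theta (s + 2 * η) τ) -
        ee (-(d * (2 * η))) * (theta (t - 2 * η) τ * theta (s - 2 * η) τ) := by
  have h := pair_ell_sub hτ η (perEnt_ellKer_integrand hτ d t s)
  have e : (fun x => ee (2 * x + τ) * (ee (d * (x + τ)) *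
      (theta (x + τ + t) τ * theta (x + τ + s) τ))) = fun x => ee (d * τ - t - s) *
        (ee (d * x) * (theta (x + t) τ * theta (x + s) τ)) := by
    ext x
    rw [add_right_comm x τ t, add_right_comm x τ s, theta_add_tau, theta_add_tau]
    have : ee (2 * x + τ) * ee (d * (x + τ)) * (exp (-(Real.pi * I * (2 * (x + t) + τ))) *
        exp (-(Real.pi * I * (2 * (x + s) + τ)))) = ee (d * τ - t - s) * ee (d * x) := by
      simp only [ee, ← exp_add]
      congr 1
      ring
    linear_combination (theta (x + t) τ * theta (x + s) τ) * this
  rw [e, pair_const_mul] at h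
  rw [sub_mul, one_mul, add_comm t, add_comm s, show t - 2 * η = -(2 * η) + t by ring,
    show s - 2 * η = -(2 * η) + s by ring, ← mul_neg]
  exact h

/-- The value of the kernel at the point `(-2 η, 2 η)`, where its defining relation degenerates,
is obtained by differentiation. -/
theorem ellKer_ne_zero (hτ : 0 < τ.im) (h4 : theta (4 * η) τ ≠ 0) :
    ellKer τ η 0 (-(2 * η)) (2 * η) ≠ 0 := by
  intro h0
  have hd := (differentiable_ellKer hτ η 0 (2 * η)).comp
    (f := fun x : ℂ => -(2 * η) + x) (by fun_prop)
  have h1 : HasDerivAt (fun x : ℂ => (1 - ee (-x)) * ellKer τ η 0 (-(2 * η) + x) (2 * η))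
      (deriv (fun x => 1 - ee (-x)) 0 * ellKer τ η 0 (-(2 * η) + 0) (2 * η) +
        (1 - ee (-0)) * deriv (fun x => ellKer τ η 0 (-(2 * η) + x) (2 * η)) 0) 0 := by
    refine HasDerivAt.mul ?_ (hd 0).hasDerivAt
    have : Differentiable ℂ fun x : ℂ => 1 - ee (-x) :=
      (differentiable_ee.comp differentiable_neg).const_sub 1
    exact (this 0).hasDerivAt
  rw [add_zero, h0, neg_zero, ee_zero, sub_self, mul_zero, zero_mul, add_zero] at h1
  have e : (fun x : ℂ => (1 - ee (-x)) * ellKer τ η 0 (-(2 * η) + x) (2 * η)) =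
      fun x => theta x τ * theta (4 * η) τ := by
    ext x
    have := one_sub_mul_ellKer hτ η 0 (-(2 * η) + x) (2 * η)
    rw [sub_self (2 * η), theta_zero] at this
    simp only [Int.cast_zero, zero_mul, zero_sub, neg_zero, ee_zero, one_mul, mul_zero,
      sub_zero] at this
    rw [show -(-(2 * η) + x) - 2 * η = -x by ring, show -(2 * η) + x + 2 * η = x by ring,
      show 2 * η + 2 * η = 4 * η by ring] at this
    exact this
  rw [e] at h1
  have h2 := ((differentiable_theta hτ 0).hasDerivAt.mul_const (theta (4 * η) τ)).unique h1
  exact mul_ne_zero (deriv_theta_zero_ne hτ) h4 h2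

/-- The integrand of the double integral. -/
def dblKer (τ σ η : ℂ) (d : ℤ) (μ ν t s : ℂ) : ℂ :=
  (Nfac τ σ η t * theta (μ + t) σ) * (Nfac τ σ (-η) s * theta (ν + s) σ) * ellKer τ η d t s

theorem perEnt2_dblKer (hτ : 0 < τ.im) (hσ : 0 < σ.im) (η : ℂ) (d : ℤ) (μ ν : ℂ) :
    PerEnt2 (dblKer τ σ η d μ ν) := by
  have n1 := perEnt_Nfac hτ hσ η
  have n2 := perEnt_Nfac hτ hσ (-η)
  have t1 : ∀ z, Differentiable ℂ fun t => theta (z + t) σ := fun z =>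
    differentiable_theta_comp hσ (by fun_prop)
  refine ⟨?_, fun s => ⟨?_, fun t => ?_⟩, fun t => ⟨?_, fun s => ?_⟩⟩
  · exact (((n1.diff.continuous.comp continuous_fst).mul ((t1 μ).continuous.comp
      continuous_fst)).mul ((n2.diff.continuous.comp continuous_snd).mul
        ((t1 ν).continuous.comp continuous_snd))).mul (continuous_ellKer hτ η d)
  · exact ((n1.diff.mul (t1 μ)).mul_const _).mul (differentiable_ellKer hτ η d s)
  · rw [dblKer, dblKer, n1.per, antiperiodic_theta, ellKer_add_one]; ring
  · have e : dblKer τ σ η d μ ν t = fun s => (Nfac τ σ η t * theta (μ + t) σ) *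
        (Nfac τ σ (-η) s * theta (ν + s) σ) * ellKer τ η d s t := by
      ext s
      rw [dblKer, ellKer_comm]
    rw [e]
    exact ((n2.diff.mul (t1 ν)).const_mul _).mul (differentiable_ellKer hτ η d t)
  · rw [dblKer, dblKer, ellKer_comm τ η d t, ellKer_comm τ η d t, n2.per, antiperiodic_theta,
      ellKer_add_one]
    ring

/-- The factor `exp (-2 π i n t) θ(μ + t, σ)`. -/
def expTheta (σ : ℂ) (n : ℤ) (μ t : ℂ) : ℂ := ee (-(n * t)) * theta (μ + t) σ

theorem differentiable_expTheta (hσ : 0 < σ.im) (n : ℤ) (μ : ℂ) :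
    Differentiable ℂ (expTheta σ n μ) :=
  (differentiable_ee.comp (f := fun t : ℂ => -(n * t)) (by fun_prop)).mul
    (differentiable_theta_comp hσ (by fun_prop))

theorem expTheta_add_one (σ : ℂ) (n : ℤ) (μ t : ℂ) :
    expTheta σ n μ (t + 1) = -expTheta σ n μ t := by
  have := ee_int_mul_add_one (-n) t
  rw [Int.cast_neg, neg_mul, neg_mul] at this
  rw [expTheta, expTheta, antiperiodic_theta, this]
  ring

theorem perEnt_theta_expTheta (hτ : 0 < τ.im) (hσ : 0 < σ.im) (w : ℂ) (n : ℤ) (μ : ℂ) :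
    PerEnt fun t => theta (t + w) τ * expTheta σ n μ t := by
  refine ⟨(differentiable_theta_comp hτ (by fun_prop)).mul (differentiable_expTheta hσ n μ),
    fun t => ?_⟩
  rw [expTheta_add_one, antiperiodic_theta', neg_mul_neg]

/-- The functional equation of the integral, for the function `expTheta`. -/
theorem Lam_theta_expTheta (hτ : 0 < τ.im) (hσ : 0 < σ.im) (hη : η ∉ pinchSet τ σ) (n : ℤ)
    (μ : ℂ) : Lam τ σ η (fun t => theta (t + -(2 * η)) τ * expTheta σ n μ t) =
      ee (-(n * σ) - μ) * Lam τ σ η (fun t => theta (t + 2 * η) τ * expTheta σ n μ t) := by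
  have h := Lam_theta_sub hτ hσ hη (differentiable_expTheta hσ n μ) (expTheta_add_one σ n μ)
  simp only [← sub_eq_add_neg]
  rw [h, ← Lam_const_mul, ← neg_one_mul, ← Lam_const_mul]
  congr 1
  ext t
  rw [expTheta, expTheta, ← add_assoc, theta_add_tau]
  have : exp (Real.pi * I * (2 * t + σ)) * (ee (-(n * (t + σ))) *
      exp (-(Real.pi * I * (2 * (μ + t) + σ)))) = ee (-(n * σ) - μ) * ee (-(n * t)) := by
    simp only [ee, ← exp_add]
    congr 1
    ring
  linear_combination (theta (t + 2 * η) τ * theta (μ + t) σ) * this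

/-- The difference of the two sides is a combination of two products of single integrals, which
cancel by the functional equations for `η` and `-η`. -/
theorem pair2_dblKer_succ (hτ : 0 < τ.im) (hσ : 0 < σ.im) (hη : η ∉ pinchSet τ σ)
    (hη' : -η ∉ pinchSet τ σ) {d : ℤ} {μ ν : ℂ} (hd : ν - μ = 4 * η * d) (n : ℤ) :
    pair2 (dco τ σ η) (dco τ σ (-η))
      (fun t s => ee (n * (d * τ - t - s)) * dblKer τ σ η d μ ν t s) =
    pair2 (dco τ σ η) (dco τ σ (-η))
      (fun t s => ee ((n + 1 : ℤ) * (d * τ - t - s)) * dblKer τ σ η d μ ν t s) := by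
  obtain ⟨C, R, hφ⟩ := expBdd_dco hτ hσ hη
  obtain ⟨C', R', hψ⟩ := expBdd_dco hτ hσ hη'
  have n1 := perEnt_Nfac hτ hσ η
  have n2 := perEnt_Nfac hτ hσ (-η)
  have hZ := perEnt2_dblKer hτ hσ η d μ ν
  have hX : ∀ m : ℤ, PerEnt2 fun t s => ee (m * (d * τ - t - s)) * dblKer τ σ η d μ ν t s := by
    intro m
    refine PerEnt2.mul ⟨continuous_ee.comp (by fun_prop), fun s => ⟨differentiable_ee.comp
      (f := fun t => m * (d * τ - t - s)) (by fun_prop), fun t => ?_⟩, fun t =>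
        ⟨differentiable_ee.comp (f := fun s => m * (d * τ - t - s)) (by fun_prop),
          fun s => ?_⟩⟩ hZ
    · rw [show d * τ - t - s = d * τ - (t + 1) - s + 1 by ring, ee_int_mul_add_one]
    · rw [show d * τ - t - s = d * τ - t - (s + 1) + 1 by ring, ee_int_mul_add_one]
  set A : ℂ → ℂ → ℂ := fun w t => Nfac τ σ η t * (theta (t + w) τ * expTheta σ n μ t) with hA
  set B : ℂ → ℂ → ℂ := fun w s => Nfac τ σ (-η) s * (theta (s + w) τ * expTheta σ n ν s) with hB
  have pA : ∀ w, PerEnt (A w) := fun w => n1.mul (perEnt_theta_expTheta hτ hσ w n μ)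
  have pB : ∀ w, PerEnt (B w) := fun w => n2.mul (perEnt_theta_expTheta hτ hσ w n ν)
  have pAB : ∀ c w, PerEnt2 fun t s => c * (A w t * B w s) := fun c w =>
    PerEnt2.mul (f := fun _ _ => c) ⟨continuous_const, fun _ => ⟨differentiable_const _,
      fun _ => rfl⟩, fun _ => ⟨differentiable_const _, fun _ => rfl⟩⟩
      (perEnt2_mul_fst_snd (pA w) (pB w))
  have key : (fun t s => ee (n * (d * τ - t - s)) * dblKer τ σ η d μ ν t s +
      ee (n * (d * τ) - d * (2 * η)) * (A (-(2 * η)) t * B (-(2 * η)) s)) =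
      fun t s => ee ((n + 1 : ℤ) * (d * τ - t - s)) * dblKer τ σ η d μ ν t s +
        ee (n * (d * τ) + d * (2 * η)) * (A (2 * η) t * B (2 * η) s) := by
    ext t s
    have h := one_sub_mul_ellKer hτ η d t s
    simp only [hA, hB, dblKer, expTheta, ← sub_eq_add_neg]
    have e1 : ee ((n + 1 : ℤ) * (d * τ - t - s)) =
        ee (n * (d * τ)) * (ee (-(n * t)) * ee (-(n * s))) * ee (d * τ - t - s) := by
      simp only [← ee_add]; congr 1; push_cast; ring
    have e2 : ee (n * (d * τ - t - s)) =
        ee (n * (d * τ)) * (ee (-(n * t)) * ee (-(n * s))) := by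
      simp only [← ee_add]; congr 1; ring
    rw [e1, e2, sub_eq_add_neg (n * (d * τ)), ee_add, ee_add]
    linear_combination (ee (n * (d * τ)) * (ee (-(n * t)) * ee (-(n * s))) *
      (Nfac τ σ η t * theta (μ + t) σ) * (Nfac τ σ (-η) s * theta (ν + s) σ)) * h
  have h2 := congrArg (pair2 (dco τ σ η) (dco τ σ (-η))) key
  rw [pair2_add hφ hψ (hX n) (pAB _ _), pair2_add hφ hψ (hX (n + 1)) (pAB _ _),
    pair2_const_mul, pair2_const_mul, pair2_mul hφ hψ (pA _) (pB _),
    pair2_mul hφ hψ (pA _) (pB _)] at h2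
  have hm : pair (dco τ σ η) (A (-(2 * η))) =
      ee (-(n * σ) - μ) * pair (dco τ σ η) (A (2 * η)) := Lam_theta_expTheta hτ hσ hη n μ
  have hk : pair (dco τ σ (-η)) (B (2 * η)) =
      ee (-(n * σ) - ν) * pair (dco τ σ (-η)) (B (-(2 * η))) := by
    have := Lam_theta_expTheta hτ hσ hη' n ν
    simp only [mul_neg, neg_neg] at this
    exact this
  have hc : ee (n * (d * τ) - d * (2 * η)) * ee (-(n * σ) - μ) =
      ee (n * (d * τ) + d * (2 * η)) * ee (-(n * σ) - ν) := by
    simp only [← ee_add]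
    congr 1
    linear_combination hd
  rw [hm, hk] at h2
  linear_combination h2 - pair (dco τ σ η) (A (2 * η)) * pair (dco τ σ (-η)) (B (-(2 * η))) * hc

/-- The hypergeometric integral, without its exponential factor, as a function of `x`. -/
def hyp (τ σ η μ x : ℂ) : ℂ := Lam τ σ η (uFactor x μ τ σ)

theorem differentiable_hyp (hτ : 0 < τ.im) (hσ : 0 < σ.im) (hη : η ∉ pinchSet τ σ) (μ : ℂ) :
    Differentiable ℂ (hyp τ σ η μ) := by
  refine differentiable_Lam hτ hσ hη (f := fun x => uFactor x μ τ σ) ?_ (fun t => ?_)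
    fun x => perEnt_uFactor hτ hσ x μ
  · exact (continuous_theta_comp hτ (by fun_prop)).mul (continuous_theta_comp hσ (by fun_prop))
  · exact (differentiable_theta_comp hτ (by fun_prop)).mul_const _

theorem hyp_add_one (τ σ η μ x : ℂ) : hyp τ σ η μ (x + 1) = -hyp τ σ η μ x := by
  rw [hyp, hyp, ← neg_one_mul, ← Lam_const_mul]
  congr 1
  ext t
  rw [uFactor, uFactor, antiperiodic_theta']
  ring

/-- The pairing of `ell` with a product of two hypergeometric integrals is a double integral. -/
theorem pair_ell_hyp_mul (hτ : 0 < τ.im) (hσ : 0 < σ.im) (hη : η ∉ pinchSet τ σ)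
    (hη' : -η ∉ pinchSet τ σ) (d : ℤ) (μ ν : ℂ) :
    pair (ell τ η) (fun x => ee (d * x) * (hyp τ σ η μ x * hyp τ σ (-η) ν x)) =
      pair2 (dco τ σ η) (dco τ σ (-η)) (dblKer τ σ η d μ ν) := by
  obtain ⟨C, R, hφ⟩ := expBdd_dco hτ hσ hη
  obtain ⟨C', R', hψ⟩ := expBdd_dco hτ hσ hη'
  obtain ⟨C'', R'', hl⟩ := exists_expBdd_ell hτ η
  have n1 := perEnt_Nfac hτ hσ η
  have n2 := perEnt_Nfac hτ hσ (-η)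
  have hV := differentiable_hyp hτ hσ hη' ν
  have he : ∀ d : ℤ, Differentiable ℂ fun x => ee (d * x) := fun d => (perEnt_ee d).diff
  have hθ : ∀ z, Differentiable ℂ fun t => theta (z + t) σ := fun z =>
    differentiable_theta_comp hσ (by fun_prop)
  have hθ1 : ∀ t, Differentiable ℂ fun x => theta (x + t) τ := fun t =>
    differentiable_theta_comp hτ (by fun_prop)
  have hθ2 : ∀ x, Differentiable ℂ fun t => theta (x + t) τ := fun t =>
    differentiable_theta_comp hτ (by fun_prop)
  have hθc : Continuous fun p : ℂ × ℂ => theta (p.1 + p.2) τ :=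
    continuous_theta_comp hτ (by fun_prop)
  have p1 : PerEnt2 fun x t =>
      (ee (d * x) * hyp τ σ (-η) ν x) * (Nfac τ σ η t * uFactor x μ τ σ t) := by
    simp only [uFactor]
    refine ⟨?_, fun t => ⟨?_, fun x => ?_⟩, fun x => ⟨?_, fun t => ?_⟩⟩
    · exact (((he d).continuous.comp continuous_fst).mul (hV.continuous.comp continuous_fst)).mul
        ((n1.diff.continuous.comp continuous_snd).mul
          (hθc.mul ((hθ μ).continuous.comp continuous_snd)))
    · exact ((he d).mul hV).mul (((hθ1 t).mul_const _).const_mul _)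
    · rw [ee_int_mul_add_one, hyp_add_one, antiperiodic_theta']; ring
    · exact (n1.diff.mul ((hθ2 x).mul (hθ μ))).const_mul _
    · rw [n1.per, antiperiodic_theta, antiperiodic_theta]; ring
  have p2 : ∀ t, PerEnt2 fun x s => (Nfac τ σ η t * theta (μ + t) σ) *
      ((ee (d * x) * theta (x + t) τ) * (Nfac τ σ (-η) s * uFactor x ν τ σ s)) := by
    intro t
    simp only [uFactor]
    refine ⟨?_, fun s => ⟨?_, fun x => ?_⟩, fun x => ⟨?_, fun s => ?_⟩⟩
    · exact continuous_const.mul ((((he d).continuous.comp continuous_fst).mul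
        ((hθ1 t).continuous.comp continuous_fst)).mul
        ((n2.diff.continuous.comp continuous_snd).mul
          (hθc.mul ((hθ ν).continuous.comp continuous_snd))))
    · exact (((he d).mul (hθ1 t)).mul (((hθ1 s).mul_const _).const_mul _)).const_mul _
    · rw [ee_int_mul_add_one, antiperiodic_theta', antiperiodic_theta']; ring
    · exact ((n2.diff.mul ((hθ2 x).mul (hθ ν))).const_mul _).const_mul _
    · rw [n2.per, antiperiodic_theta, antiperiodic_theta]; ring
  have e1 : (fun x => ee (d * x) * (hyp τ σ η μ x * hyp τ σ (-η) ν x)) = fun x =>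
      pair (dco τ σ η) fun t =>
        (ee (d * x) * hyp τ σ (-η) ν x) * (Nfac τ σ η t * uFactor x μ τ σ t) := by
    ext x
    rw [pair_const_mul, hyp, Lam]
    ring
  rw [e1, pair_comm hl hφ p1, ← pair_pair hφ hψ (perEnt2_dblKer hτ hσ η d μ ν)]
  congr 1
  ext t
  have e2 : (fun x => (ee (d * x) * hyp τ σ (-η) ν x) * (Nfac τ σ η t * uFactor x μ τ σ t)) =
      fun x => pair (dco τ σ (-η)) fun s => (Nfac τ σ η t * theta (μ + t) σ) *
        ((ee (d * x) * theta (x + t) τ) * (Nfac τ σ (-η) s * uFactor x ν τ σ s)) := by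
    ext x
    rw [pair_const_mul, pair_const_mul, hyp, Lam, uFactor]
    ring
  rw [e2, pair_comm hl hψ (p2 t)]
  congr 1
  ext s
  rw [dblKer, ellKer, ← pair_const_mul]
  congr 1
  ext x
  rw [uFactor]
  ring

end Kernel

section Independence

variable {τ σ η : ℂ}

/-! ### Functionals dual to the terms of the series -/

theorem neg_not_mem_pinchSet (hτ : 0 < τ.im) (hσ : 0 < σ.im) (hη : η.im < 0) :
    -η ∉ pinchSet τ σ := by
  rintro ⟨l, m, n, h⟩
  have h' := congrArg Complex.im h
  simp at h'
  have : 0 ≤ (m : ℝ) * τ.im := by positivity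
  have : 0 ≤ (n : ℝ) * σ.im := by positivity
  linarith

/-- Orthogonality of the hypergeometric integrals for `η` and `-η`. -/
theorem exists_pair_ell_hyp_mul (hτ : 0 < τ.im) (hσ : 0 < σ.im) (hη0 : η.im < 0)
    (hη : η ∉ pinchSet τ σ) : ∃ c : ℂ, c ≠ 0 ∧ ∀ (d : ℤ) (μ ν : ℂ), ν - μ = 4 * η * d →
    pair (ell τ η) (fun x => ee (d * x) * (hyp τ σ η μ x * hyp τ σ (-η) ν x)) =
      if d = 0 then c * dblKer τ σ η d μ ν (-(2 * η)) (2 * η) else 0 := by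
  have hη' := neg_not_mem_pinchSet hτ hσ hη0
  obtain ⟨c, hc, h⟩ := pair2_eq_of_invariant hτ hσ hη0 hη hη'
  refine ⟨c, hc, fun d μ ν hd => ?_⟩
  rw [pair_ell_hyp_mul hτ hσ hη hη']
  exact h _ d (perEnt2_dblKer hτ hσ η d μ ν) (pair2_dblKer_succ hτ hσ hη hη' hd)

theorem Nfac_ne_zero (hτ : 0 < τ.im) (hσ : 0 < σ.im) (hη0 : η.im < 0) :
    Nfac τ σ η (-(2 * η)) ≠ 0 := by
  have hq := norm_ee_lt_one hτ
  have hp := norm_ee_lt_one hσ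
  refine mul_ne_zero (Phi_ne_zero hq hp (norm_ee_lt_one ?_)) (Phi_ne_zero hq hp (norm_ee_lt_one ?_))
  · simp; linarith
  · simp; linarith

/-- A zero of the first factor would be a pinching value. -/
theorem Nfac_neg_ne_zero (hτ : 0 < τ.im) (hσ : 0 < σ.im) (hη : η ∉ pinchSet τ σ) :
    Nfac τ σ (-η) (2 * η) ≠ 0 := by
  have hq := norm_ee_lt_one hτ
  have hp := norm_ee_lt_one hσ
  refine mul_ne_zero (fun h => ?_) (Phi_ne_zero hq hp (norm_ee_lt_one ?_))
  · rw [Phi, qprod_eq_zero_iff (summable_pow_pow_norm hq hp)] at h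
    obtain ⟨⟨j, k⟩, hjk⟩ := h
    refine hη ((ee_mem_poleSet_iff τ σ η).mp ⟨j + 1, k + 1, ?_⟩)
    rw [← hjk, show τ + σ + 2 * η - 2 * -η = τ + (σ + 4 * η) by ring, ee_add, ee_add]
    ring
  · simp; linarith

/-- The product with `exp (π i n x)` and with the integral for `-η`, averaged over `x` and
`x + 1` to obtain a function with period `1`. -/
def dualAvg (τ σ η : ℂ) (n : ℤ) (g : ℂ → ℂ) (x : ℂ) : ℂ :=
  1 / 2 * (exp (Real.pi * I * n * x) * hyp τ σ (-η) (2 * η * n) x * g x +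
    exp (Real.pi * I * n * (x + 1)) * hyp τ σ (-η) (2 * η * n) (x + 1) * g (x + 1))

theorem exp_pi_int_mul_add_two (n : ℤ) (x : ℂ) :
    exp (Real.pi * I * n * (x + 1 + 1)) = exp (Real.pi * I * n * x) := by
  rw [exp_eq_exp_iff_exists_int]
  exact ⟨n, by ring⟩

theorem perEnt_dualAvg (hτ : 0 < τ.im) (hσ : 0 < σ.im) (hη0 : η.im < 0) (n : ℤ) {g : ℂ → ℂ}
    (hg : Differentiable ℂ g) (hg2 : ∀ x, g (x + 2) = g x) : PerEnt (dualAvg τ σ η n g) := by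
  have hV := differentiable_hyp hτ hσ (neg_not_mem_pinchSet hτ hσ hη0) (2 * η * n)
  have hV1 : Differentiable ℂ fun x => hyp τ σ (-η) (2 * η * n) (x + 1) := hV.comp (by fun_prop)
  have hg1 : Differentiable ℂ fun x => g (x + 1) := hg.comp (by fun_prop)
  refine ⟨?_, fun x => ?_⟩
  · unfold dualAvg
    fun_prop
  · rw [dualAvg, dualAvg, exp_pi_int_mul_add_two, hyp_add_one _ _ _ _ (x + 1), hyp_add_one,
      show x + 1 + 1 = x + 2 by ring, hg2]
    ring

/-- The functional extracting the coefficient of the term of index `n`. -/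
def dualFun (τ σ η : ℂ) (n : ℤ) (g : ℂ → ℂ) : ℂ := pair (ell τ η) (dualAvg τ σ η n g)

theorem dualFun_const_mul (n : ℤ) (c : ℂ) (g : ℂ → ℂ) :
    dualFun τ σ η n (fun x => c * g x) = c * dualFun τ σ η n g := by
  rw [dualFun, dualFun, ← pair_const_mul]
  congr 1
  ext x
  rw [dualAvg, dualAvg]
  ring

theorem dualFun_add (hτ : 0 < τ.im) (hσ : 0 < σ.im) (hη0 : η.im < 0) (n : ℤ) {f g : ℂ → ℂ}
    (hf : Differentiable ℂ f) (hf2 : ∀ x, f (x + 2) = f x)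
    (hg : Differentiable ℂ g) (hg2 : ∀ x, g (x + 2) = g x) :
    dualFun τ σ η n (fun x => f x + g x) = dualFun τ σ η n f + dualFun τ σ η n g := by
  obtain ⟨C, R, hl⟩ := exists_expBdd_ell hτ η
  rw [dualFun, dualFun, dualFun, ← pair_add hl (perEnt_dualAvg hτ hσ hη0 n hf hf2)
    (perEnt_dualAvg hτ hσ hη0 n hg hg2)]
  congr 1
  ext x
  simp only [dualAvg]
  ring

theorem exists_bound_of_antiperiodic {F : ℂ → ℂ} (hF : Differentiable ℂ F)
    (h : ∀ x, F (x + 1) = -F x) (Y : ℝ) :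
    ∃ M : ℝ, 0 ≤ M ∧ ∀ x : ℂ, |x.im| ≤ Y → ‖F x‖ ≤ M := by
  obtain ⟨M, hM0, hM⟩ := PerEnt.exists_bound (G := fun x => F x * F x)
    ⟨hF.mul hF, fun x => by rw [h, neg_mul_neg]⟩ Y
  refine ⟨M + 1, by linarith, fun x hx => ?_⟩
  have := hM x hx
  rw [norm_mul] at this
  nlinarith [norm_nonneg (F x)]

theorem norm_exp_mul_le {x : ℂ} {Y : ℝ} (hx : |x.im| ≤ Y) (n : ℝ) :
    ‖exp (Real.pi * I * n * x)‖ ≤ Real.exp (Real.pi * |n| * Y) := by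
  rw [norm_exp, Real.exp_le_exp]
  have : (Real.pi * I * n * x : ℂ).re = -(Real.pi * (n * x.im)) := by simp; ring
  rw [this]
  have h1 := neg_abs_le (n * x.im)
  rw [abs_mul] at h1
  have h2 : |n| * |x.im| ≤ |n| * Y := mul_le_mul_of_nonneg_left hx (abs_nonneg n)
  nlinarith [Real.pi_pos]

/-- The dual functionals are continuous with respect to dominated convergence on strips. -/
theorem hasSum_dualFun (hτ : 0 < τ.im) (hσ : 0 < σ.im) (hη0 : η.im < 0) (n : ℤ)
    {F : ℤ → ℂ → ℂ} {g : ℂ → ℂ} (hF : ∀ r, Differentiable ℂ (F r))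
    (hF2 : ∀ r x, F r (x + 2) = F r x)
    (hb : ∀ Y : ℝ, ∃ u : ℤ → ℝ, Summable u ∧ ∀ r (x : ℂ), |x.im| ≤ Y → ‖F r x‖ ≤ u r)
    (h : ∀ x, HasSum (fun r => F r x) (g x)) :
    HasSum (fun r => dualFun τ σ η n (F r)) (dualFun τ σ η n g) := by
  obtain ⟨C, R, hl⟩ := exists_expBdd_ell hτ η
  obtain ⟨Y, hY, hRY⟩ := exists_width R
  obtain ⟨u, hu, hub⟩ := hb Y
  have hV := differentiable_hyp hτ hσ (neg_not_mem_pinchSet hτ hσ hη0) (2 * η * n)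
  obtain ⟨M, hM0, hM⟩ := exists_bound_of_antiperiodic hV (fun x => hyp_add_one _ _ _ _ x) Y
  set E := Real.exp (Real.pi * |(n : ℝ)| * Y) with hE
  refine hasSum_pair hl hY hRY (u := fun r => E * M * u r) (hu.mul_left (E * M))
    (fun r => perEnt_dualAvg hτ hσ hη0 n (hF r) (hF2 r)) (fun r x hx => ?_) fun t => ?_
  · have key : ∀ y : ℂ, |y.im| ≤ Y →
        ‖exp (Real.pi * I * n * y) * hyp τ σ (-η) (2 * η * n) y * F r y‖ ≤ E * M * u r := by
      intro y hy
      rw [norm_mul, norm_mul]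
      have h1 := norm_exp_mul_le hy n
      rw [ofReal_intCast, ← hE] at h1
      gcongr
      · exact hM y hy
      · exact hub r y hy
    have h1 := key x hx
    have h2 := key (x + 1) (by simpa using hx)
    rw [dualAvg, norm_mul]
    have h3 := (norm_add_le _ _).trans (add_le_add h1 h2)
    have h4 : ‖(1 / 2 : ℂ)‖ = 1 / 2 := by norm_num
    rw [h4]
    linarith
  · simp only [dualAvg]
    exact (((h t).mul_left _).add ((h (t + 1)).mul_left _)).mul_left _

/-- The value of a dual functional at the terms of the series, up to constant factors. -/
theorem dualFun_hyp (hτ : 0 < τ.im) (hσ : 0 < σ.im) (hη0 : η.im < 0) (hη : η ∉ pinchSet τ σ) :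
    ∃ c : ℂ, c ≠ 0 ∧ ∀ n j : ℤ,
      dualFun τ σ η n (fun x => exp (-(Real.pi * I * j * x)) * hyp τ σ η (2 * η * j) x) =
        if j = n then c * dblKer τ σ η 0 (2 * η * n) (2 * η * n) (-(2 * η)) (2 * η) else 0 := by
  obtain ⟨c, hc, h⟩ := exists_pair_ell_hyp_mul hτ hσ hη0 hη
  refine ⟨c, hc, fun n j => ?_⟩
  rcases Int.even_or_odd' (n - j) with ⟨d, hd | hd⟩
  · obtain rfl : n = j + 2 * d := by omega
    have e : dualAvg τ σ η (j + 2 * d)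
        (fun x => exp (-(Real.pi * I * j * x)) * hyp τ σ η (2 * η * j) x) = fun x =>
        ee (d * x) * (hyp τ σ η (2 * η * j) x *
          hyp τ σ (-η) (2 * η * (j + 2 * d : ℤ)) x) := by
      ext x
      have key : ∀ y : ℂ, exp (Real.pi * I * (j + 2 * d : ℤ) * y) *
          exp (-(Real.pi * I * j * y)) = ee (d * y) := by
        intro y
        rw [ee, ← exp_add]; congr 1; push_cast; ring
      have k1 := key x
      have k2 := key (x + 1)
      rw [ee_int_mul_add_one] at k2
      rw [dualAvg, hyp_add_one, hyp_add_one]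
      linear_combination (1 / 2 * hyp τ σ η (2 * η * j) x *
        hyp τ σ (-η) (2 * η * (j + 2 * d : ℤ)) x) * (k1 + k2)
    rw [dualFun, e, h d _ _ (by push_cast; ring)]
    rcases eq_or_ne d 0 with rfl | hd0
    · simp
    · rw [if_neg hd0, if_neg (by omega)]
  -- if `n - j` is odd, the two summands of the average cancel
  · have e : dualAvg τ σ η n
        (fun x => exp (-(Real.pi * I * j * x)) * hyp τ σ η (2 * η * j) x) = fun x => 0 * 0 := by
      ext x
      have k : exp (Real.pi * I * n * (x + 1)) * exp (-(Real.pi * I * j * (x + 1))) =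
          -(exp (Real.pi * I * n * x) * exp (-(Real.pi * I * j * x))) := by
        have hnj : (n : ℂ) = j + 2 * d + 1 := by exact_mod_cast (by omega : n = j + 2 * d + 1)
        have h1 := exp_int_mul_two_pi_mul_I d
        rw [← exp_add, ← exp_add, hnj, show (Real.pi * I * (j + 2 * d + 1) * (x + 1) +
          -(Real.pi * I * j * (x + 1)) : ℂ) = (Real.pi * I * (j + 2 * d + 1) * x +
          -(Real.pi * I * j * x)) + Real.pi * I + d * (2 * Real.pi * I) by ring, exp_add, exp_add,
          h1, exp_pi_mul_I]
        ring
      rw [dualAvg, hyp_add_one, hyp_add_one]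
      linear_combination (1 / 2 * hyp τ σ η (2 * η * j) x * hyp τ σ (-η) (2 * η * n) x) * k
    rw [dualFun, e, pair_const_mul, zero_mul, if_neg (by omega)]

end Independence

section Independence

variable {τ η : ℂ} {κ : ℕ}

/-! ### Independence of the hypergeometric theta functions -/

/-- Summable bounds for the terms of the series, uniform in horizontal strips. -/
theorem exists_bound_Lam_repTerm (hτ : 0 < τ.im) (hκ : 0 < κ) (hσ : 0 < (-2 * η * κ).im)
    (hη : η ∉ pinchSet τ (-2 * η * κ)) (l : ℤ) (Y : ℝ) :
    ∃ u : ℤ → ℝ, Summable u ∧ ∀ (r : ℤ) (x : ℂ), |x.im| ≤ Y →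
      ‖Lam τ (-2 * η * κ) η (repTerm κ l x τ η r)‖ ≤ u r := by
  have hτ' := im_two_mul_pos hκ hτ
  obtain ⟨C, R, hCR⟩ := expBdd_dco hτ hσ hη
  obtain ⟨W, hW, hRW⟩ := exists_width R
  have hN := perEnt_Nfac hτ hσ η
  obtain ⟨M₁, hM₁, b₁⟩ := hN.exists_bound W
  obtain ⟨M₂, hM₂, b₂⟩ := exists_bound_of_antiperiodic (differentiable_theta hτ)
    (fun z => theta_add_one z τ) (Y + W)
  obtain ⟨M₃, hM₃, b₃⟩ := exists_bound_of_antiperiodic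
    (F := fun t => theta (2 * η * l + t) (-2 * η * κ))
    (differentiable_theta_comp hσ (by fun_prop)) (fun t => antiperiodic_theta _ _ t) W
  set E := ‖exp (Real.pi * I * (l ^ 2 * τ / (2 * κ)))‖ with hE
  set E' := Real.exp (Real.pi * |(-l : ℝ)| * Y) with hE'
  have hs := summable_pow_mul_jacobiTheta₂_term_bound (|(l * τ).im| + 2 * W + κ * Y) hτ' 0
  simp only [pow_zero, one_mul] at hs
  refine ⟨_, ((((hs.mul_left (E * E')).mul_left (M₂ * M₃)).mul_left M₁).mul_left C).mul_right
    (∑' n : ℤ, (1 / 2 : ℝ) ^ n.natAbs), fun r x hx => ?_⟩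
  refine norm_pair_le hCR (hN.mul (perEnt_repTerm hτ hσ l x r)) hW hRW fun t ht => ?_
  have h1 : ‖exp (Real.pi * I * (l ^ 2 * τ / (2 * κ) - l * x))‖ ≤ E * E' := by
    have := norm_exp_mul_le hx (-l)
    rw [show (Real.pi * I * (l ^ 2 * τ / (2 * κ) - l * x) : ℂ) =
      Real.pi * I * (l ^ 2 * τ / (2 * κ)) + Real.pi * I * (-l : ℝ) * x by push_cast; ring,
      exp_add, norm_mul]
    gcongr
  have h2 : |(l * τ + 2 * t - κ * x).im| ≤ |(l * τ).im| + 2 * W + κ * Y := by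
    have : (l * τ + 2 * t - κ * x).im = (l * τ).im + 2 * t.im - κ * x.im := by simp
    rw [this]
    have h3 : |2 * t.im| ≤ 2 * W := by rw [abs_mul, abs_two]; linarith
    have h4 : |κ * x.im| ≤ κ * Y := by
      rw [abs_mul, Nat.abs_cast]; gcongr
    have h5 := abs_sub ((l * τ).im + 2 * t.im) (κ * x.im)
    have h6 := abs_add_le (l * τ).im (2 * t.im)
    linarith
  have h3 := norm_jacobiTheta₂_term_le hτ' h2 le_rfl r
  have h4 : ‖theta (x + t) τ‖ ≤ M₂ := b₂ _ (by
    rw [add_im]; exact (abs_add_le _ _).trans (add_le_add hx ht))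
  have h5 : ‖theta (2 * η * l + t) (-2 * η * κ)‖ ≤ M₃ := b₃ t ht
  rw [repTerm, uFactor, norm_mul, norm_mul, norm_mul, norm_mul]
  have h6 := b₁ t ht
  gcongr

theorem Q_neg (μ σ η : ℂ) : Q (-μ) σ η = Q μ σ η := by
  rw [Q, Q, show -μ - 2 * η = -(μ + 2 * η) by ring, show -μ + 2 * η = -(μ - 2 * η) by ring,
    theta_neg, theta_neg, neg_mul_neg, mul_comm (theta (μ + 2 * η) σ)]

/-- The kernel of the integral is even in `t`. -/
theorem hyp_neg {σ : ℂ} (hτ : 0 < τ.im) (hσ : 0 < σ.im) (η μ x : ℂ) :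
    hyp τ σ η μ (-x) = hyp τ σ η (-μ) x := by
  rw [hyp, ← Lam_neg hτ hσ η (perEnt_uFactor hτ hσ _ _), hyp]
  congr 1
  ext t
  rw [uFactor, uFactor, show -x + -t = -(x + t) by ring, show μ + -t = -(-μ + t) by ring,
    theta_neg, theta_neg, neg_mul_neg]

/-- The constant factor of the term of index `j`. -/
def termCoeff (κ : ℕ) (τ η c : ℂ) (j : ℤ) : ℂ :=
  c * Q (2 * η * j) (-2 * η * κ) η * exp (Real.pi * I * ((τ + 4 * η) / (2 * κ)) * (j : ℂ) ^ 2)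

theorem deltaTerm_eq_hyp (hη0 : η ≠ 0) {c : ℂ}
    (hc : ∀ z μ, gammaInt τ (-2 * η * κ) η (uFactor z μ τ (-2 * η * κ)) =
      c * Lam τ (-2 * η * κ) η (uFactor z μ τ (-2 * η * κ))) (j : ℤ) (x : ℂ) :
    deltaTerm κ j x τ η = termCoeff κ τ η c j *
      (exp (-(Real.pi * I * j * x)) * hyp τ (-2 * η * κ) η (2 * η * j) x) := by
  rw [deltaTerm, u, hc, termCoeff, hyp,
    show -(Real.pi * I * x * (2 * η * j)) / (2 * η) = -(Real.pi * I * j * x) by field_simp]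
  ring

theorem deltaTerm_neg (hτ : 0 < τ.im) (hσ : 0 < (-2 * η * κ).im) (hη0 : η ≠ 0) {c : ℂ}
    (hc : ∀ z μ, gammaInt τ (-2 * η * κ) η (uFactor z μ τ (-2 * η * κ)) =
      c * Lam τ (-2 * η * κ) η (uFactor z μ τ (-2 * η * κ))) (j : ℤ) (x : ℂ) :
    deltaTerm κ j (-x) τ η = deltaTerm κ (-j) x τ η := by
  rw [deltaTerm_eq_hyp hη0 hc, deltaTerm_eq_hyp hη0 hc, hyp_neg hτ hσ, termCoeff, termCoeff]
  push_cast
  rw [show 2 * η * -(j : ℂ) = -(2 * η * j) by ring, Q_neg, neg_sq,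
    show Real.pi * I * j * -x = Real.pi * I * -j * x by ring]

theorem theta_two_mul_ne_zero (hη : η.im < 0) (hσ : 0 < (-2 * η * κ).im) {m : ℤ}
    (hm : ∀ s : ℤ, m ≠ s * κ) : theta (2 * η * m) (-2 * η * κ) ≠ 0 := by
  intro h
  obtain ⟨r, s, hrs⟩ := (theta_eq_zero_iff hσ _).mp h
  have h' := congrArg Complex.im hrs
  have e1 : (2 * η * m).im = 2 * m * η.im := by
    rw [show 2 * η * m = ((2 * m : ℝ) : ℂ) * η by push_cast; ring, im_ofReal_mul]
  have e2 : ((r : ℂ) + s * (-2 * η * κ)).im = -(2 * s * κ) * η.im := by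
    rw [show (r : ℂ) + s * (-2 * η * κ) = ((r : ℝ) : ℂ) + ((-(2 * s * κ) : ℝ) : ℂ) * η by
      push_cast; ring, add_im, ofReal_im, im_ofReal_mul, zero_add]
  rw [e1, e2] at h'
  have h2 := mul_right_cancel₀ hη.ne h'
  refine hm (-s) ?_
  have : (m : ℝ) = ((-s * κ : ℤ) : ℝ) := by push_cast; linarith
  exact_mod_cast this

theorem not_multiple {m : ℤ} (h1 : 0 < m) (h2 : m < κ) (s : ℤ) : m ≠ s * κ := by
  rintro rfl
  rcases lt_trichotomy s 0 with h | rfl | h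
  · nlinarith
  · simp at h1
  · nlinarith

theorem termCoeff_ne_zero (hκ : 4 ≤ κ) (hη : η.im < 0) (hσ : 0 < (-2 * η * κ).im) {c : ℂ}
    (hc : c ≠ 0) {n : ℤ} (hn : n ∈ Set.Icc (2 : ℤ) (κ - 2)) : termCoeff κ τ η c n ≠ 0 := by
  have h1 := theta_two_mul_ne_zero (m := n - 1) hη hσ
    (not_multiple (by linarith [hn.1]) (by linarith [hn.2]))
  have h2 := theta_two_mul_ne_zero (m := n + 1) hη hσ
    (not_multiple (by linarith [hn.1]) (by linarith [hn.2]))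
  have h3 := theta_two_mul_ne_zero (m := 2) hη hσ (not_multiple (by norm_num) (by omega))
  push_cast at h1 h2 h3
  rw [show 2 * η * (n - 1) = 2 * η * n - 2 * η by ring] at h1
  rw [show 2 * η * (n + 1) = 2 * η * n + 2 * η by ring] at h2
  rw [show 2 * η * 2 = 4 * η by ring] at h3
  exact mul_ne_zero (mul_ne_zero hc (div_ne_zero (mul_ne_zero h3 (deriv_theta_zero_ne hσ))
    (mul_ne_zero h1 h2))) (exp_ne_zero _)

theorem dblKer_ne_zero (hτ : 0 < τ.im) (hη : η.im < 0) (hσ : 0 < (-2 * η * κ).im)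
    (hp : η ∉ pinchSet τ (-2 * η * κ)) (h4 : theta (4 * η) τ ≠ 0) {n : ℤ}
    (hn : n ∈ Set.Icc (2 : ℤ) (κ - 2)) :
    dblKer τ (-2 * η * κ) η 0 (2 * η * n) (2 * η * n) (-(2 * η)) (2 * η) ≠ 0 := by
  have h1 := theta_two_mul_ne_zero (m := n - 1) hη hσ
    (not_multiple (by linarith [hn.1]) (by linarith [hn.2]))
  have h2 := theta_two_mul_ne_zero (m := n + 1) hη hσ
    (not_multiple (by linarith [hn.1]) (by linarith [hn.2]))
  push_cast at h1 h2
  rw [show 2 * η * (n - 1) = 2 * η * n + -(2 * η) by ring] at h1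
  rw [show 2 * η * (n + 1) = 2 * η * n + 2 * η by ring] at h2
  exact mul_ne_zero (mul_ne_zero (mul_ne_zero (Nfac_ne_zero hτ hσ hη) h1)
    (mul_ne_zero (Nfac_neg_ne_zero hτ hσ hp) h2)) (ellKer_ne_zero hτ h4)

/-- The value of the dual functional of index `n` at the term of index `j`. -/
theorem dualFun_deltaTerm (hτ : 0 < τ.im) (hη : η.im < 0) (hσ : 0 < (-2 * η * κ).im)
    (hp : η ∉ pinchSet τ (-2 * η * κ)) {c : ℂ}
    (hc : ∀ z μ, gammaInt τ (-2 * η * κ) η (uFactor z μ τ (-2 * η * κ)) =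
      c * Lam τ (-2 * η * κ) η (uFactor z μ τ (-2 * η * κ))) :
    ∃ c' : ℂ, c' ≠ 0 ∧ ∀ n j : ℤ,
      dualFun τ (-2 * η * κ) η n (fun x => deltaTerm κ j x τ η) =
        if j = n then termCoeff κ τ η c n * (c' *
          dblKer τ (-2 * η * κ) η 0 (2 * η * n) (2 * η * n) (-(2 * η)) (2 * η)) else 0 := by
  have hη0 : η ≠ 0 := fun h => by simp [h] at hη
  obtain ⟨c', hc', h⟩ := dualFun_hyp hτ hσ hη hp
  refine ⟨c', hc', fun n j => ?_⟩
  simp only [deltaTerm_eq_hyp hη0 hc]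
  rw [dualFun_const_mul, h]
  split_ifs with hj
  · rw [hj]
  · rw [mul_zero]

/-- The dual functionals separate the hypergeometric theta functions. -/
theorem dualFun_delta (hκ : 4 ≤ κ) (hτ : 0 < τ.im) (hη : η.im < 0) (hσ : 0 < (-2 * η * κ).im)
    (hp : η ∉ pinchSet τ (-2 * η * κ)) (h4 : theta (4 * η) τ ≠ 0) {n : ℤ}
    (hn : n ∈ Set.Icc (2 : ℤ) (κ - 2)) : ∃ C : ℂ, C ≠ 0 ∧ ∀ l ∈ Set.Icc (2 : ℤ) (κ - 2),
      dualFun τ (-2 * η * κ) η n (fun x => delta κ l x τ η) = if l = n then C else 0 := by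
  have hη0 : η ≠ 0 := fun h => by simp [h] at hη
  have hκ0 : 0 < κ := by omega
  have hκ' : (κ : ℂ) ≠ 0 := by exact_mod_cast hκ0.ne'
  obtain ⟨c, hc0, hc1⟩ := exists_gammaInt_eq hτ hσ
  have hc : ∀ z μ, gammaInt τ (-2 * η * κ) η (uFactor z μ τ (-2 * η * κ)) =
      c * Lam τ (-2 * η * κ) η (uFactor z μ τ (-2 * η * κ)) := fun z μ =>
    (hc1 _ (perEnt_uFactor hτ hσ z μ) η hp).2
  obtain ⟨c', hc', h⟩ := dualFun_deltaTerm hτ hη hσ hp hc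
  set C := termCoeff κ τ η c n * (c' *
    dblKer τ (-2 * η * κ) η 0 (2 * η * n) (2 * η * n) (-(2 * η)) (2 * η)) with hC
  refine ⟨C, mul_ne_zero (termCoeff_ne_zero hκ hη hσ hc0 hn)
    (mul_ne_zero hc' (dblKer_ne_zero hτ hη hσ hp h4 hn)), fun l hl => ?_⟩
  have hd : ∀ j : ℤ, Differentiable ℂ fun x => deltaTerm κ j x τ η := fun j => by
    have := differentiable_hyp hτ hσ hp (2 * η * j)
    simp only [deltaTerm_eq_hyp hη0 hc]
    fun_prop
  have h2 : ∀ (j : ℤ) (x : ℂ), deltaTerm κ j (x + 2) τ η = deltaTerm κ j x τ η := fun j x => by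
    have := exp_pi_int_mul_add_two (-j) x
    push_cast at this
    rw [show Real.pi * I * -j * (x + 1 + 1) = -(Real.pi * I * j * (x + 2)) by ring,
      show Real.pi * I * -j * x = -(Real.pi * I * j * x) by ring] at this
    rw [deltaTerm_eq_hyp hη0 hc, deltaTerm_eq_hyp hη0 hc, this,
      show x + 2 = x + 1 + 1 by ring, hyp_add_one, hyp_add_one, neg_neg]
  have hneg := deltaTerm_neg hτ hσ hη0 hc
  have hsum : ∀ x, HasSum (fun r : ℤ => deltaTerm κ (l + 2 * κ * r) x τ η)
      (deltaTilde κ l x τ η) := fun x => by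
    refine Summable.hasSum ?_
    simp only [deltaTerm_eq hη0 hκ' hc]
    exact ((hasSum_Lam_repTerm hτ hκ0 hσ hp l x).mul_left _).summable
  have hsum2 := hasSum_dualFun hτ hσ hη n
    (F := fun r x => deltaTerm κ (l + 2 * κ * r) x τ η +
      (-1) * deltaTerm κ (-(l + 2 * κ * r)) x τ η) (g := fun x => delta κ l x τ η)
    (fun r => (hd _).add ((hd _).const_mul _)) (fun r x => by simp only [h2]) (fun Y => ?_)
    (fun x => ?_)
  · have e : ∀ r : ℤ, dualFun τ (-2 * η * κ) η n (fun x => deltaTerm κ (l + 2 * κ * r) x τ η +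
        (-1) * deltaTerm κ (-(l + 2 * κ * r)) x τ η) =
        if r = 0 then (if l = n then C else 0) else 0 := by
      intro r
      rw [dualFun_add hτ hσ hη n (hd _) (h2 _) ((hd _).const_mul _) (fun x => by rw [h2]),
        dualFun_const_mul, h, h, ← hC]
      have hl1 := hl.1
      have hl2 := hl.2
      have hn1 := hn.1
      have hn2 := hn.2
      -- of the indices `±(l + 2 κ r)` with `r ∈ ℤ`, only `l` itself lies between `2` and `κ - 2`
      have a1 : -(l + 2 * κ * r) ≠ n := by
        intro h
        rcases le_or_gt 0 r with h0 | h0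
        · nlinarith
        · nlinarith
      have a2 : r ≠ 0 → l + 2 * κ * r ≠ n := by
        intro hr h
        rcases lt_or_gt_of_ne hr with h0 | h0
        · nlinarith
        · nlinarith
      rw [if_neg a1, mul_zero, add_zero]
      split_ifs with h5 h6 h7 h8 h9
      · rfl
      · exact absurd (by simpa [h6] using h5) h7
      · exact absurd h5 (a2 h6)
      · exact absurd (by simpa [h8] using h9) h5
      · rfl
      · rfl
    simp only [e] at hsum2
    exact hsum2.unique (hasSum_ite_eq 0 _)
  · obtain ⟨u, hu, hub⟩ := exists_bound_Lam_repTerm hτ hκ0 hσ hp l Y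
    set K := exp (2 * Real.pi * I * η / κ * l ^ 2) * Q (2 * η * l) (-2 * η * κ) η * c
    have hb : ∀ (r : ℤ) (x : ℂ), |x.im| ≤ Y →
        ‖deltaTerm κ (l + 2 * κ * r) x τ η‖ ≤ ‖K‖ * u r := fun r x hx => by
      rw [deltaTerm_eq hη0 hκ' hc, norm_mul]
      exact mul_le_mul_of_nonneg_left (hub r x hx) (norm_nonneg _)
    refine ⟨fun r => ‖K‖ * u r + ‖K‖ * u r, (hu.mul_left _).add (hu.mul_left _),
      fun r x hx => (norm_add_le _ _).trans (add_le_add (hb r x hx) ?_)⟩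
    rw [← hneg, neg_one_mul, norm_neg]
    exact hb r (-x) (by simpa using hx)
  · simp only [← hneg, neg_one_mul, ← sub_eq_add_neg]
    exact (hsum x).sub (hsum (-x))

theorem linearIndependent_delta (hκ : 4 ≤ κ) (hτ : 0 < τ.im) (hη : η.im < 0)
    (hσ : 0 < (-2 * η * κ).im) (hp : η ∉ pinchSet τ (-2 * η * κ)) (h4 : theta (4 * η) τ ≠ 0)
    (hE : ∀ l : ℤ, (fun z => delta κ l z τ η) ∈ oddVanishingSpace κ τ η) :
    LinearIndependent ℂ fun (l : Set.Icc (2 : ℤ) ((κ : ℤ) - 2)) (z : ℂ) =>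
      delta κ (l : ℤ) z τ η := by
  have hper : ∀ f ∈ thetaSpace (κ + 2) τ, ∀ x, f (x + 2) = f x := fun f hf x => by
    have := hf.2 x 1 0
    simpa using this
  let T : ℤ → thetaSpace (κ + 2) τ →ₗ[ℂ] ℂ := fun n =>
    { toFun := fun f => dualFun τ (-2 * η * κ) η n f
      map_add' := fun f g => dualFun_add hτ hσ hη n f.2.1 (hper _ f.2) g.2.1 (hper _ g.2)
      map_smul' := fun a f => dualFun_const_mul n a f }
  let v : Set.Icc (2 : ℤ) ((κ : ℤ) - 2) → thetaSpace (κ + 2) τ := fun l =>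
    ⟨fun z => delta κ (l : ℤ) z τ η, (hE l).1⟩
  have hv : LinearIndependent ℂ v := by
    rw [linearIndependent_iff']
    intro s a ha n hn
    obtain ⟨C, hC, h⟩ := dualFun_delta hκ hτ hη hσ hp h4 n.2
    have h1 := congrArg (T n) ha
    rw [map_sum, map_zero] at h1
    have h2 : ∀ l ∈ s, T n (a l • v l) = if l = n then a n * C else 0 := fun l _ => by
      rw [map_smul, smul_eq_mul]
      have : T n (v l) = if (l : ℤ) = n then C else 0 := h l l.2
      rw [this]
      simp only [Subtype.ext_iff]
      split_ifs with h3
      · rw [show l = n from Subtype.ext h3]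
      · rw [mul_zero]
    rw [Finset.sum_congr rfl h2, Finset.sum_ite_eq' s n, if_pos hn] at h1
    exact (mul_eq_zero.mp h1).resolve_right hC
  exact hv.map' (thetaSpace (κ + 2) τ).subtype (Submodule.ker_subtype _)

end Independence

theorem hasSum_deltaTerm {κ : ℕ} {τ η : ℂ} (hτ : 0 < τ.im) (hκ : 0 < κ) (hσ : 0 < (-2 * η * κ).im)
    (hp : η ∉ pinchSet τ (-2 * η * κ)) {c : ℂ}
    (hc : ∀ f, PerEnt f → ∀ η' ∉ pinchSet τ (-2 * η * κ),
      GammaIntegrable τ (-2 * η * κ) η' f ∧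
        gammaInt τ (-2 * η * κ) η' f = c * Lam τ (-2 * η * κ) η' f) (l : ℤ) (z : ℂ) :
    HasSum (fun r : ℤ => deltaTerm κ (l + 2 * κ * r) z τ η)
      (exp (2 * Real.pi * I * η / κ * l ^ 2) * Q (2 * η * l) (-2 * η * κ) η * c *
        Lam τ (-2 * η * κ) η (repFactor κ l z τ η)) := by
  have hη0 : η ≠ 0 := fun h => by simp [h] at hσ
  have hκ' : (κ : ℂ) ≠ 0 := by exact_mod_cast hκ.ne'
  simp only [deltaTerm_eq hη0 hκ' fun z μ => (hc _ (perEnt_uFactor hτ hσ z μ) η hp).2]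
  exact (hasSum_Lam_repTerm hτ hκ hσ hp l z).mul_left _

/-- The antisymmetrized functions lie in the space of odd vanishing theta functions. -/
theorem delta_mem {κ : ℕ} {τ η : ℂ} (hτ : 0 < τ.im) (hκ : 0 < κ) (hσ : 0 < (-2 * η * κ).im)
    (hp : η ∉ pinchSet τ (-2 * η * κ)) {K : ℂ} {l : ℤ}
    (hK : ∀ z, deltaTilde κ l z τ η = K * Lam τ (-2 * η * κ) η (repFactor κ l z τ η)) :
    (fun z => delta κ l z τ η) ∈ oddVanishingSpace κ τ η := by
  have hκ' : (κ : ℂ) ≠ 0 := by exact_mod_cast hκ.ne'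
  refine antisymm_mem_oddVanishingSpace (f := fun z => deltaTilde κ l z τ η)
    ⟨?_, fun z r s => ?_⟩ fun r s => ?_
  · simp only [hK]
    exact (differentiable_Lam_repFactor hτ hκ hσ hp l).const_mul _
  · simp only [hK, funext fun t => repFactor_add hκ' l z τ η t r s]
    rw [Lam_const_mul]
    ring
  · simp only [hK]
    rw [Lam_repFactor_eq_neg hτ hκ hσ hp]

end HypergeometricTheta

end

open HypergeometricTheta in
theorem theorem3p1 (κ : ℕ) (hκ : 4 ≤ κ) (τ η : ℂ) (hτ : 0 < τ.im) (hη : η.im < 0)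
    (hreg : ∀ j : ℕ, 1 ≤ j → ∀ n : ℤ, (j : ℂ) * τ + 4 * η ≠ (n : ℂ)) :
    -- (i) the terms of the series are defined, and the series converges to an entire function
    (∀ l : ℤ, HypergeometricTheta.Admissible κ l →
      (∀ (z : ℂ) (r : ℤ), HypergeometricTheta.GammaIntegrable τ (-2 * η * κ) η
        (HypergeometricTheta.uFactor z (2 * η * ((l + 2 * κ * r : ℤ) : ℂ)) τ (-2 * η * κ))) ∧
      (∀ z : ℂ, Summable fun r : ℤ =>
        HypergeometricTheta.deltaTerm κ (l + 2 * κ * r) z τ η) ∧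
      Differentiable ℂ (fun z => HypergeometricTheta.deltaTilde κ l z τ η)) ∧
    -- (ii) the integral representation
    (∀ l : ℤ, HypergeometricTheta.Admissible κ l → ∀ z : ℂ,
      HypergeometricTheta.GammaIntegrable τ (-2 * η * κ) η
        (HypergeometricTheta.repFactor κ l z τ η) ∧
      HypergeometricTheta.deltaTilde κ l z τ η =
        Complex.exp (2 * Real.pi * Complex.I * η / κ * (l : ℂ) ^ 2) *
          HypergeometricTheta.repInt κ l z τ η *
          HypergeometricTheta.Q (2 * η * l) (-2 * η * κ) η) ∧
    -- (iii) the basis of the space `E_κ(τ, η)`, which has dimension `κ - 3`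
    (LinearIndependent ℂ (fun (l : Set.Icc (2 : ℤ) ((κ : ℤ) - 2)) (z : ℂ) =>
        HypergeometricTheta.delta κ (l : ℤ) z τ η) ∧
      Submodule.span ℂ (Set.range (fun (l : Set.Icc (2 : ℤ) ((κ : ℤ) - 2)) (z : ℂ) =>
        HypergeometricTheta.delta κ (l : ℤ) z τ η)) =
        HypergeometricTheta.oddVanishingSpace κ τ η ∧
      Module.finrank ℂ (HypergeometricTheta.oddVanishingSpace κ τ η) = κ - 3) := by
  have hκ0 : 0 < κ := by omega
  have hκR : (0 : ℝ) < κ := by exact_mod_cast hκ0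
  have hσ : 0 < (-2 * η * κ).im := by
    rw [show -2 * η * κ = ((-2 * κ : ℝ) : ℂ) * η by push_cast; ring, Complex.im_ofReal_mul]
    nlinarith
  have hp := not_mem_pinchSet hκ hη hτ hreg
  obtain ⟨c, hc0, hc⟩ := exists_gammaInt_eq hτ hσ
  have hsum := hasSum_deltaTerm hτ hκ0 hσ hp hc
  -- `4 η` lies in the lower half-plane, so it could only be a lattice point with `s < 0`
  have h4 : ∀ r s : ℤ, 4 * η ≠ r + s * τ := by
    intro r s h
    have h' := congrArg Complex.im h
    simp at h'
    have hs : s < 0 := by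
      by_contra! hs
      have : (0 : ℝ) ≤ s * τ.im := mul_nonneg (by exact_mod_cast hs) hτ.le
      linarith
    obtain ⟨m, hm⟩ : ∃ m : ℕ, (m : ℤ) = -s := ⟨(-s).toNat, by omega⟩
    refine hreg m (by omega) r ?_
    have hm' : (m : ℂ) = -s := by exact_mod_cast hm
    rw [h, hm']
    ring
  have h4' : theta (4 * η) τ ≠ 0 := fun h => by
    obtain ⟨r, s, hrs⟩ := (theta_eq_zero_iff hτ _).mp h
    exact h4 r s hrs
  have hE : ∀ l : ℤ, (fun z => delta κ l z τ η) ∈ oddVanishingSpace κ τ η := fun l =>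
    delta_mem hτ hκ0 hσ hp fun z => (hsum l z).tsum_eq
  have hind := linearIndependent_delta hκ hτ hη hσ hp h4' hE
  obtain ⟨hfin, hle⟩ := finrank_oddVanishingSpace_le hτ hκ h4
  refine ⟨fun l _ => ⟨fun z r => (hc _ (perEnt_uFactor hτ hσ _ _) η hp).1,
    fun z => (hsum l z).summable, ?_⟩, fun l _ z => ⟨(hc _ (perEnt_repFactor hτ hκ0 hσ l z) η hp).1,
      ?_⟩, hind, ?_⟩
  · simp only [deltaTilde, (hsum l _).tsum_eq]
    exact (differentiable_Lam_repFactor hτ hκ0 hσ hp l).const_mul _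
  · rw [deltaTilde, (hsum l z).tsum_eq, repInt, (hc _ (perEnt_repFactor hτ hκ0 hσ l z) η hp).2]
    ring
  · have hspan : Submodule.span ℂ (Set.range (fun (l : Set.Icc (2 : ℤ) ((κ : ℤ) - 2)) (z : ℂ) =>
        delta κ (l : ℤ) z τ η)) ≤ oddVanishingSpace κ τ η := by
      rw [Submodule.span_le]
      rintro _ ⟨l, rfl⟩
      exact hE l
    have hcard : Fintype.card (Set.Icc (2 : ℤ) ((κ : ℤ) - 2)) = κ - 3 := by
      rw [Fintype.card_ofFinset, Int.card_Icc]
      omega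
    have hrank := finrank_span_eq_card hind
    rw [hcard] at hrank
    -- the span has dimension `κ - 3`, the upper bound for the dimension of the whole space
    have heq := Submodule.eq_of_le_of_finrank_le hspan (by rw [hrank]; exact hle)
    exact ⟨heq, by rw [← heq, hrank]⟩
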